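/- **Setting.** Let $\mathbb{C}^{8}$ have coordinates $\lambda=(\lambda_4,\lambda_6,\dots,\lambda_{18})$, put $\mathcal P=\mathbb C[\lambda]$, and let $\mathcal B\subset\mathbb C^8$ be the set of $\lambda$ for which the genus $4$ curve $y^2=x^9+\lambda_4x^7+\lambda_6x^6+\dots+\lambda_{16}x+\lambda_{18}$ in $\mathbb C^2$ is nonsingular. With the conventions $\lambda_0=1$ and $\lambda_s=0$ for $s\notin\{0,4,6,\dots,18\}$, set for $1\le k\le m\le 8$ $$v_{2k,2m}=v_{2m,2k}=\sum_{s=0}^{k-1}2(k+m-2s)\lambda_{2s}\lambda_{2(k+m-s)}-\frac{2k(9-m)}{9}\lambda_{2k}\lambda_{2m},\qquad L_{2k}=\sum_{s=2}^{9}v_{2k+2,2s-2}\frac{\partial}{\partial\lambda_{2s}}\quad(0\le k\le 7).$$ Let $\mathbb C^{12}$ have coordinates $b_{i,j}$, $i\in\{1,2,3\}$, $j\in\{1,3,5,7\}$, of weight $i+j$ (and $b_{i,j}=0$ for an index out of range). The polynomial map $\rho:\mathbb C^{12}\to\mathbb C^8$ is $b\mapsto(\lambda_4(b),\dots,\lambda_{18}(b))$,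 where $$\begin{aligned} \lambda_4&=-3b_{1,1}^2+\tfrac12b_{3,1}-2b_{1,3},\\ \lambda_6&=2b_{1,1}^3+\tfrac14b_{2,1}^2-\tfrac12b_{1,1}b_{3,1}-2b_{1,1}b_{1,3}+\tfrac12b_{3,3}-2b_{1,5},\\ \lambda_8&=4b_{1,1}^2b_{1,3}+b_{1,3}^2-2b_{1,1}b_{1,5}+\tfrac12b_{3,5}-2b_{1,7}-\tfrac12(b_{3,1}b_{1,3}-b_{2,1}b_{2,3}+b_{1,1}b_{3,3}),\\ \lambda_{10}&=2(b_{1,1}b_{1,3}^2+b_{1,5}b_{1,3}-b_{1,1}b_{1,7}+2b_{1,1}^2b_{1,5})+\tfrac14b_{2,3}^2-\tfrac12(b_{1,3}b_{3,3}-b_{3,7}+b_{3,1}b_{1,5}-b_{2,1}b_{2,5}+b_{1,1}b_{3,5}),\\ \lambda_{12}&=4b_{1,1}(b_{1,3}b_{1,5}+b_{1,1}b_{1,7})+b_{1,5}^2+2b_{1,3}b_{1,7}-\tfrac12(b_{3,3}b_{1,5}-b_{2,3}b_{2,5}+b_{1,3}b_{3,5}+b_{3,1}b_{1,7}-b_{2,1}b_{2,7}+b_{1,1}b_{3,7}),\\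 \lambda_{14}&=2b_{1,1}b_{1,5}^2+\tfrac14b_{2,5}^2-\tfrac12b_{1,5}b_{3,5}+4b_{1,1}b_{1,3}b_{1,7}+2b_{1,5}b_{1,7}-\tfrac12(b_{3,3}b_{1,7}-b_{2,3}b_{2,7}+b_{1,3}b_{3,7}),\\ \lambda_{16}&=4b_{1,1}b_{1,5}b_{1,7}+b_{1,7}^2-\tfrac12(b_{3,5}b_{1,7}-b_{2,5}b_{2,7}+b_{1,5}b_{3,7}),\\ \lambda_{18}&=2b_{1,1}b_{1,7}^2+\tfrac14b_{2,7}^2-\tfrac12b_{1,7}b_{3,7}. \end{aligned}$$ Define also $p_{k,l}=p_{l,k}\in\mathbb C[b]$ for $k,l\in\{1,3,5,7\}$ by $p_{1,k}=2b_{1,k}$ and $$\begin{aligned} p_{3,3}&=6b_{1,1}b_{1,3}-b_{3,3}+6b_{1,5},\quad p_{3,5}=6b_{1,1}b_{1,5}-b_{3,5}+6b_{1,7},\quad p_{3,7}=6b_{1,1}b_{1,7}-b_{3,7},\\ p_{5,5}&=b_{3,1}b_{1,5}-b_{2,1}b_{2,5}+b_{1,1}b_{3,5}-2(4b_{1,1}^2+b_{1,3})b_{1,5}+10b_{1,1}b_{1,7}-2b_{3,7},\\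 p_{5,7}&=b_{3,1}b_{1,7}-b_{2,1}b_{2,7}+b_{1,1}b_{3,7}-2(4b_{1,1}^2+b_{1,3})b_{1,7},\\ p_{7,7}&=b_{3,3}b_{1,7}-b_{2,3}b_{2,7}+b_{1,3}b_{3,7}-2(4b_{1,1}b_{1,3}+b_{1,5})b_{1,7}. \end{aligned}$$ A polynomial vector field $\mathcal D$ on $\mathbb C^{12}$ is *projectable* for $\rho$ with *pushforward* $L$, a polynomial vector field on $\mathbb C^8$, if $\mathcal D(\rho^*f)=\rho^*(L(f))$ for all $f\in\mathcal P$. Polynomials in $\lambda$ act on fields on $\mathbb C^{12}$ through $\rho^*$. **Conditions.** Let $S=\{0,1,2,3,4,5,6,7,8,10,12,14\}$. Consider polynomial vector fields $\mathcal D_s$, $s\in S$, on $\mathbb C^{12}$ such that: (a) $\mathcal D_0(b_{i,j})=(i+j)b_{i,j}$; $\mathcal D_1(b_{1,j})=b_{2,j}$, $\mathcal D_1(b_{2,j})=b_{3,j}$, $\mathcal D_1(b_{3,j})=4(2b_{1,1}b_{2,j}+b_{2,1}b_{1,j}+b_{2,j+2})$; and $\mathcal D_s(b_{i,j})=\tfrac12\mathcal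 D_1^{\,i}(p_{s,j})$ for $s\in\{3,5,7\}$. Write $p'_{i,j}=\mathcal D_1(p_{i,j})$, $p''_{i,j}=\mathcal D_1(\mathcal D_1(p_{i,j}))$. (b) The fields $\mathcal D_2,\mathcal D_4$ satisfy $$\begin{aligned} \mathcal D_2(b_{1,1})&=-b_{1,1}^2+\tfrac12b_{3,1}+2b_{1,3}+\tfrac79\lambda_4,\\ \mathcal D_2(b_{1,3})&=-b_{1,1}b_{1,3}+\tfrac12b_{3,3}+3b_{1,5}-\tfrac43\lambda_4b_{1,1}+\tfrac12p_{3,3},\\ \mathcal D_2(b_{1,5})&=-b_{1,1}b_{1,5}+\tfrac12b_{3,5}+5b_{1,7}-\tfrac89\lambda_4b_{1,3}+\tfrac12p_{3,5},\\ \mathcal D_2(b_{1,7})&=-b_{1,1}b_{1,7}+\tfrac12b_{3,7}-\tfrac49\lambda_4b_{1,5}+\tfrac12p_{3,7},\\ \mathcal D_4(b_{1,1})&=-2b_{1,1}b_{1,3}+b_{3,3}+2b_{1,5}+\tfrac23\lambda_6,\\ \mathcal D_4(b_{1,3})&=-b_{1,3}^2+3b_{1,7}+\lambda_4b_{1,3}-2\lambda_6b_{1,1}-\lambda_8-\tfrac12b_{1,1}p_{3,3}+\tfrac12p_{3,3}''+\tfrac12p_{3,5},\\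 \mathcal D_4(b_{1,5})&=-b_{1,3}b_{1,5}+3\lambda_4b_{1,5}-\tfrac43\lambda_6b_{1,3}-\tfrac12b_{1,1}p_{3,5}+\tfrac12p_{3,5}''+\tfrac12p_{5,5},\\ \mathcal D_4(b_{1,7})&=-b_{1,3}b_{1,7}+5\lambda_4b_{1,7}-\tfrac23\lambda_6b_{1,5}-\tfrac12b_{1,1}p_{3,7}+\tfrac12p_{3,7}''+\tfrac12p_{5,7},\\ [\mathcal D_1,\mathcal D_2]&=b_{1,1}\mathcal D_1-\mathcal D_3,\qquad[\mathcal D_1,\mathcal D_4]=b_{1,3}\mathcal D_1+b_{1,1}\mathcal D_3-\mathcal D_5. \end{aligned}$$ (c) The remaining fields are given recursively by $$\begin{aligned} \mathcal D_6&=\tfrac14\bigl(2[\mathcal D_2,\mathcal D_4]+b_{2,3}\mathcal D_1-b_{2,1}\mathcal D_3\bigr)-\tfrac43(\lambda_6\mathcal D_0-\lambda_4\mathcal D_2),\\ \mathcal D_8&=\tfrac18\bigl(2[\mathcal D_2,\mathcal D_6]+(\tfrac12p'_{3,3}+b_{2,5})\mathcal D_1-b_{2,3}\mathcal D_3-b_{2,1}\mathcal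 D_5\bigr)-\tfrac59(\lambda_8\mathcal D_0-\lambda_4\mathcal D_4),\\ \mathcal D_{10}&=\tfrac1{12}\bigl(2[\mathcal D_2,\mathcal D_8]+(p'_{3,5}+b_{2,7})\mathcal D_1-b_{2,5}\mathcal D_3-b_{2,3}\mathcal D_5-b_{2,1}\mathcal D_7\bigr)-\tfrac8{27}(\lambda_{10}\mathcal D_0-\lambda_4\mathcal D_6),\\ \mathcal D_{12}&=\tfrac1{16}\bigl(2[\mathcal D_2,\mathcal D_{10}]+(p'_{3,7}+\tfrac12p'_{5,5})\mathcal D_1-b_{2,7}\mathcal D_3-b_{2,5}\mathcal D_5-b_{2,3}\mathcal D_7\bigr)-\tfrac16(\lambda_{12}\mathcal D_0-\lambda_4\mathcal D_8),\\ \mathcal D_{14}&=\tfrac1{20}\bigl(2[\mathcal D_2,\mathcal D_{12}]+p'_{5,7}\mathcal D_1-b_{2,7}\mathcal D_5-b_{2,5}\mathcal D_7\bigr)-\tfrac4{45}(\lambda_{14}\mathcal D_0-\lambda_4\mathcal D_{10}). \end{aligned}$$ **Theorem.** There is exactly one family $(\mathcal D_s)_{s\in S}$ of polynomial vector fields on $\mathbb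 C^{12}$ satisfying (a), (b), (c), and it has the following properties. 1. Each $\mathcal D_s$ is homogeneous of weight $s$: $\mathcal D_s(b_{i,j})$ is weighted homogeneous of weight $i+j+s$. 2. All $\mathcal D_s$ are projectable for $\rho$; the pushforwards of $\mathcal D_1,\mathcal D_3,\mathcal D_5,\mathcal D_7$ are $0$, and the pushforward of $\mathcal D_{2k}$ is $L_{2k}$ for $k=0,1,\dots,7$. 3. The twelve fields are linearly independent at every point of $\rho^{-1}(\mathcal B)$. 4. The $\mathbb C[b]$-module generated by the $\mathcal D_s$ is closed under the commutator. There are unique polynomials $c_{2i,2j}^{2k}\in\mathcal P$, $0\le i,j,k\le7$, with $[L_{2i},L_{2j}]=\sum_{k=0}^7c_{2i,2j}^{2k}L_{2k}$; the $c_{2,2j}^{2k}$, $2\le j\le7$, are given by $\sum_kc_{2,2j}^{2k}L_{2k}=2(j-1)L_{2j+2}+\tfrac{4(8-j)}{9}(\lambda_{2j+2}L_0-\lambda_4L_{2j-2})$, with the term $L_{2j+2}$ absent for $j=7$. The commutation relations are as follows, where $\vec{\mathcal D}=(\mathcal D_1,\mathcal D_3,\mathcal D_5,\mathcal D_7)^\top$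 and $q_{i,j,k}=\mathcal D_i(p_{j,k})$. * $[\mathcal D_0,\mathcal D_k]=k\mathcal D_k$ for $k\in S$, and $[\mathcal D_k,\mathcal D_m]=0$ for $k,m\in\{1,3,5,7\}$. * For $k=1,\dots,7$, $$\begin{aligned}[\mathcal D_1,\mathcal D_{2k}]&=(M_1)_k\vec{\mathcal D},&[\mathcal D_3,\mathcal D_{2k}]&=\tfrac12(M_3)_k\vec{\mathcal D}+\tfrac{8-k}3\lambda_{2k+2}\mathcal D_1,\\ [\mathcal D_5,\mathcal D_{2k}]&=\tfrac12(M_5)_k\vec{\mathcal D}+\tfrac{4(k+1)}9\lambda_{2k+2}\mathcal D_3,&[\mathcal D_7,\mathcal D_{2k}]&=\tfrac12(M_7)_k\vec{\mathcal D}+\tfrac{2(k+1)}9\lambda_{2k+2}\mathcal D_5,\end{aligned}$$ where $(M)_k$ is the $k$-th row of $M$ and $$M_1=\begin{pmatrix}b_{1,1}&-1&0&0\\b_{1,3}&b_{1,1}&-1&0\\b_{1,5}&b_{1,3}&b_{1,1}&-1\\b_{1,7}&b_{1,5}&b_{1,3}&b_{1,1}\\0&b_{1,7}&b_{1,5}&b_{1,3}\\0&0&b_{1,7}&b_{1,5}\\0&0&0&b_{1,7}\end{pmatrix},\quad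 M_3=\begin{pmatrix}2b_{1,3}-2\lambda_4&0&-6&0\\p_{3,3}&2b_{1,3}-2\lambda_4&0&-6\\p_{3,5}&p_{3,3}&2b_{1,3}-2\lambda_4&0\\p_{3,7}&p_{3,5}&p_{3,3}&2b_{1,3}-2\lambda_4\\0&p_{3,7}&p_{3,5}&p_{3,3}\\0&0&p_{3,7}&p_{3,5}\\0&0&0&p_{3,7}\end{pmatrix},$$ $$M_5=\begin{pmatrix}2b_{1,5}&0&0&-10\\p_{3,5}&2b_{1,5}&-6\lambda_4&0\\p_{5,5}&p_{3,5}&2b_{1,5}-4\lambda_6&-6\lambda_4\\p_{5,7}-2\lambda_{12}&p_{5,5}&p_{3,5}-2\lambda_8&2b_{1,5}-4\lambda_6\\-4\lambda_{14}&p_{5,7}-2\lambda_{12}&p_{5,5}&p_{3,5}-2\lambda_8\\-6\lambda_{16}&-4\lambda_{14}&p_{5,7}&p_{5,5}\\-8\lambda_{18}&-6\lambda_{16}&0&p_{5,7}\end{pmatrix},\quad M_7=\begin{pmatrix}2b_{1,7}&0&0&0\\p_{3,7}&2b_{1,7}&0&-10\lambda_4\\p_{5,7}&p_{3,7}&2b_{1,7}&-8\lambda_6\\p_{7,7}&p_{5,7}&p_{3,7}&2b_{1,7}-6\lambda_8\\-2\lambda_{16}&p_{7,7}&p_{5,7}&p_{3,7}-4\lambda_{10}\\-4\lambda_{18}&-2\lambda_{16}&p_{7,7}&p_{5,7}-2\lambda_{12}\\0&-4\lambda_{18}&-2\lambda_{16}&p_{7,7}\end{pmatrix}.$$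 * For $j=2,\dots,7$, $[\mathcal D_2,\mathcal D_{2j}]=\sum_{k=0}^7c_{2,2j}^{2k}(\lambda)\mathcal D_{2k}+\tfrac12(A_2)_{j-1}\vec{\mathcal D}$, where $$A_2=\begin{pmatrix}-b_{2,3}&b_{2,1}&0&0\\-\frac12p'_{3,3}-b_{2,5}&b_{2,3}&b_{2,1}&0\\-p'_{3,5}-b_{2,7}&b_{2,5}&b_{2,3}&b_{2,1}\\-p'_{3,7}-\frac12p'_{5,5}&b_{2,7}&b_{2,5}&b_{2,3}\\-p'_{5,7}&0&b_{2,7}&b_{2,5}\\-\frac12p'_{7,7}&0&0&b_{2,7}\end{pmatrix}.$$ * For $2\le m<n\le7$, $[\mathcal D_{2m},\mathcal D_{2n}]=\sum_{k=0}^7c_{2m,2n}^{2k}(\lambda)\mathcal D_{2k}+A_{2m,2n}\vec{\mathcal D}$, where $$\begin{pmatrix}A_{4,6}\\A_{4,8}\\A_{4,10}\\A_{4,12}\\A_{4,14}\\A_{6,8}\\A_{6,10}\\A_{6,12}\\A_{6,14}\\A_{8,10}\\A_{8,12}\\A_{8,14}\\A_{10,12}\\A_{10,14}\\A_{12,14}\end{pmatrix}=\frac14\begin{pmatrix}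 -q_{3,3,3}&q_{1,3,3}-2q_{1,1,5}&2q_{1,1,3}&0\\ -2q_{3,3,5}&-2q_{1,1,7}&2q_{1,3,3}&2q_{1,1,3}\\ -2q_{3,3,7}-q_{3,5,5}&-q_{1,5,5}&2q_{1,3,5}&2q_{1,3,3}\\ -2q_{3,5,7}&-2q_{1,5,7}&2q_{1,3,7}&2q_{1,3,5}\\ -q_{3,7,7}&-q_{1,7,7}&0&2q_{1,3,7}\\ q_{3,3,7}-2q_{3,5,5}&2q_{1,5,5}-q_{3,3,5}-2q_{1,3,7}&q_{3,3,3}-2q_{1,1,7}&q_{1,3,3}+2q_{1,1,5}\\ -q_{5,5,5}-2q_{3,5,7}&2q_{1,5,7}-q_{3,5,5}-q_{3,3,7}&q_{3,3,5}+q_{1,5,5}-2q_{1,3,7}&q_{3,3,3}+2q_{1,3,5}\\ -2q_{5,5,7}&-2q_{3,5,7}&q_{3,3,7}&q_{3,3,5}+2q_{1,5,5}\\ -q_{5,7,7}&-q_{3,7,7}&-q_{1,7,7}&q_{3,3,7}+2q_{1,5,7}\\ -2q_{3,7,7}-q_{5,5,7}&-q_{5,5,5}+2q_{1,7,7}&2q_{1,5,7}+q_{3,5,5}-2q_{3,3,7}&2q_{3,3,5}-q_{1,5,5}\\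 -2q_{5,7,7}&-2q_{5,5,7}&2q_{1,7,7}&2q_{3,5,5}\\ -q_{7,7,7}&-q_{5,7,7}&-q_{3,7,7}&2q_{3,5,7}+q_{1,7,7}\\ 0&-2q_{5,7,7}&2q_{3,7,7}-q_{5,5,7}&q_{5,5,5}\\ 0&-q_{7,7,7}&-q_{5,7,7}&q_{5,5,7}+q_{3,7,7}\\ 0&0&-q_{7,7,7}&q_{5,7,7}\end{pmatrix}.$$ -/

import Mathlib

open MvPolynomial

namespace Genus4

noncomputable section

/-! ### The space of parameters: coordinates `λ₄, λ₆, …, λ₁₈` -/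

/-- The ring `𝒫 = ℂ[λ₄, λ₆, …, λ₁₈]`; the variable with index `i` is `λ_{2i+4}`. -/
abbrev ParamRing : Type := MvPolynomial (Fin 8) ℂ

/-- `lamVar s` is `λ_s`, with the convention `λ₀ = 1` and
`λ_s = 0` for `s ∉ {0, 4, 6, …, 18}`. -/
def lamVar : ℕ → ParamRing
  | 0 => 1
  | 4 => X 0
  | 6 => X 1
  | 8 => X 2
  | 10 => X 3
  | 12 => X 4
  | 14 => X 5
  | 16 => X 6
  | 18 => X 7
  | _ => 0

/-- The right-hand side `x⁹ + λ₄ x⁷ + λ₆ x⁶ + … + λ₁₆ x + λ₁₈` of the equation of the curve. -/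
def curvePoly (l : Fin 8 → ℂ) : Polynomial ℂ :=
  Polynomial.X ^ 9 + ∑ i : Fin 8, Polynomial.C (l i) * Polynomial.X ^ (7 - (i : ℕ))

/-- The set of parameters for which the affine plane curve `y² = curvePoly l (x)` is nonsingular:
the two partial derivatives of the equation have no common zero on the curve. -/
def nonsingularLocus : Set (Fin 8 → ℂ) :=
  {l | ∀ x y : ℂ, y ^ 2 = (curvePoly l).eval x →
    ¬ (2 * y = 0 ∧ (curvePoly l).derivative.eval x = 0)}

/-- The entry `v_{2k,2m}` for `k ≤ m` (in genus `g = 4`, so `2g - m + 1 = 9 - m`). -/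
def vUpper (k m : ℕ) : ParamRing :=
  (∑ s ∈ Finset.range k,
    C (2 * ((k : ℂ) + m - 2 * s)) * lamVar (2 * s) * lamVar (2 * (k + m - s)))
    - C (2 * (k : ℂ) * (9 - m) / 9) * lamVar (2 * k) * lamVar (2 * m)

/-- The symmetric matrix `v_{2k,2m}`, `1 ≤ k, m ≤ 8`. -/
def v (k m : ℕ) : ParamRing := if k ≤ m then vUpper k m else vUpper m k

/-- The vector field `L_{2k} = ∑_{s=2}^{9} v_{2k+2,2s-2} ∂/∂λ_{2s}` on `ℂ⁸`, `0 ≤ k ≤ 7`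
(the variable with index `i` is `λ_{2s}` for `s = i + 2`). -/
def L (k : Fin 8) : Derivation ℂ ParamRing ParamRing :=
  mkDerivation ℂ fun i : Fin 8 => v ((k : ℕ) + 1) ((i : ℕ) + 1)

/-- `c` is a system of structure polynomials:
`[L_{2i}, L_{2j}] = ∑_k c_{2i,2j}^{2k} L_{2k}`. -/
def IsStructurePolynomials (c : Fin 8 → Fin 8 → Fin 8 → ParamRing) : Prop :=
  ∀ i j : Fin 8, ⁅L i, L j⁆ = ∑ k : Fin 8, c i j k • L k

/-- The matrix of the structure polynomials `c_{2,2j}^{2k}`, `j = 2, …, 7` (rows),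
`k = 0, …, 7` (columns). -/
def C2 : Matrix (Fin 6) (Fin 8) ParamRing :=
  (C (1 / 9) : ParamRing) •
  !![24 * lamVar 6, - 24 * lamVar 4, 0, 18, 0, 0, 0, 0;
     20 * lamVar 8, 0, - 20 * lamVar 4, 0, 36, 0, 0, 0;
     16 * lamVar 10, 0, 0, - 16 * lamVar 4, 0, 54, 0, 0;
     12 * lamVar 12, 0, 0, 0, - 12 * lamVar 4, 0, 72, 0;
     8 * lamVar 14, 0, 0, 0, 0, - 8 * lamVar 4, 0, 90;
     4 * lamVar 16, 0, 0, 0, 0, 0, - 4 * lamVar 4, 0]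

/-! ### The space `ℂ¹²`: coordinates `b_{i,j}`, `i ∈ {1,2,3}`, `j ∈ {1,3,5,7}` -/

/-- Index set of the coordinates; `(i, j)` stands for `b_{i+1, 2j+1}`. -/
abbrev Idx : Type := Fin 3 × Fin 4

/-- The polynomial ring in the twelve variables `b_{i,j}`. -/
abbrev BRing : Type := MvPolynomial Idx ℂ

/-- Polynomial vector fields on `ℂ¹²`. -/
abbrev VF : Type := Derivation ℂ BRing BRing

/-- `b i j` is the coordinate `b_{i,j}`, and `0` if an index is out of range. -/
def b : ℕ → ℕ → BRing
  | 1, 1 => X (0, 0)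
  | 1, 3 => X (0, 1)
  | 1, 5 => X (0, 2)
  | 1, 7 => X (0, 3)
  | 2, 1 => X (1, 0)
  | 2, 3 => X (1, 1)
  | 2, 5 => X (1, 2)
  | 2, 7 => X (1, 3)
  | 3, 1 => X (2, 0)
  | 3, 3 => X (2, 1)
  | 3, 5 => X (2, 2)
  | 3, 7 => X (2, 3)
  | _, _ => 0

/-- The weight `i + j` of the variable `b_{i,j}`. -/
def wt (x : Idx) : ℕ := ((x.1 : ℕ) + 1) + (2 * (x.2 : ℕ) + 1)

/-- The polynomials `λ_s` in the variables `b_{i,j}`. -/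
def lam : ℕ → BRing
  | 4 => - 3 * b 1 1 ^ 2 + C (1 / 2) * b 3 1 - 2 * b 1 3
  | 6 => 2 * b 1 1 ^ 3 + C (1 / 4) * b 2 1 ^ 2 - C (1 / 2) * b 1 1 * b 3 1
      - 2 * b 1 1 * b 1 3 + C (1 / 2) * b 3 3 - 2 * b 1 5
  | 8 => 4 * b 1 1 ^ 2 * b 1 3 + b 1 3 * b 1 3 - 2 * b 1 1 * b 1 5 + C (1 / 2) * b 3 5
      - 2 * b 1 7 - C (1 / 2) * (b 3 1 * b 1 3 - b 2 1 * b 2 3 + b 1 1 * b 3 3)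
  | 10 => 2 * (b 1 1 * b 1 3 ^ 2 + b 1 5 * b 1 3 - b 1 1 * b 1 7 + 2 * b 1 1 ^ 2 * b 1 5)
      + C (1 / 4) * b 2 3 ^ 2
      - C (1 / 2) * (b 1 3 * b 3 3 - b 3 7 + b 3 1 * b 1 5 - b 2 1 * b 2 5 + b 1 1 * b 3 5)
  | 12 => 4 * b 1 1 * (b 1 3 * b 1 5 + b 1 1 * b 1 7) + b 1 5 ^ 2 + 2 * b 1 3 * b 1 7
      - C (1 / 2) * (b 3 3 * b 1 5 - b 2 3 * b 2 5 + b 1 3 * b 3 5 + b 3 1 * b 1 7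
        - b 2 1 * b 2 7 + b 1 1 * b 3 7)
  | 14 => 2 * b 1 1 * b 1 5 ^ 2 + C (1 / 4) * b 2 5 ^ 2 - C (1 / 2) * b 1 5 * b 3 5
      + 4 * b 1 1 * b 1 3 * b 1 7 + 2 * b 1 5 * b 1 7
      - C (1 / 2) * (b 3 3 * b 1 7 - b 2 3 * b 2 7 + b 1 3 * b 3 7)
  | 16 => 4 * b 1 1 * b 1 5 * b 1 7 + b 1 7 ^ 2
      - C (1 / 2) * (b 3 5 * b 1 7 - b 2 5 * b 2 7 + b 1 5 * b 3 7)
  | 18 => 2 * b 1 1 * b 1 7 ^ 2 + C (1 / 4) * b 2 7 ^ 2 - C (1 / 2) * b 1 7 * b 3 7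
  | _ => 0

def p33 : BRing := 6 * b 1 1 * b 1 3 - b 3 3 + 6 * b 1 5

def p35 : BRing := 6 * b 1 1 * b 1 5 - b 3 5 + 6 * b 1 7

def p37 : BRing := 6 * b 1 1 * b 1 7 - b 3 7

def p55 : BRing :=
  b 3 1 * b 1 5 - b 2 1 * b 2 5 + b 1 1 * b 3 5 - 2 * (4 * b 1 1 ^ 2 + b 1 3) * b 1 5
    + 10 * b 1 1 * b 1 7 - 2 * b 3 7

def p57 : BRing :=
  b 3 1 * b 1 7 - b 2 1 * b 2 7 + b 1 1 * b 3 7 - 2 * (4 * b 1 1 ^ 2 + b 1 3) * b 1 7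

def p77 : BRing :=
  b 3 3 * b 1 7 - b 2 3 * b 2 7 + b 1 3 * b 3 7 - 2 * (4 * b 1 1 * b 1 3 + b 1 5) * b 1 7

/-- The polynomials `p_{k,l} = p_{l,k}` for `k, l ∈ {1,3,5,7}`, where `p_{1,k} = 2 b_{1,k}`. -/
def p : ℕ → ℕ → BRing
  | 1, 1 => 2 * b 1 1
  | 1, 3 => 2 * b 1 3
  | 3, 1 => 2 * b 1 3
  | 1, 5 => 2 * b 1 5
  | 5, 1 => 2 * b 1 5
  | 1, 7 => 2 * b 1 7
  | 7, 1 => 2 * b 1 7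
  | 3, 3 => p33
  | 3, 5 => p35
  | 5, 3 => p35
  | 3, 7 => p37
  | 7, 3 => p37
  | 5, 5 => p55
  | 5, 7 => p57
  | 7, 5 => p57
  | 7, 7 => p77
  | _, _ => 0

/-- The pullback `ρ^* : 𝒫 → ℂ[b]`. -/
def rhoPullback : ParamRing →ₐ[ℂ] BRing := aeval fun i : Fin 8 => lam (2 * (i : ℕ) + 4)

/-- The polynomial map `ρ : ℂ¹² → ℂ⁸`. -/
def rho (x : Idx → ℂ) : Fin 8 → ℂ := fun i => eval x (lam (2 * (i : ℕ) + 4))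

/-- `D` is projectable for `ρ` with pushforward `M`. -/
def HasPushforward (D : VF) (M : Derivation ℂ ParamRing ParamRing) : Prop :=
  ∀ f : ParamRing, D (rhoPullback f) = rhoPullback (M f)

/-- The value of a vector field at a point, as a vector of `ℂ¹²`. -/
def valueAt (D : VF) (x : Idx → ℂ) : Idx → ℂ := fun i => eval x (D (X i))

/-! ### The vector fields -/

/-- The Euler vector field, multiplying `b_{i,j}` by `i + j`. -/
def eulerField : VF := mkDerivation ℂ fun x : Idx => (wt x : BRing) * X x

/-- `D₁ = ∑_j b_{2,j} ∂/∂b_{1,j} + b_{3,j} ∂/∂b_{2,j}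
  + 4 (2 b_{1,1} b_{2,j} + b_{2,1} b_{1,j} + b_{2,j+2}) ∂/∂b_{3,j}`. -/
def field1 : VF :=
  mkDerivation ℂ fun x : Idx =>
    ![b 2 (2 * (x.2 : ℕ) + 1),
      b 3 (2 * (x.2 : ℕ) + 1),
      4 * (2 * b 1 1 * b 2 (2 * (x.2 : ℕ) + 1) + b 2 1 * b 1 (2 * (x.2 : ℕ) + 1)
        + b 2 (2 * (x.2 : ℕ) + 3))] x.1

/-- For `s ∈ {3,5,7}`: the field `D_s` with `D_s(b_{i,j}) = ½ D₁^i (p_{s,j})`. -/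
def fieldOdd (s : ℕ) : VF :=
  mkDerivation ℂ fun x : Idx =>
    C (1 / 2) * (fun f => field1 f)^[(x.1 : ℕ) + 1] (p s (2 * (x.2 : ℕ) + 1))

/-- `p'_{i,j} = D₁(p_{i,j})`. -/
def p' (i j : ℕ) : BRing := field1 (p i j)

/-- `p''_{i,j} = D₁(D₁(p_{i,j}))`. -/
def p'' (i j : ℕ) : BRing := field1 (field1 (p i j))

/-- The index set `{0,1,2,3,4,5,6,7,8,10,12,14}` of the vector fields. -/
def indices : Finset ℕ := {0, 1, 2, 3, 4, 5, 6, 7, 8, 10, 12, 14}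

/-- The conditions that determine the vector fields `D_s`, `s ∈ indices`. -/
structure IsDetermined (D : ℕ → VF) : Prop where
  eq_zero : D 0 = eulerField
  eq_one : D 1 = field1
  eq_three : D 3 = fieldOdd 3
  eq_five : D 5 = fieldOdd 5
  eq_seven : D 7 = fieldOdd 7
  two_one : D 2 (b 1 1) =
    - b 1 1 ^ 2 + C (1 / 2) * b 3 1 + 2 * b 1 3 + C (7 / 9) * lam 4
  two_three : D 2 (b 1 3) =
    - b 1 1 * b 1 3 + C (1 / 2) * b 3 3 + 3 * b 1 5 - C (4 / 3) * lam 4 * b 1 1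
      + C (1 / 2) * p 3 3
  two_five : D 2 (b 1 5) =
    - b 1 1 * b 1 5 + C (1 / 2) * b 3 5 + 5 * b 1 7 - C (8 / 9) * lam 4 * b 1 3
      + C (1 / 2) * p 3 5
  two_seven : D 2 (b 1 7) =
    - b 1 1 * b 1 7 + C (1 / 2) * b 3 7 - C (4 / 9) * lam 4 * b 1 5 + C (1 / 2) * p 3 7
  four_one : D 4 (b 1 1) =
    - 2 * b 1 1 * b 1 3 + b 3 3 + 2 * b 1 5 + C (2 / 3) * lam 6
  four_three : D 4 (b 1 3) =
    - b 1 3 ^ 2 + 3 * b 1 7 + lam 4 * b 1 3 - 2 * lam 6 * b 1 1 - lam 8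
      - C (1 / 2) * b 1 1 * p 3 3 + C (1 / 2) * p'' 3 3 + C (1 / 2) * p 3 5
  four_five : D 4 (b 1 5) =
    - b 1 3 * b 1 5 + 3 * lam 4 * b 1 5 - C (4 / 3) * lam 6 * b 1 3
      - C (1 / 2) * b 1 1 * p 3 5 + C (1 / 2) * p'' 3 5 + C (1 / 2) * p 5 5
  four_seven : D 4 (b 1 7) =
    - b 1 3 * b 1 7 + 5 * lam 4 * b 1 7 - C (2 / 3) * lam 6 * b 1 5
      - C (1 / 2) * b 1 1 * p 3 7 + C (1 / 2) * p'' 3 7 + C (1 / 2) * p 5 7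
  lie_one_two : ⁅D 1, D 2⁆ = b 1 1 • D 1 - D 3
  lie_one_four : ⁅D 1, D 4⁆ = b 1 3 • D 1 + b 1 1 • D 3 - D 5
  six : D 6 =
    (1 / 4 : ℂ) • ((2 : ℂ) • ⁅D 2, D 4⁆ + b 2 3 • D 1 - b 2 1 • D 3)
      - (4 / 3 : ℂ) • (lam 6 • D 0 - lam 4 • D 2)
  eight : D 8 =
    (1 / 8 : ℂ) • ((2 : ℂ) • ⁅D 2, D 6⁆ + (C (1 / 2) * p' 3 3 + b 2 5) • D 1
        - b 2 3 • D 3 - b 2 1 • D 5)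
      - (5 / 9 : ℂ) • (lam 8 • D 0 - lam 4 • D 4)
  ten : D 10 =
    (1 / 12 : ℂ) • ((2 : ℂ) • ⁅D 2, D 8⁆ + (p' 3 5 + b 2 7) • D 1
        - b 2 5 • D 3 - b 2 3 • D 5 - b 2 1 • D 7)
      - (8 / 27 : ℂ) • (lam 10 • D 0 - lam 4 • D 6)
  twelve : D 12 =
    (1 / 16 : ℂ) • ((2 : ℂ) • ⁅D 2, D 10⁆ + (p' 3 7 + C (1 / 2) * p' 5 5) • D 1
        - b 2 7 • D 3 - b 2 5 • D 5 - b 2 3 • D 7)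
      - (1 / 6 : ℂ) • (lam 12 • D 0 - lam 4 • D 8)
  fourteen : D 14 =
    (1 / 20 : ℂ) • ((2 : ℂ) • ⁅D 2, D 12⁆ + p' 5 7 • D 1 - b 2 7 • D 5 - b 2 5 • D 7)
      - (4 / 45 : ℂ) • (lam 14 • D 0 - lam 4 • D 10)

/-! ### The commutation relations -/

/-- Coefficients of `[D₁, D_{2k}]`, `k = 1, …, 7`, in `D₁, D₃, D₅, D₇`. -/
def M1 : Matrix (Fin 7) (Fin 4) BRing :=
  !![b 1 1, -1, 0, 0;
     b 1 3, b 1 1, -1, 0;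
     b 1 5, b 1 3, b 1 1, -1;
     b 1 7, b 1 5, b 1 3, b 1 1;
     0, b 1 7, b 1 5, b 1 3;
     0, 0, b 1 7, b 1 5;
     0, 0, 0, b 1 7]

/-- Twice the first coefficient matrix of `[D₃, D_{2k}]`. -/
def M3 : Matrix (Fin 7) (Fin 4) BRing :=
  !![2 * b 1 3 - 2 * lam 4, 0, -6, 0;
     p 3 3, 2 * b 1 3 - 2 * lam 4, 0, -6;
     p 3 5, p 3 3, 2 * b 1 3 - 2 * lam 4, 0;
     p 3 7, p 3 5, p 3 3, 2 * b 1 3 - 2 * lam 4;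
     0, p 3 7, p 3 5, p 3 3;
     0, 0, p 3 7, p 3 5;
     0, 0, 0, p 3 7]

/-- Twice the first coefficient matrix of `[D₅, D_{2k}]`. -/
def M5 : Matrix (Fin 7) (Fin 4) BRing :=
  !![2 * b 1 5, 0, 0, -10;
     p 3 5, 2 * b 1 5, - 6 * lam 4, 0;
     p 5 5, p 3 5, 2 * b 1 5 - 4 * lam 6, - 6 * lam 4;
     p 5 7 - 2 * lam 12, p 5 5, p 3 5 - 2 * lam 8, 2 * b 1 5 - 4 * lam 6;
     - 4 * lam 14, p 5 7 - 2 * lam 12, p 5 5, p 3 5 - 2 * lam 8;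
     - 6 * lam 16, - 4 * lam 14, p 5 7, p 5 5;
     - 8 * lam 18, - 6 * lam 16, 0, p 5 7]

/-- Twice the first coefficient matrix of `[D₇, D_{2k}]`. -/
def M7 : Matrix (Fin 7) (Fin 4) BRing :=
  !![2 * b 1 7, 0, 0, 0;
     p 3 7, 2 * b 1 7, 0, - 10 * lam 4;
     p 5 7, p 3 7, 2 * b 1 7, - 8 * lam 6;
     p 7 7, p 5 7, p 3 7, 2 * b 1 7 - 6 * lam 8;
     - 2 * lam 16, p 7 7, p 5 7, p 3 7 - 4 * lam 10;
     - 4 * lam 18, - 2 * lam 16, p 7 7, p 5 7 - 2 * lam 12;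
     0, - 4 * lam 18, - 2 * lam 16, p 7 7]

def e3 : Fin 7 → BRing :=
  ![7 * lam 4, 6 * lam 6, 5 * lam 8, 4 * lam 10, 3 * lam 12, 2 * lam 14, lam 16]

def e57 : Fin 7 → BRing :=
  ![2 * lam 4, 3 * lam 6, 4 * lam 8, 5 * lam 10, 6 * lam 12, 7 * lam 14, 8 * lam 16]

/-- Twice the coefficients of `D₁, D₃, D₅, D₇` in `[D₂, D_{2j}]`, `j = 2, …, 7`. -/
def A2 : Matrix (Fin 6) (Fin 4) BRing :=
  !![- b 2 3, b 2 1, 0, 0;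
     - C (1 / 2) * p' 3 3 - b 2 5, b 2 3, b 2 1, 0;
     - p' 3 5 - b 2 7, b 2 5, b 2 3, b 2 1;
     - p' 3 7 - C (1 / 2) * p' 5 5, b 2 7, b 2 5, b 2 3;
     - p' 5 7, 0, b 2 7, b 2 5;
     - C (1 / 2) * p' 7 7, 0, 0, b 2 7]

/-- The row `4 A_{2m,2n}` of coefficients of `D₁, D₃, D₅, D₇` in `[D_{2m}, D_{2n}]`,
`2 ≤ m < n ≤ 7`, written in terms of `q_{i,j,k} = D_i(p_{j,k})`. -/
def fourA (q : ℕ → ℕ → ℕ → BRing) : ℕ → ℕ → Fin 4 → BRing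
  | 4, 6 => ![- q 3 3 3, q 1 3 3 - 2 * q 1 1 5, 2 * q 1 1 3, 0]
  | 4, 8 => ![- 2 * q 3 3 5, - 2 * q 1 1 7, 2 * q 1 3 3, 2 * q 1 1 3]
  | 4, 10 => ![- 2 * q 3 3 7 - q 3 5 5, - q 1 5 5, 2 * q 1 3 5, 2 * q 1 3 3]
  | 4, 12 => ![- 2 * q 3 5 7, - 2 * q 1 5 7, 2 * q 1 3 7, 2 * q 1 3 5]
  | 4, 14 => ![- q 3 7 7, - q 1 7 7, 0, 2 * q 1 3 7]
  | 6, 8 => ![q 3 3 7 - 2 * q 3 5 5, 2 * q 1 5 5 - q 3 3 5 - 2 * q 1 3 7,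
      q 3 3 3 - 2 * q 1 1 7, q 1 3 3 + 2 * q 1 1 5]
  | 6, 10 => ![- q 5 5 5 - 2 * q 3 5 7, 2 * q 1 5 7 - q 3 5 5 - q 3 3 7,
      q 3 3 5 + q 1 5 5 - 2 * q 1 3 7, q 3 3 3 + 2 * q 1 3 5]
  | 6, 12 => ![- 2 * q 5 5 7, - 2 * q 3 5 7, q 3 3 7, q 3 3 5 + 2 * q 1 5 5]
  | 6, 14 => ![- q 5 7 7, - q 3 7 7, - q 1 7 7, q 3 3 7 + 2 * q 1 5 7]
  | 8, 10 => ![- 2 * q 3 7 7 - q 5 5 7, - q 5 5 5 + 2 * q 1 7 7,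
      2 * q 1 5 7 + q 3 5 5 - 2 * q 3 3 7, 2 * q 3 3 5 - q 1 5 5]
  | 8, 12 => ![- 2 * q 5 7 7, - 2 * q 5 5 7, 2 * q 1 7 7, 2 * q 3 5 5]
  | 8, 14 => ![- q 7 7 7, - q 5 7 7, - q 3 7 7, 2 * q 3 5 7 + q 1 7 7]
  | 10, 12 => ![0, - 2 * q 5 7 7, 2 * q 3 7 7 - q 5 5 7, q 5 5 5]
  | 10, 14 => ![0, - q 7 7 7, - q 5 7 7, q 5 5 7 + q 3 7 7]
  | 12, 14 => ![0, 0, - q 7 7 7, q 5 7 7]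
  | _, _ => 0

/-- The combination `r₀ D₁ + r₁ D₃ + r₂ D₅ + r₃ D₇`. -/
def oddComb (D : ℕ → VF) (r : Fin 4 → BRing) : VF :=
  ∑ t : Fin 4, r t • D (2 * (t : ℕ) + 1)

/-- The combination `∑_{k=0}^{7} a_k(λ) D_{2k}`. -/
def evenComb (D : ℕ → VF) (a : Fin 8 → ParamRing) : VF :=
  ∑ k : Fin 8, rhoPullback (a k) • D (2 * (k : ℕ))

/-- The commutation relations of the fields `D_s`, for given structure polynomials `c` of the
fields `L_{2k}`. -/
structure CommutationRelations (c : Fin 8 → Fin 8 → Fin 8 → ParamRing) (D : ℕ → VF) :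
    Prop where
  lie_zero : ∀ k ∈ indices, ⁅D 0, D k⁆ = (k : ℂ) • D k
  lie_odd : ∀ k m : Fin 4, ⁅D (2 * (k : ℕ) + 1), D (2 * (m : ℕ) + 1)⁆ = 0
  lie_one : ∀ k : Fin 7, ⁅D 1, D (2 * (k : ℕ) + 2)⁆ = oddComb D (M1 k)
  lie_three : ∀ k : Fin 7, ⁅D 3, D (2 * (k : ℕ) + 2)⁆ =
    (1 / 2 : ℂ) • oddComb D (M3 k) + (1 / 3 : ℂ) • e3 k • D 1
  lie_five : ∀ k : Fin 7, ⁅D 5, D (2 * (k : ℕ) + 2)⁆ =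
    (1 / 2 : ℂ) • oddComb D (M5 k) + (4 / 9 : ℂ) • e57 k • D 3
  lie_seven : ∀ k : Fin 7, ⁅D 7, D (2 * (k : ℕ) + 2)⁆ =
    (1 / 2 : ℂ) • oddComb D (M7 k) + (2 / 9 : ℂ) • e57 k • D 5
  lie_two : ∀ j : Fin 6, ⁅D 2, D (2 * (j : ℕ) + 4)⁆ =
    evenComb D (C2 j) + (1 / 2 : ℂ) • oddComb D (A2 j)
  lie_even : ∀ m n : Fin 8, 2 ≤ m → m < n →
    ⁅D (2 * (m : ℕ)), D (2 * (n : ℕ))⁆ =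
      evenComb D (c m n) +
        (1 / 4 : ℂ) • oddComb D (fourA (fun i j k => D i (p j k)) (2 * (m : ℕ)) (2 * (n : ℕ)))

end

end Genus4

open Genus4

namespace Genus4

set_option linter.unusedSimpArgs false

/-! ### Polynomial vector fields as functions -/

/-! Everything rests on a rigidity principle. A polynomial field on `ℂ¹²` is determined by its
bracket with `D₁`, its pushforward and its value on the single coordinate `b₁₁`
(`vf_eq_of_lie_odd1`, `vf_eq_of_projects`). Indeed `D₁` carries `b_{1,j}` to `b_{2,j}` and `b_{2,j}`
to `b_{3,j}`, while `λ₄`, `λ₆`, `λ₈` contain `b₁₃`, `b₁₅`, `b₁₇` linearly with constant coefficient.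
So a field that commutes with `D₁` and kills `b₁₁` and these three `λ_s` kills all twelve
coordinates. A relation `[U, W] = V` therefore splits into three tests: an identity between fields
on the base; equality of the brackets with `D₁`, which is the Jacobi identity plus relations already
known and is checked on an arbitrary `f`; and one explicit polynomial identity for the value on
`b₁₁`.

Existence: `D₂` and `D₄` are lifted from their prescribed values on `b_{1,j}` (`liftField`). The
later fields are defined by the recursion, and the same loop runs for each: the pushforward comes
from the relations on the base (`lie_base`), the bracket with `D₁` from Jacobi, the brackets with
`D₃`, `D₅`, `D₇` from `OddRelations.of_projects`. Solved for the bracket, the recursion gives the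
relations of `D₂` with `D₄`, …, `D₁₂`; the relation with `D₁₄` and the fifteen relations among `D₄`,
…, `D₁₄` come from `lie_even_eq`. Uniqueness: the bracket with `D₁` and the values on `b_{1,j}` fix
`D₂` and `D₄`, and all other fields are given by formulas.

Independence is algebra in one variable. Put `u = x⁴ - b₁₁x³ - b₁₃x² - b₁₅x - b₁₇`, `V = b₂₁x³ + … +
b₂₇`, `W = b₃₁x³ + … + b₃₇`; the curve polynomial is `f = V²/4 + u((x + 2b₁₁)u + W/2)`. A
combination of the odd fields sends `u` to `Su - NV` and `V` to `NW - S'u` with `deg N < 4`. If it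
vanishes at a point, `u` divides `NV` and `NW`; a common zero of `u`, `V`, `W` would be a double
root of `f`, so `u` divides `N` and `N = 0` (`odd_independent`). On the base a combination of the
`L_{2k}` sends `f` to `Qf + Gf'` with `deg G ≤ 8`, and coprimality of `f` and `f'` forces `G = 0`
(`base_independent`). Pulled-back functions do not see the odd fields, so the two results combine
(`field_independent`).

Homogeneity is the relation `[D₀, D_s] = s D_s` read on coefficients; closure of the module follows
from the relations by Leibniz; the structure polynomials are unique because the matrix `v` is
invertible at one point. -/

/-- Polynomial vector fields on an affine space; a type synonym for derivations. -/
def PolyField (σ : Type) : Type := Derivation ℂ (MvPolynomial σ ℂ) (MvPolynomial σ ℂ)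

/-- The value of a polynomial at a point. -/
noncomputable def polyVal {σ : Type} (x : σ → ℂ) (f : MvPolynomial σ ℂ) : ℂ := eval x f

/-- `ℂ` is infinite, so values determine a polynomial. Passing to values moves identities from
`MvPolynomial` into the field `ℂ`, where constants such as `C (1 / 3)` become numerals that `ring1`
can combine. -/
theorem poly_ext {σ : Type} {f g : MvPolynomial σ ℂ} (h : ∀ x, polyVal x f = polyVal x g) :
    f = g :=
  MvPolynomial.funext h

namespace PolyField

variable {σ : Type}

noncomputable instance : AddCommGroup (PolyField σ) :=
  inferInstanceAs (AddCommGroup (Derivation ℂ (MvPolynomial σ ℂ) (MvPolynomial σ ℂ)))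

noncomputable instance : Module (MvPolynomial σ ℂ) (PolyField σ) :=
  inferInstanceAs (Module (MvPolynomial σ ℂ)
    (Derivation ℂ (MvPolynomial σ ℂ) (MvPolynomial σ ℂ)))

noncomputable instance : Module ℂ (PolyField σ) :=
  inferInstanceAs (Module ℂ (Derivation ℂ (MvPolynomial σ ℂ) (MvPolynomial σ ℂ)))

noncomputable instance : Bracket (PolyField σ) (PolyField σ) :=
  inferInstanceAs (Bracket (Derivation ℂ (MvPolynomial σ ℂ) (MvPolynomial σ ℂ))
    (Derivation ℂ (MvPolynomial σ ℂ) (MvPolynomial σ ℂ)))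

/-- A vector field as a derivation. -/
def toDerivation (U : PolyField σ) : Derivation ℂ (MvPolynomial σ ℂ) (MvPolynomial σ ℂ) := U

/-- The action of a vector field on polynomials. -/
noncomputable def apply (U : PolyField σ) (f : MvPolynomial σ ℂ) : MvPolynomial σ ℂ :=
  U.toDerivation f

-- Application goes through `apply`, not through the coercion of derivations, so the rewriting rules
-- below all match one fixed head symbol.
noncomputable instance : CoeFun (PolyField σ) (fun _ => MvPolynomial σ ℂ → MvPolynomial σ ℂ) :=
  ⟨apply⟩

end PolyField

/-- Polynomial vector fields on `ℂ¹²`. -/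
abbrev BField : Type := PolyField Idx

/-! ### Rewriting rules for derivations and for evaluation at a point -/

section Expand

variable {σ : Type}

theorem vf_lie_apply (U W : PolyField σ) (f : MvPolynomial σ ℂ) :
    ⁅U, W⁆ f = U (W f) - W (U f) :=
  Derivation.commutator_apply (D1 := U.toDerivation) (D2 := W.toDerivation) f

theorem vf_map_add (U : PolyField σ) (f g : MvPolynomial σ ℂ) : U (f + g) = U f + U g :=
  map_add U.toDerivation f g

theorem vf_map_sub (U : PolyField σ) (f g : MvPolynomial σ ℂ) : U (f - g) = U f - U g :=
  map_sub U.toDerivation f g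

theorem vf_map_neg (U : PolyField σ) (f : MvPolynomial σ ℂ) : U (-f) = - U f :=
  map_neg U.toDerivation f

theorem vf_map_zero (U : PolyField σ) : U 0 = 0 := map_zero U.toDerivation

theorem vf_leibniz (U : PolyField σ) (f g : MvPolynomial σ ℂ) : U (f * g) = f * U g + g * U f :=
  U.toDerivation.leibniz f g

theorem vf_pow_two (U : PolyField σ) (f : MvPolynomial σ ℂ) : U (f ^ 2) = 2 * (f * U f) := by
  rw [sq, vf_leibniz]; ring

theorem vf_pow_three (U : PolyField σ) (f : MvPolynomial σ ℂ) :
    U (f ^ 3) = 3 * (f ^ 2 * U f) := by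
  rw [pow_succ, vf_leibniz, vf_pow_two]; ring

theorem vf_pow_four (U : PolyField σ) (f : MvPolynomial σ ℂ) :
    U (f ^ 4) = 4 * (f ^ 3 * U f) := by
  rw [pow_succ, vf_leibniz, vf_pow_three]; ring

theorem vf_C (U : PolyField σ) (a : ℂ) : U (C a) = 0 := derivation_C U.toDerivation a

theorem vf_natCast (U : PolyField σ) (n : ℕ) : U (n : MvPolynomial σ ℂ) = 0 :=
  U.toDerivation.map_natCast n

theorem vf_sub_apply (U W : PolyField σ) (f : MvPolynomial σ ℂ) : (U - W) f = U f - W f :=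
  Derivation.sub_apply (D1 := U.toDerivation) (D2 := W.toDerivation) f

theorem vf_scalar_apply (a : ℂ) (U : PolyField σ) (f : MvPolynomial σ ℂ) :
    (a • U) f = C a * U f :=
  (Derivation.smul_apply f a U.toDerivation).trans (MvPolynomial.smul_eq_C_mul _ _)

/-- Rules that expand the value of a derivation at a polynomial expression. -/
theorem vf_expand :
    (∀ (U W : PolyField σ) (f), (U + W) f = U f + W f) ∧
    (∀ (U W : PolyField σ) (f), (U - W) f = U f - W f) ∧
    (∀ (U : PolyField σ) (f), (-U) f = - U f) ∧
    (∀ f, (0 : PolyField σ) f = 0) ∧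
    (∀ (g) (U : PolyField σ) (f), (g • U) f = g * U f) ∧
    (∀ (a : ℂ) (U : PolyField σ) (f), (a • U) f = C a * U f) ∧
    (∀ (U : PolyField σ) (f g), U (f + g) = U f + U g) ∧
    (∀ (U : PolyField σ) (f g), U (f - g) = U f - U g) ∧
    (∀ (U : PolyField σ) (f), U (-f) = - U f) ∧
    (∀ (U : PolyField σ) (f g), U (f * g) = f * U g + g * U f) ∧
    (∀ (U : PolyField σ) (f), U (f ^ 2) = 2 * (f * U f)) ∧
    (∀ (U : PolyField σ) (f), U (f ^ 3) = 3 * (f ^ 2 * U f)) ∧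
    (∀ (U : PolyField σ) (f), U (f ^ 4) = 4 * (f ^ 3 * U f)) ∧
    (∀ (U : PolyField σ) (a : ℂ), U (C a) = 0) ∧
    (∀ U : PolyField σ,
      U 2 = 0 ∧ U 3 = 0 ∧ U 4 = 0 ∧ U 5 = 0 ∧ U 6 = 0 ∧ U 7 = 0 ∧ U 8 = 0 ∧ U 9 = 0 ∧
      U 10 = 0 ∧ U 12 = 0) ∧
    (∀ U : PolyField σ, U 0 = 0) ∧
    (∀ U : PolyField σ, U 1 = 0) :=
  ⟨fun _ _ _ => rfl, vf_sub_apply, fun U _ => Derivation.neg_apply (D := U.toDerivation) _,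
    fun _ => rfl, fun _ _ _ => rfl, vf_scalar_apply, vf_map_add, vf_map_sub, vf_map_neg, vf_leibniz,
    vf_pow_two, vf_pow_three, vf_pow_four, vf_C, fun U =>
    ⟨vf_natCast U 2, vf_natCast U 3, vf_natCast U 4, vf_natCast U 5, vf_natCast U 6,
    vf_natCast U 7, vf_natCast U 8, vf_natCast U 9, vf_natCast U 10, vf_natCast U 12⟩,
    vf_map_zero, fun U => U.toDerivation.map_one_eq_zero⟩

/-- Rules that expand the value of a polynomial expression at a point. -/
theorem polyVal_expand (x : σ → ℂ) :
    (∀ f g, polyVal x (f + g) = polyVal x f + polyVal x g) ∧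
    (∀ f g, polyVal x (f - g) = polyVal x f - polyVal x g) ∧
    (∀ f g, polyVal x (f * g) = polyVal x f * polyVal x g) ∧
    (∀ f, polyVal x (-f) = - polyVal x f) ∧
    (∀ (f) (n : ℕ), polyVal x (f ^ n) = polyVal x f ^ n) ∧
    (∀ a : ℂ, polyVal x (C a) = a) ∧
    (polyVal x 2 = 2 ∧ polyVal x 3 = 3 ∧ polyVal x 4 = 4 ∧ polyVal x 5 = 5 ∧
      polyVal x 6 = 6 ∧ polyVal x 7 = 7 ∧ polyVal x 8 = 8 ∧ polyVal x 9 = 9 ∧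
      polyVal x 10 = 10 ∧ polyVal x 12 = 12) ∧
    polyVal x 0 = 0 ∧
    polyVal x 1 = 1 :=
  ⟨map_add (eval x), map_sub (eval x), map_mul (eval x), map_neg (eval x), map_pow (eval x),
    fun a => eval_C a,
    ⟨map_ofNat (eval x) 2, map_ofNat (eval x) 3, map_ofNat (eval x) 4, map_ofNat (eval x) 5,
    map_ofNat (eval x) 6, map_ofNat (eval x) 7, map_ofNat (eval x) 8, map_ofNat (eval x) 9,
    map_ofNat (eval x) 10, map_ofNat (eval x) 12⟩, map_zero (eval x), map_one (eval x)⟩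

end Expand

/-- A vector field is determined by its values on the twelve coordinates. -/
theorem vf_ext {U W : BField}
    (h1 : U (b 1 1) = W (b 1 1) ∧ U (b 1 3) = W (b 1 3) ∧ U (b 1 5) = W (b 1 5) ∧
      U (b 1 7) = W (b 1 7))
    (h2 : U (b 2 1) = W (b 2 1) ∧ U (b 2 3) = W (b 2 3) ∧ U (b 2 5) = W (b 2 5) ∧
      U (b 2 7) = W (b 2 7))
    (h3 : U (b 3 1) = W (b 3 1) ∧ U (b 3 3) = W (b 3 3) ∧ U (b 3 5) = W (b 3 5) ∧
      U (b 3 7) = W (b 3 7)) : U = W := by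
  refine MvPolynomial.derivation_ext (D₁ := U.toDerivation) (D₂ := W.toDerivation) fun i => ?_
  obtain ⟨i, j⟩ := i
  obtain ⟨h11, h13, h15, h17⟩ := h1
  obtain ⟨h21, h23, h25, h27⟩ := h2
  obtain ⟨h31, h33, h35, h37⟩ := h3
  fin_cases i <;> fin_cases j <;> assumption

/-! ### The odd fields on the coordinates -/

/-- The Euler field. -/
noncomputable def euler : BField := eulerField

/-- The field `D₁`. -/
noncomputable def odd1 : BField := field1

/-- The field `D₃`. -/
noncomputable def odd3 : BField := fieldOdd 3

/-- The field `D₅`. -/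
noncomputable def odd5 : BField := fieldOdd 5

/-- The field `D₇`. -/
noncomputable def odd7 : BField := fieldOdd 7

theorem p'_eq (i j : ℕ) : p' i j = odd1 (p i j) := rfl

theorem p''_eq (i j : ℕ) : p'' i j = odd1 (odd1 (p i j)) := rfl

theorem odd1_b :
    (odd1 (b 1 1) = b 2 1 ∧ odd1 (b 1 3) = b 2 3 ∧
      odd1 (b 1 5) = b 2 5 ∧ odd1 (b 1 7) = b 2 7) ∧
    (odd1 (b 2 1) = b 3 1 ∧ odd1 (b 2 3) = b 3 3 ∧
      odd1 (b 2 5) = b 3 5 ∧ odd1 (b 2 7) = b 3 7) ∧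
    odd1 (b 3 1) = 12 * b 1 1 * b 2 1 + 4 * b 2 3 ∧
    odd1 (b 3 3) = 8 * b 1 1 * b 2 3 + 4 * b 2 1 * b 1 3 + 4 * b 2 5 ∧
    odd1 (b 3 5) = 8 * b 1 1 * b 2 5 + 4 * b 2 1 * b 1 5 + 4 * b 2 7 ∧
    odd1 (b 3 7) = 8 * b 1 1 * b 2 7 + 4 * b 2 1 * b 1 7 := by
  have h (i : Idx) : odd1 (X i) = _ := mkDerivation_X ℂ _ i
  refine ⟨⟨?_, ?_, ?_, ?_⟩, ⟨?_, ?_, ?_, ?_⟩, ?_, ?_, ?_, ?_⟩ <;> simp [h, b] <;> ring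

theorem fieldOdd_b_one (s : ℕ) : fieldOdd s (b 1 1) = C (1 / 2) * odd1 (p s 1) ∧
    fieldOdd s (b 1 3) = C (1 / 2) * odd1 (p s 3) ∧
    fieldOdd s (b 1 5) = C (1 / 2) * odd1 (p s 5) ∧
    fieldOdd s (b 1 7) = C (1 / 2) * odd1 (p s 7) := by
  refine ⟨?_, ?_, ?_, ?_⟩ <;> exact mkDerivation_X _ _ _

theorem fieldOdd_b_two (s : ℕ) :
    fieldOdd s (b 2 1) = C (1 / 2) * odd1 (odd1 (p s 1)) ∧
    fieldOdd s (b 2 3) = C (1 / 2) * odd1 (odd1 (p s 3)) ∧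
    fieldOdd s (b 2 5) = C (1 / 2) * odd1 (odd1 (p s 5)) ∧
    fieldOdd s (b 2 7) = C (1 / 2) * odd1 (odd1 (p s 7)) := by
  refine ⟨?_, ?_, ?_, ?_⟩ <;> exact mkDerivation_X _ _ _

theorem fieldOdd_b_three (s : ℕ) :
    fieldOdd s (b 3 1) = C (1 / 2) * odd1 (odd1 (odd1 (p s 1))) ∧
    fieldOdd s (b 3 3) = C (1 / 2) * odd1 (odd1 (odd1 (p s 3))) ∧
    fieldOdd s (b 3 5) = C (1 / 2) * odd1 (odd1 (odd1 (p s 5))) ∧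
    fieldOdd s (b 3 7) = C (1 / 2) * odd1 (odd1 (odd1 (p s 7))) := by
  refine ⟨?_, ?_, ?_, ?_⟩ <;> exact mkDerivation_X _ _ _

/-- With `u`, `V`, `W` the polynomials in `x` built from `b_{1,j}`, `b_{2,j}`, `b_{3,j}`, the first
eight values say `D₃u = b₂₁u - (x - b₁₁)V` and `D₃V = (x - b₁₁)W - b₃₁u`. `D₅` and `D₇` follow the
same pattern, with longer truncations of `u`, `V`, `W`. These closed forms replace the iterated `D₁`
of the definition from here on. -/
theorem odd3_b :
    odd3 (b 1 1) =
      b 2 3 ∧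
    odd3 (b 1 3) =
      -(b 1 1 * b 2 3) + b 1 3 * b 2 1 + b 2 5 ∧
    odd3 (b 1 5) =
      -(b 1 1 * b 2 5) + b 1 5 * b 2 1 + b 2 7 ∧
    odd3 (b 1 7) =
      -(b 1 1 * b 2 7) + b 1 7 * b 2 1 ∧
    odd3 (b 2 1) =
      b 3 3 ∧
    odd3 (b 2 3) =
      -(b 1 1 * b 3 3) + b 1 3 * b 3 1 + b 3 5 ∧
    odd3 (b 2 5) =
      -(b 1 1 * b 3 5) + b 1 5 * b 3 1 + b 3 7 ∧
    odd3 (b 2 7) =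
      -(b 1 1 * b 3 7) + b 1 7 * b 3 1 ∧
    odd3 (b 3 1) =
      8 * b 1 1 * b 2 3 + 4 * b 1 3 * b 2 1 + 4 * b 2 5 ∧
    odd3 (b 3 3) =
      -(8 * b 1 1 ^ 2 * b 2 3) + 8 * b 1 1 * b 1 3 * b 2 1 + 4 * b 1 1 * b 2 5 + 4 * b 1 3 * b 2 3
      + 4 * b 1 5 * b 2 1 - b 2 1 * b 3 3 + b 2 3 * b 3 1 + 4 * b 2 7 ∧
    odd3 (b 3 5) =
      -(8 * b 1 1 ^ 2 * b 2 5) + 8 * b 1 1 * b 1 5 * b 2 1 + 4 * b 1 1 * b 2 7 + 4 * b 1 5 * b 2 3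
      + 4 * b 1 7 * b 2 1 - b 2 1 * b 3 5 + b 2 5 * b 3 1 ∧
    odd3 (b 3 7) =
      -(8 * b 1 1 ^ 2 * b 2 7) + 8 * b 1 1 * b 1 7 * b 2 1 + 4 * b 1 7 * b 2 3 - b 2 1 * b 3 7 + b
      2 7 * b 3 1 := by
  obtain ⟨h11, h13, h15, h17⟩ := fieldOdd_b_one 3
  obtain ⟨h21, h23, h25, h27⟩ := fieldOdd_b_two 3
  obtain ⟨h31, h33, h35, h37⟩ := fieldOdd_b_three 3
  refine ⟨h11.trans ?_, h13.trans ?_, h15.trans ?_, h17.trans ?_, h21.trans ?_, h23.trans ?_,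
    h25.trans ?_, h27.trans ?_, h31.trans ?_, h33.trans ?_, h35.trans ?_, h37.trans ?_⟩ <;>
  · refine poly_ext fun x => ?_
    simp only [p, p33, p35, p37, p55, p57, p77, vf_expand, odd1_b, polyVal_expand x]
    ring1

theorem odd5_b :
    odd5 (b 1 1) =
      b 2 5 ∧
    odd5 (b 1 3) =
      -(b 1 1 * b 2 5) + b 1 5 * b 2 1 + b 2 7 ∧
    odd5 (b 1 5) =
      -(b 1 1 * b 2 7) - b 1 3 * b 2 5 + b 1 5 * b 2 3 + b 1 7 * b 2 1 ∧
    odd5 (b 1 7) =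
      -(b 1 3 * b 2 7) + b 1 7 * b 2 3 ∧
    odd5 (b 2 1) =
      b 3 5 ∧
    odd5 (b 2 3) =
      -(b 1 1 * b 3 5) + b 1 5 * b 3 1 + b 3 7 ∧
    odd5 (b 2 5) =
      -(b 1 1 * b 3 7) - b 1 3 * b 3 5 + b 1 5 * b 3 3 + b 1 7 * b 3 1 ∧
    odd5 (b 2 7) =
      -(b 1 3 * b 3 7) + b 1 7 * b 3 3 ∧
    odd5 (b 3 1) =
      8 * b 1 1 * b 2 5 + 4 * b 1 5 * b 2 1 + 4 * b 2 7 ∧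
    odd5 (b 3 3) =
      -(8 * b 1 1 ^ 2 * b 2 5) + 8 * b 1 1 * b 1 5 * b 2 1 + 4 * b 1 1 * b 2 7 + 4 * b 1 5 * b 2 3
      + 4 * b 1 7 * b 2 1 - b 2 1 * b 3 5 + b 2 5 * b 3 1 ∧
    odd5 (b 3 5) =
      -(8 * b 1 1 ^ 2 * b 2 7) - 8 * b 1 1 * b 1 3 * b 2 5 + 8 * b 1 1 * b 1 5 * b 2 3 + 8 * b 1 1
      * b 1 7 * b 2 1 - 4 * b 1 3 * b 2 7 + 4 * b 1 5 * b 2 5 + 4 * b 1 7 * b 2 3 - b 2 1 * b 3 7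
      - b 2 3 * b 3 5 + b 2 5 * b 3 3 + b 2 7 * b 3 1 ∧
    odd5 (b 3 7) =
      -(8 * b 1 1 * b 1 3 * b 2 7) + 8 * b 1 1 * b 1 7 * b 2 3 + 4 * b 1 7 * b 2 5 - b 2 3 * b 3 7
      + b 2 7 * b 3 3 := by
  obtain ⟨h11, h13, h15, h17⟩ := fieldOdd_b_one 5
  obtain ⟨h21, h23, h25, h27⟩ := fieldOdd_b_two 5
  obtain ⟨h31, h33, h35, h37⟩ := fieldOdd_b_three 5
  refine ⟨h11.trans ?_, h13.trans ?_, h15.trans ?_, h17.trans ?_, h21.trans ?_, h23.trans ?_,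
    h25.trans ?_, h27.trans ?_, h31.trans ?_, h33.trans ?_, h35.trans ?_, h37.trans ?_⟩ <;>
  · refine poly_ext fun x => ?_
    simp only [p, p33, p35, p37, p55, p57, p77, vf_expand, odd1_b, polyVal_expand x]
    ring1

theorem odd7_b :
    odd7 (b 1 1) =
      b 2 7 ∧
    odd7 (b 1 3) =
      -(b 1 1 * b 2 7) + b 1 7 * b 2 1 ∧
    odd7 (b 1 5) =
      -(b 1 3 * b 2 7) + b 1 7 * b 2 3 ∧
    odd7 (b 1 7) =
      -(b 1 5 * b 2 7) + b 1 7 * b 2 5 ∧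
    odd7 (b 2 1) =
      b 3 7 ∧
    odd7 (b 2 3) =
      -(b 1 1 * b 3 7) + b 1 7 * b 3 1 ∧
    odd7 (b 2 5) =
      -(b 1 3 * b 3 7) + b 1 7 * b 3 3 ∧
    odd7 (b 2 7) =
      -(b 1 5 * b 3 7) + b 1 7 * b 3 5 ∧
    odd7 (b 3 1) =
      8 * b 1 1 * b 2 7 + 4 * b 1 7 * b 2 1 ∧
    odd7 (b 3 3) =
      -(8 * b 1 1 ^ 2 * b 2 7) + 8 * b 1 1 * b 1 7 * b 2 1 + 4 * b 1 7 * b 2 3 - b 2 1 * b 3 7 + b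
      2 7 * b 3 1 ∧
    odd7 (b 3 5) =
      -(8 * b 1 1 * b 1 3 * b 2 7) + 8 * b 1 1 * b 1 7 * b 2 3 + 4 * b 1 7 * b 2 5 - b 2 3 * b 3 7
      + b 2 7 * b 3 3 ∧
    odd7 (b 3 7) =
      -(8 * b 1 1 * b 1 5 * b 2 7) + 8 * b 1 1 * b 1 7 * b 2 5 + 4 * b 1 7 * b 2 7 - b 2 5 * b 3 7
      + b 2 7 * b 3 5 := by
  obtain ⟨h11, h13, h15, h17⟩ := fieldOdd_b_one 7
  obtain ⟨h21, h23, h25, h27⟩ := fieldOdd_b_two 7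
  obtain ⟨h31, h33, h35, h37⟩ := fieldOdd_b_three 7
  refine ⟨h11.trans ?_, h13.trans ?_, h15.trans ?_, h17.trans ?_, h21.trans ?_, h23.trans ?_,
    h25.trans ?_, h27.trans ?_, h31.trans ?_, h33.trans ?_, h35.trans ?_, h37.trans ?_⟩ <;>
  · refine poly_ext fun x => ?_
    simp only [p, p33, p35, p37, p55, p57, p77, vf_expand, odd1_b, polyVal_expand x]
    ring1

/-! The odd fields annihilate the polynomials `λ_s`. -/

/-- The `λ_s` are the coefficients of `V²/4 + u((x + 2b₁₁)u + W/2)`. This is constant along `D₁`,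
because `D₁u = -V`, `D₁V = W` and `D₁W = 4(x + 2b₁₁)V - 4b₂₁u`. -/
theorem odd1_lam :
    odd1 (lam 4) = 0 ∧ odd1 (lam 6) = 0 ∧ odd1 (lam 8) = 0 ∧ odd1 (lam 10) = 0 ∧
    odd1 (lam 12) = 0 ∧ odd1 (lam 14) = 0 ∧ odd1 (lam 16) = 0 ∧ odd1 (lam 18) = 0 := by
  refine ⟨?_, ?_, ?_, ?_, ?_, ?_, ?_, ?_⟩ <;>
  · refine poly_ext fun x => ?_
    simp only [lam, vf_expand, odd1_b, polyVal_expand x]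
    ring1

theorem odd3_lam :
    odd3 (lam 4) = 0 ∧ odd3 (lam 6) = 0 ∧ odd3 (lam 8) = 0 ∧ odd3 (lam 10) = 0 ∧
    odd3 (lam 12) = 0 ∧ odd3 (lam 14) = 0 ∧ odd3 (lam 16) = 0 ∧ odd3 (lam 18) = 0 := by
  refine ⟨?_, ?_, ?_, ?_, ?_, ?_, ?_, ?_⟩ <;>
  · refine poly_ext fun x => ?_
    simp only [lam, vf_expand, odd3_b, polyVal_expand x]
    ring1

theorem odd5_lam :
    odd5 (lam 4) = 0 ∧ odd5 (lam 6) = 0 ∧ odd5 (lam 8) = 0 ∧ odd5 (lam 10) = 0 ∧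
    odd5 (lam 12) = 0 ∧ odd5 (lam 14) = 0 ∧ odd5 (lam 16) = 0 ∧ odd5 (lam 18) = 0 := by
  refine ⟨?_, ?_, ?_, ?_, ?_, ?_, ?_, ?_⟩ <;>
  · refine poly_ext fun x => ?_
    simp only [lam, vf_expand, odd5_b, polyVal_expand x]
    ring1

theorem odd7_lam :
    odd7 (lam 4) = 0 ∧ odd7 (lam 6) = 0 ∧ odd7 (lam 8) = 0 ∧ odd7 (lam 10) = 0 ∧
    odd7 (lam 12) = 0 ∧ odd7 (lam 14) = 0 ∧ odd7 (lam 16) = 0 ∧ odd7 (lam 18) = 0 := by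
  refine ⟨?_, ?_, ?_, ?_, ?_, ?_, ?_, ?_⟩ <;>
  · refine poly_ext fun x => ?_
    simp only [lam, vf_expand, odd7_b, polyVal_expand x]
    ring1

theorem vf_smul_apply {σ : Type} (g : MvPolynomial σ ℂ) (U : PolyField σ) (f) :
    (g • U) f = g * U f := rfl

theorem vf_zero_apply {σ : Type} (f : MvPolynomial σ ℂ) : (0 : PolyField σ) f = 0 := rfl

/-! ### Recognizing a vector field from its bracket with `odd1` -/

/-- A vector field is determined by its bracket with `odd1`, its values on `λ₄`, `λ₆`, `λ₈` and
its value on `b_{1,1}`. -/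
theorem vf_eq_of_lie_odd1 {U W : BField}
    (h : ∀ f, odd1 (U f) - U (odd1 f) = odd1 (W f) - W (odd1 f))
    (h11 : U (b 1 1) = W (b 1 1)) (h4 : U (lam 4) = W (lam 4)) (h6 : U (lam 6) = W (lam 6))
    (h8 : U (lam 8) = W (lam 8)) : U = W := by
  -- The hypothesis `h` says that the difference `E` commutes with `odd1`, so `E f = 0` propagates
  -- to `odd1 f`. A zero at `b_{1,j}` thus spreads to `b_{2,j}` and `b_{3,j}`.
  obtain ⟨E, hE⟩ : ∃ E, E = U - W := ⟨_, rfl⟩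
  have hEf : ∀ f, E f = U f - W f := fun f => by rw [hE, vf_sub_apply]
  have comm : ∀ f, E f = 0 → E (odd1 f) = 0 := fun f hf => by
    have h0 := hEf f
    have h1 := congrArg odd1 (h0.symm.trans hf)
    rw [vf_map_sub, vf_map_zero] at h1
    rw [hEf]
    linear_combination h1 - h f
  have e4 : E (lam 4) = 0 := by rw [hEf, h4, sub_self]
  have e6 : E (lam 6) = 0 := by rw [hEf, h6, sub_self]
  have e8 : E (lam 8) = 0 := by rw [hEf, h8, sub_self]
  obtain ⟨⟨d1, d3, d5, d7⟩, ⟨d1', d3', d5', d7'⟩, -⟩ := odd1_b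
  have e11 : E (b 1 1) = 0 := by rw [hEf, h11, sub_self]
  have e21 : E (b 2 1) = 0 := d1 ▸ comm _ e11
  have e31 : E (b 3 1) = 0 := d1' ▸ comm _ e21
  have two : (2 : BRing) ≠ 0 := by norm_num
  -- `λ₄` is `-2 b₁₃` plus a polynomial in coordinates already killed, so `E λ₄ = 0` releases `b₁₃`.
  -- In the same way `λ₆` releases `b₁₅` and `λ₈` releases `b₁₇`.
  have e13 : E (b 1 3) = 0 := by
    simp only [lam, vf_expand, e11, e21, e31] at e4
    refine (mul_eq_zero.1 ?_).resolve_left two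
    linear_combination -e4
  have e23 : E (b 2 3) = 0 := d3 ▸ comm _ e13
  have e33 : E (b 3 3) = 0 := d3' ▸ comm _ e23
  have e15 : E (b 1 5) = 0 := by
    simp only [lam, vf_expand, e11, e21, e31, e13, e23, e33] at e6
    refine (mul_eq_zero.1 ?_).resolve_left two
    linear_combination -e6
  have e25 : E (b 2 5) = 0 := d5 ▸ comm _ e15
  have e35 : E (b 3 5) = 0 := d5' ▸ comm _ e25
  have e17 : E (b 1 7) = 0 := by
    simp only [lam, vf_expand, e11, e21, e31, e13, e23, e33, e15, e25, e35] at e8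
    refine (mul_eq_zero.1 ?_).resolve_left two
    linear_combination -e8
  have e27 : E (b 2 7) = 0 := d7 ▸ comm _ e17
  have e37 : E (b 3 7) = 0 := d7' ▸ comm _ e27
  have : E = 0 := vf_ext ⟨e11, e13, e15, e17⟩ ⟨e21, e23, e25, e27⟩ ⟨e31, e33, e35, e37⟩
  exact sub_eq_zero.1 (hE ▸ this)

/-- A vector field is determined by its bracket with `odd1` and its values on the
coordinates `b_{1,j}`. -/
theorem vf_eq_of_lie_odd1_of_b {U W : BField} (h : ⁅odd1, U⁆ = ⁅odd1, W⁆)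
    (h1 : U (b 1 1) = W (b 1 1) ∧ U (b 1 3) = W (b 1 3) ∧ U (b 1 5) = W (b 1 5) ∧
      U (b 1 7) = W (b 1 7)) : U = W := by
  have comm : ∀ f, U f = W f → U (odd1 f) = W (odd1 f) := fun f hf => by
    have := congrArg (fun V => V.apply f) h
    rw [vf_lie_apply, vf_lie_apply, hf] at this
    exact sub_right_injective this
  obtain ⟨⟨d1, d3, d5, d7⟩, ⟨d1', d3', d5', d7'⟩, -⟩ := odd1_b
  obtain ⟨e1, e3, e5, e7⟩ := h1
  have f1 := d1 ▸ comm _ e1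
  have f3 := d3 ▸ comm _ e3
  have f5 := d5 ▸ comm _ e5
  have f7 := d7 ▸ comm _ e7
  exact vf_ext ⟨e1, e3, e5, e7⟩ ⟨f1, f3, f5, f7⟩
    ⟨d1' ▸ comm _ f1, d3' ▸ comm _ f3, d5' ▸ comm _ f5, d7' ▸ comm _ f7⟩

/-! ### Projectable fields -/

theorem rhoPullback_X (i : Fin 8) : rhoPullback (X i) = lam (2 * (i : ℕ) + 4) :=
  aeval_X _ _

theorem rhoPullback_lamVar :
    rhoPullback (lamVar 4) = lam 4 ∧ rhoPullback (lamVar 6) = lam 6 ∧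
    rhoPullback (lamVar 8) = lam 8 ∧ rhoPullback (lamVar 10) = lam 10 ∧
    rhoPullback (lamVar 12) = lam 12 ∧ rhoPullback (lamVar 14) = lam 14 ∧
    rhoPullback (lamVar 16) = lam 16 ∧ rhoPullback (lamVar 18) = lam 18 :=
  ⟨rhoPullback_X 0, rhoPullback_X 1, rhoPullback_X 2, rhoPullback_X 3, rhoPullback_X 4,
    rhoPullback_X 5, rhoPullback_X 6, rhoPullback_X 7⟩

theorem rhoPullback_C (a : ℂ) : rhoPullback (C a) = C a := rhoPullback.commutes a

/-- The field `D` is projectable with pushforward `M`. -/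
def Projects (D : BField) (M : PolyField (Fin 8)) : Prop :=
  ∀ f : ParamRing, D (rhoPullback f) = rhoPullback (M f)

/-- Projectability can be checked on the coordinates of the base. -/
theorem projects_of_X {D : BField} {M : PolyField (Fin 8)}
    (h : ∀ i : Fin 8, D (lam (2 * (i : ℕ) + 4)) = rhoPullback (M (X i))) :
    Projects D M := by
  intro f
  induction f using MvPolynomial.induction_on with
  | C a => rw [rhoPullback_C, vf_C, vf_C, map_zero]
  | add f g hf hg => rw [map_add, vf_map_add, vf_map_add, hf, hg, map_add]
  | mul_X f i hf =>
    rw [map_mul, vf_leibniz, hf, rhoPullback_X, h, vf_leibniz, map_add, map_mul, map_mul,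
      rhoPullback_X]

namespace Projects

variable {D E : BField} {M N : PolyField (Fin 8)}

theorem lie (hD : Projects D M) (hE : Projects E N) : Projects ⁅D, E⁆ ⁅M, N⁆ := by
  intro f
  rw [vf_lie_apply, hE, hD, hD, hE, ← map_sub, vf_lie_apply]

theorem add (hD : Projects D M) (hE : Projects E N) : Projects (D + E) (M + N) := by
  intro f
  rw [vf_expand.1, vf_expand.1, hD, hE, map_add]

theorem sub (hD : Projects D M) (hE : Projects E N) : Projects (D - E) (M - N) := by
  intro f
  rw [vf_sub_apply, vf_sub_apply, hD, hE, map_sub]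

theorem scalar_smul (a : ℂ) (hD : Projects D M) : Projects (a • D) (a • M) := by
  intro f
  rw [vf_scalar_apply, vf_scalar_apply, hD, map_mul, rhoPullback_C]

theorem smul (g : ParamRing) (hD : Projects D M) :
    Projects (rhoPullback g • D) (g • M) := by
  intro f
  rw [vf_smul_apply, vf_smul_apply, hD, map_mul]

/-- Verticality survives arbitrary polynomial coefficients in `b`, whereas a nonzero pushforward
only survives coefficients pulled back from the base as in `smul`. -/
theorem smul_zero (g : BRing) (hD : Projects D 0) : Projects (g • D) 0 := by
  intro f
  rw [vf_smul_apply, hD, vf_zero_apply, map_zero, mul_zero]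

theorem lie_vertical (hD : Projects D M) (hE : Projects E 0) :
    Projects ⁅D, E⁆ 0 := by
  intro f
  have h : ∀ g, E (rhoPullback g) = 0 := fun g => (hE g).trans (by rw [vf_zero_apply, map_zero])
  rw [vf_lie_apply, hD, h, h, vf_map_zero, sub_zero]
  rw [vf_zero_apply, map_zero]

theorem vertical_lie (hD : Projects D 0) (hE : Projects E N) :
    Projects ⁅D, E⁆ 0 := by
  intro f
  have h : ∀ g, D (rhoPullback g) = 0 := fun g => (hD g).trans (by rw [vf_zero_apply, map_zero])
  rw [vf_lie_apply, hE, h, h, vf_map_zero, sub_zero]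
  rw [vf_zero_apply, map_zero]

theorem congr (hD : Projects D M) (h : M = N) : Projects D N := h ▸ hD

theorem lam_eq (hD : Projects D M) (i : Fin 8) :
    D (lam (2 * (i : ℕ) + 4)) = rhoPullback (M (X i)) := by
  rw [← rhoPullback_X, hD]

end Projects

/-- Two projectable fields with the same pushforward agree if they have the same bracket with
`odd1` and the same value on `b_{1,1}`. -/
theorem vf_eq_of_projects {U W : BField} {M : PolyField (Fin 8)}
    (hU : Projects U M) (hW : Projects W M)
    (h : ∀ f, odd1 (U f) - U (odd1 f) = odd1 (W f) - W (odd1 f))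
    (h11 : U (b 1 1) = W (b 1 1)) : U = W :=
  vf_eq_of_lie_odd1 h h11 ((hU.lam_eq 0).trans (hW.lam_eq 0).symm)
    ((hU.lam_eq 1).trans (hW.lam_eq 1).symm) ((hU.lam_eq 2).trans (hW.lam_eq 2).symm)

theorem forall_fin_eight {P : Fin 8 → Prop} (h : P 0 ∧ P 1 ∧ P 2 ∧ P 3 ∧ P 4 ∧ P 5 ∧ P 6 ∧ P 7)
    (i : Fin 8) : P i := by
  obtain ⟨h0, h1, h2, h3, h4, h5, h6, h7⟩ := h
  fin_cases i <;> assumption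

theorem projects_zero_of_lam {D : BField}
    (h : D (lam 4) = 0 ∧ D (lam 6) = 0 ∧ D (lam 8) = 0 ∧ D (lam 10) = 0 ∧
      D (lam 12) = 0 ∧ D (lam 14) = 0 ∧ D (lam 16) = 0 ∧ D (lam 18) = 0) : Projects D 0 := by
  refine projects_of_X fun i => ?_
  rw [vf_zero_apply, map_zero]
  exact forall_fin_eight (P := fun i => D (lam (2 * (i : ℕ) + 4)) = 0) h i

theorem odd1_projects : Projects odd1 0 :=
  projects_zero_of_lam odd1_lam

theorem odd3_projects : Projects (odd3) 0 :=
  projects_zero_of_lam odd3_lam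

theorem odd5_projects : Projects (odd5) 0 :=
  projects_zero_of_lam odd5_lam

theorem odd7_projects : Projects (odd7) 0 :=
  projects_zero_of_lam odd7_lam

/-! ### The odd fields commute -/

/-- The rigidity principle is not available yet, since it needs commutation with `odd1` as input;
hence the direct check on all twelve coordinates. -/
theorem lie_odd1_three : ⁅odd1, odd3⁆ = 0 := by
  refine vf_ext ⟨?_, ?_, ?_, ?_⟩ ⟨?_, ?_, ?_, ?_⟩ ⟨?_, ?_, ?_, ?_⟩ <;>
  · refine poly_ext fun x => ?_
    simp only [vf_lie_apply, vf_expand, odd1_b, odd3_b, polyVal_expand x]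
    ring1

theorem lie_odd1_five : ⁅odd1, odd5⁆ = 0 := by
  refine vf_ext ⟨?_, ?_, ?_, ?_⟩ ⟨?_, ?_, ?_, ?_⟩ ⟨?_, ?_, ?_, ?_⟩ <;>
  · refine poly_ext fun x => ?_
    simp only [vf_lie_apply, vf_expand, odd1_b, odd5_b, polyVal_expand x]
    ring1

theorem lie_odd1_seven : ⁅odd1, odd7⁆ = 0 := by
  refine vf_ext ⟨?_, ?_, ?_, ?_⟩ ⟨?_, ?_, ?_, ?_⟩ ⟨?_, ?_, ?_, ?_⟩ <;>
  · refine poly_ext fun x => ?_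
    simp only [vf_lie_apply, vf_expand, odd1_b, odd7_b, polyVal_expand x]
    ring1

theorem odd1_fieldOdd :
    (∀ f, odd3 (odd1 f) = odd1 (odd3 f)) ∧
    (∀ f, odd5 (odd1 f) = odd1 (odd5 f)) ∧
    (∀ f, odd7 (odd1 f) = odd1 (odd7 f)) := by
  have h3 := fun f => congrArg (fun V => V.apply f) lie_odd1_three
  have h5 := fun f => congrArg (fun V => V.apply f) lie_odd1_five
  have h7 := fun f => congrArg (fun V => V.apply f) lie_odd1_seven
  simp only [vf_lie_apply, vf_expand, sub_eq_zero] at h3 h5 h7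
  exact ⟨fun f => (h3 f).symm, fun f => (h5 f).symm, fun f => (h7 f).symm⟩

/-- The rigidity principle with zero as the second field. For brackets of odd fields the commutation
with `odd1` is automatic, so only the value on `b₁₁` has to be computed. -/
theorem vf_eq_zero_of_vertical {U : BField} (hU : Projects U 0)
    (h : ∀ f, odd1 (U f) = U (odd1 f)) (h11 : U (b 1 1) = 0) : U = 0 :=
  vf_eq_of_projects hU (fun f => by rw [vf_zero_apply, vf_zero_apply, map_zero])
    (fun f => by rw [h, vf_zero_apply, vf_zero_apply, vf_map_zero, sub_self, sub_self]) h11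

theorem lie_three_five : ⁅odd3, odd5⁆ = 0 := by
  refine vf_eq_zero_of_vertical (odd3_projects.lie_vertical
    odd5_projects) (fun f => ?_) ?_
  · simp only [vf_lie_apply, vf_expand, odd1_fieldOdd]
  · simp only [vf_lie_apply, vf_expand, odd3_b, odd5_b, sub_self]

theorem lie_three_seven : ⁅odd3, odd7⁆ = 0 := by
  refine vf_eq_zero_of_vertical (odd3_projects.lie_vertical
    odd7_projects) (fun f => ?_) ?_
  · simp only [vf_lie_apply, vf_expand, odd1_fieldOdd]
  · simp only [vf_lie_apply, vf_expand, odd3_b, odd7_b, sub_self]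

theorem lie_five_seven : ⁅odd5, odd7⁆ = 0 := by
  refine vf_eq_zero_of_vertical (odd5_projects.lie_vertical
    odd7_projects) (fun f => ?_) ?_
  · simp only [vf_lie_apply, vf_expand, odd1_fieldOdd]
  · simp only [vf_lie_apply, vf_expand, odd5_b, odd7_b, sub_self]

/-- Reordering compositions of the odd fields. -/
theorem odd_comm :
    (∀ f, odd3 (odd1 f) = odd1 (odd3 f)) ∧
    (∀ f, odd5 (odd1 f) = odd1 (odd5 f)) ∧
    (∀ f, odd7 (odd1 f) = odd1 (odd7 f)) ∧
    (∀ f, odd5 (odd3 f) = odd3 (odd5 f)) ∧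
    (∀ f, odd7 (odd3 f) = odd3 (odd7 f)) ∧
    (∀ f, odd7 (odd5 f) = odd5 (odd7 f)) := by
  have h3 := fun f => congrArg (fun V => V.apply f) lie_three_five
  have h5 := fun f => congrArg (fun V => V.apply f) lie_three_seven
  have h7 := fun f => congrArg (fun V => V.apply f) lie_five_seven
  simp only [vf_lie_apply, vf_expand, sub_eq_zero] at h3 h5 h7
  exact ⟨odd1_fieldOdd.1, odd1_fieldOdd.2.1, odd1_fieldOdd.2.2, fun f => (h3 f).symm,
    fun f => (h5 f).symm, fun f => (h7 f).symm⟩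

/-- The opposite orientation for `odd1`: it is pushed inwards, next to the argument, and not
outwards as in `odd_comm`. This is the normal form required when another field stands between the
odd fields and the argument. -/
theorem odd1_fieldOdd' :
    (∀ f, odd1 (odd3 f) = odd3 (odd1 f)) ∧
    (∀ f, odd1 (odd5 f) = odd5 (odd1 f)) ∧
    (∀ f, odd1 (odd7 f) = odd7 (odd1 f)) ∧
    (∀ f, odd5 (odd3 f) = odd3 (odd5 f)) ∧
    (∀ f, odd7 (odd3 f) = odd3 (odd7 f)) ∧
    (∀ f, odd7 (odd5 f) = odd5 (odd7 f)) :=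
  ⟨fun f => (odd_comm.1 f).symm, fun f => (odd_comm.2.1 f).symm, fun f => (odd_comm.2.2.1 f).symm,
    odd_comm.2.2.2⟩

/-- The polynomials `p_{1,j}` in terms of coordinates. -/
theorem p_one :
    p 1 1 = 2 * b 1 1 ∧ p 1 3 = 2 * b 1 3 ∧ p 1 5 = 2 * b 1 5 ∧ p 1 7 = 2 * b 1 7 ∧
    p 3 1 = 2 * b 1 3 ∧ p 5 1 = 2 * b 1 5 ∧ p 7 1 = 2 * b 1 7 ∧
    p 5 3 = p 3 5 ∧ p 7 3 = p 3 7 ∧ p 7 5 = p 5 7 :=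
  ⟨rfl, rfl, rfl, rfl, rfl, rfl, rfl, rfl, rfl, rfl⟩

/-- The symmetry of `D_i (p_{j,k})` in the three indices. -/
theorem odd_p_symm :
    odd5 (p 3 3) = odd3 (p 3 5) ∧ odd7 (p 3 3) = odd3 (p 3 7) ∧
    odd5 (p 3 5) = odd3 (p 5 5) ∧ odd7 (p 3 5) = odd3 (p 5 7) ∧
    odd5 (p 3 7) = odd3 (p 5 7) ∧ odd7 (p 3 7) = odd3 (p 7 7) ∧
    odd7 (p 5 5) = odd5 (p 5 7) ∧ odd7 (p 5 7) = odd5 (p 7 7) := by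
  refine ⟨?_, ?_, ?_, ?_, ?_, ?_, ?_, ?_⟩ <;>
  · refine poly_ext fun x => ?_
    simp only [p, p33, p35, p37, p55, p57, p77, vf_expand, odd3_b, odd5_b,
      odd7_b, polyVal_expand x]
    ring1

/-- The values of the odd fields on `b_{1,j}` in terms of the polynomials `p_{k,l}`. -/
theorem fieldOdd_b_one_p :
    (odd3 (b 1 1) = b 2 3 ∧ odd5 (b 1 1) = b 2 5 ∧ odd7 (b 1 1) = b 2 7) ∧
    (odd3 (b 1 3) = C (1 / 2) * odd1 (p 3 3) ∧
      odd3 (b 1 5) = C (1 / 2) * odd1 (p 3 5) ∧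
      odd3 (b 1 7) = C (1 / 2) * odd1 (p 3 7)) ∧
    (odd5 (b 1 3) = C (1 / 2) * odd1 (p 3 5) ∧
      odd5 (b 1 5) = C (1 / 2) * odd1 (p 5 5) ∧
      odd5 (b 1 7) = C (1 / 2) * odd1 (p 5 7)) ∧
    odd7 (b 1 3) = C (1 / 2) * odd1 (p 3 7) ∧
    odd7 (b 1 5) = C (1 / 2) * odd1 (p 5 7) ∧
    odd7 (b 1 7) = C (1 / 2) * odd1 (p 7 7) := by
  obtain ⟨-, h33, h35, h37⟩ := fieldOdd_b_one 3
  obtain ⟨-, h53, h55, h57⟩ := fieldOdd_b_one 5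
  obtain ⟨-, h73, h75, h77⟩ := fieldOdd_b_one 7
  exact ⟨⟨odd3_b.1, odd5_b.1, odd7_b.1⟩, ⟨h33, h35, h37⟩,
    ⟨h53, h55, h57⟩, h73, h75, h77⟩

/-! ### The fields on the base -/

theorem lamVar_const :
    lamVar 0 = 1 ∧ lamVar 2 = 0 ∧ lamVar 20 = 0 ∧ lamVar 22 = 0 ∧ lamVar 24 = 0 ∧
    lamVar 26 = 0 ∧ lamVar 28 = 0 ∧ lamVar 30 = 0 ∧ lamVar 32 = 0 :=
  ⟨rfl, rfl, rfl, rfl, rfl, rfl, rfl, rfl, rfl⟩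

/-- The entries of the symmetric matrix `v`. -/
theorem v_upper :
    (v 1 1 = 4 * lamVar 4 ∧
      v 1 2 = 6 * lamVar 6 ∧
      v 1 3 = 8 * lamVar 8 ∧
      v 1 4 = 10 * lamVar 10 ∧
      v 1 5 = 12 * lamVar 12 ∧
      v 1 6 = C 14 * lamVar 14 ∧
      v 1 7 = C 16 * lamVar 16 ∧
      v 1 8 = C 18 * lamVar 18) ∧
    (v 2 2 = 8 * lamVar 8 - C (28 / 9) * lamVar 4 ^ 2 ∧
      v 2 3 = 10 * lamVar 10 - C (8 / 3) * lamVar 4 * lamVar 6 ∧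
      v 2 4 = 12 * lamVar 12 - C (20 / 9) * lamVar 4 * lamVar 8 ∧
      v 2 5 = C 14 * lamVar 14 - C (16 / 9) * lamVar 4 * lamVar 10 ∧
      v 2 6 = C 16 * lamVar 16 - C (4 / 3) * lamVar 4 * lamVar 12 ∧
      v 2 7 = C 18 * lamVar 18 - C (8 / 9) * lamVar 4 * lamVar 14 ∧
      v 2 8 = -(C (4 / 9) * lamVar 4 * lamVar 16)) ∧
    (v 3 3 = 12 * lamVar 12 - 4 * lamVar 6 ^ 2 + 4 * lamVar 4 * lamVar 8 ∧
      v 3 4 = C 14 * lamVar 14 - C (10 / 3) * lamVar 6 * lamVar 8 + 6 * lamVar 4 * lamVar 10 ∧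
      v 3 5 = C 16 * lamVar 16 - C (8 / 3) * lamVar 6 * lamVar 10 + 8 * lamVar 4 * lamVar 12 ∧
      v 3 6 = C 18 * lamVar 18 - 2 * lamVar 6 * lamVar 12 + 10 * lamVar 4 * lamVar 14 ∧
      v 3 7 = -(C (4 / 3) * lamVar 6 * lamVar 14) + 12 * lamVar 4 * lamVar 16 ∧
      v 3 8 = -(C (2 / 3) * lamVar 6 * lamVar 16) + C 14 * lamVar 4 * lamVar 18) ∧
    (v 4 4 = C 16 * lamVar 16 - C (40 / 9) * lamVar 8 ^ 2 + 4 * lamVar 6 * lamVar 10 + 8 * lamVar 4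
      * lamVar 12 ∧
      v 4 5 = C 18 * lamVar 18 - C (32 / 9) * lamVar 8 * lamVar 10 + 6 * lamVar 6 * lamVar 12 + 10 *
        lamVar 4 * lamVar 14 ∧
      v 4 6 = -(C (8 / 3) * lamVar 8 * lamVar 12) + 8 * lamVar 6 * lamVar 14 + 12 * lamVar 4 *
        lamVar 16 ∧
      v 4 7 = -(C (16 / 9) * lamVar 8 * lamVar 14) + 10 * lamVar 6 * lamVar 16 + C 14 * lamVar 4 *
        lamVar 18 ∧
      v 4 8 = -(C (8 / 9) * lamVar 8 * lamVar 16) + 12 * lamVar 6 * lamVar 18) ∧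
    (v 5 5 = -(C (40 / 9) * lamVar 10 ^ 2) + 4 * lamVar 8 * lamVar 12 + 8 * lamVar 6 * lamVar 14 +
      12 * lamVar 4 * lamVar 16 ∧
      v 5 6 = -(C (10 / 3) * lamVar 10 * lamVar 12) + 6 * lamVar 8 * lamVar 14 + 10 * lamVar 6 *
        lamVar 16 + C 14 * lamVar 4 * lamVar 18 ∧
      v 5 7 = -(C (20 / 9) * lamVar 10 * lamVar 14) + 8 * lamVar 8 * lamVar 16 + 12 * lamVar 6 *
        lamVar 18 ∧
      v 5 8 = -(C (10 / 9) * lamVar 10 * lamVar 16) + 10 * lamVar 8 * lamVar 18) ∧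
    (v 6 6 = -(4 * lamVar 12 ^ 2) + 4 * lamVar 10 * lamVar 14 + 8 * lamVar 8 * lamVar 16 + 12 *
      lamVar 6 * lamVar 18 ∧
      v 6 7 = -(C (8 / 3) * lamVar 12 * lamVar 14) + 6 * lamVar 10 * lamVar 16 + 10 * lamVar 8 *
        lamVar 18 ∧
      v 6 8 = -(C (4 / 3) * lamVar 12 * lamVar 16) + 8 * lamVar 10 * lamVar 18) ∧
    (v 7 7 = -(C (28 / 9) * lamVar 14 ^ 2) + 4 * lamVar 12 * lamVar 16 + 8 * lamVar 10 * lamVar 18 ∧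
      v 7 8 = -(C (14 / 9) * lamVar 14 * lamVar 16) + 6 * lamVar 12 * lamVar 18) ∧
    v 8 8 = -(C (16 / 9) * lamVar 16 ^ 2) + 4 * lamVar 14 * lamVar 18 := by
  refine ⟨⟨?_, ?_, ?_, ?_, ?_, ?_, ?_, ?_⟩, ⟨?_, ?_, ?_, ?_, ?_, ?_, ?_⟩, ⟨?_, ?_, ?_, ?_, ?_, ?_⟩,
    ⟨?_, ?_, ?_, ?_, ?_⟩, ⟨?_, ?_, ?_, ?_⟩, ⟨?_, ?_, ?_⟩, ⟨?_, ?_⟩, ?_⟩ <;>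
  · refine poly_ext fun x => ?_
    simp only [v, vUpper, Nat.reduceAdd, Nat.reduceMul, Nat.reduceSub, Nat.reduceLeDiff, if_true,
      if_false, Finset.sum_range_succ, Finset.sum_range_zero, lamVar_const, polyVal_expand x,
      Nat.cast_ofNat, Nat.cast_one, Nat.cast_zero]
    ring1

theorem v_comm (k m : ℕ) : v k m = v m k := by
  rcases lt_trichotomy k m with h | rfl | h
  · rw [v, v, if_pos h.le, if_neg h.not_ge]
  · rfl
  · rw [v, v, if_pos h.le, if_neg h.not_ge]

theorem v_lower :
    v 2 1 = v 1 2 ∧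
    v 3 1 = v 1 3 ∧ v 3 2 = v 2 3 ∧
    v 4 1 = v 1 4 ∧ v 4 2 = v 2 4 ∧ v 4 3 = v 3 4 ∧
    v 5 1 = v 1 5 ∧ v 5 2 = v 2 5 ∧ v 5 3 = v 3 5 ∧ v 5 4 = v 4 5 ∧
    v 6 1 = v 1 6 ∧ v 6 2 = v 2 6 ∧ v 6 3 = v 3 6 ∧ v 6 4 = v 4 6 ∧ v 6 5 = v 5 6 ∧
    v 7 1 = v 1 7 ∧ v 7 2 = v 2 7 ∧ v 7 3 = v 3 7 ∧ v 7 4 = v 4 7 ∧ v 7 5 = v 5 7 ∧ v 7 6 = v 6 7 ∧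
    v 8 1 = v 1 8 ∧ v 8 2 = v 2 8 ∧ v 8 3 = v 3 8 ∧ v 8 4 = v 4 8 ∧ v 8 5 = v 5 8 ∧ v 8 6 = v 6 8 ∧
      v 8 7 = v 7 8 := by
  simp only [v_comm, and_self]

/-- The fields `L_{2k}`. -/
noncomputable def base (k : ℕ) : PolyField (Fin 8) :=
  mkDerivation ℂ fun i : Fin 8 => v (k + 1) ((i : ℕ) + 1)

theorem base_lamVar (k : ℕ) :
    base k (lamVar 4) = v (k + 1) 1 ∧ base k (lamVar 6) = v (k + 1) 2 ∧
    base k (lamVar 8) = v (k + 1) 3 ∧ base k (lamVar 10) = v (k + 1) 4 ∧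
    base k (lamVar 12) = v (k + 1) 5 ∧ base k (lamVar 14) = v (k + 1) 6 ∧
    base k (lamVar 16) = v (k + 1) 7 ∧ base k (lamVar 18) = v (k + 1) 8 :=
  ⟨mkDerivation_X _ _ 0, mkDerivation_X _ _ 1, mkDerivation_X _ _ 2, mkDerivation_X _ _ 3,
    mkDerivation_X _ _ 4, mkDerivation_X _ _ 5, mkDerivation_X _ _ 6, mkDerivation_X _ _ 7⟩

/-- A vector field on the base is determined by its values on the coordinates. -/
theorem base_ext {U W : PolyField (Fin 8)}
    (h : U (lamVar 4) = W (lamVar 4) ∧ U (lamVar 6) = W (lamVar 6) ∧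
      U (lamVar 8) = W (lamVar 8) ∧ U (lamVar 10) = W (lamVar 10) ∧
      U (lamVar 12) = W (lamVar 12) ∧ U (lamVar 14) = W (lamVar 14) ∧
      U (lamVar 16) = W (lamVar 16) ∧ U (lamVar 18) = W (lamVar 18)) : U = W :=
  MvPolynomial.derivation_ext (D₁ := U.toDerivation) (D₂ := W.toDerivation)
    fun i => forall_fin_eight (P := fun i => U (X i) = W (X i)) h i

/-- The rational coefficient in the structure polynomial `c_{2i,2j}^{2k}` for `i < j`. -/
noncomputable def structCoef (i j k : ℕ) : ℂ :=
  if j ≤ k then 2 * ((j : ℂ) - i)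
  else if k + 1 = j then -(2 * (i + 1) * (8 - j) / 9)
  else if k + 1 = i then 2 * (i + 1) * (8 - j) / 9
  else if k + 2 ≤ i then -(2 * ((j : ℂ) - i))
  else 0

/-- The structure polynomial `c_{2i,2j}^{2k}` for `i < j`. -/
noncomputable def structUpper (i j k : ℕ) : ParamRing :=
  -- The guard is needed: for `k > i + j` the truncated subtraction would yield `lamVar 0 = 1` and
  -- not zero.
  if k ≤ i + j then C (structCoef i j k) * lamVar (2 * (i + j - k)) else 0

/-- The combination of the fields `L_{2k}` with given coefficients. -/
noncomputable def baseSum (a : ℕ → ParamRing) : PolyField (Fin 8) :=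
  a 0 • base 0 + a 1 • base 1 + a 2 • base 2 + a 3 • base 3 + a 4 • base 4 + a 5 • base 5 +
    a 6 • base 6 + a 7 • base 7

-- A finite verification: 28 pairs, each compared on the eight coordinates through the table of
-- entries of `v`. Convention `λ₂ = 0` and the vanishing of `λ_s` for `s > 18` remove the
-- superfluous terms of the closed formula.
set_option maxHeartbeats 4000000 in
theorem lie_base {i j : ℕ} (hij : i < j) (hj : j < 8) :
    ⁅base i, base j⁆ = baseSum (structUpper i j) := by
  interval_cases j <;> interval_cases i <;>
  simp only [baseSum, structUpper, structCoef, Nat.reduceAdd, Nat.reduceLeDiff, Nat.reduceEqDiff,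
    Nat.reduceSub, Nat.reduceMul, if_true, if_false, lamVar_const, C_0, zero_mul, zero_smul,
    zero_add, add_zero, Nat.cast_ofNat, Nat.cast_one, Nat.cast_zero] <;>
  refine base_ext ⟨?_, ?_, ?_, ?_, ?_, ?_, ?_, ?_⟩ <;>
  · refine poly_ext fun x => ?_
    simp only [vf_lie_apply, vf_expand, base_lamVar, Nat.reduceAdd, v_upper, v_lower,
      polyVal_expand x]
    ring1

local notation "κ" => (C : ℂ →+* BRing)

/-! ### The even fields -/

/-- The rule `0 ↦ D₀` on the coordinates. -/
theorem euler_b :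
    (euler (b 1 1) = 2 * b 1 1 ∧ euler (b 1 3) = 4 * b 1 3 ∧
      euler (b 1 5) = 6 * b 1 5 ∧ euler (b 1 7) = 8 * b 1 7) ∧
    (euler (b 2 1) = 3 * b 2 1 ∧ euler (b 2 3) = 5 * b 2 3 ∧
      euler (b 2 5) = 7 * b 2 5 ∧ euler (b 2 7) = 9 * b 2 7) ∧
    euler (b 3 1) = 4 * b 3 1 ∧ euler (b 3 3) = 6 * b 3 3 ∧
      euler (b 3 5) = 8 * b 3 5 ∧ euler (b 3 7) = 10 * b 3 7 := by
  have h (i : Idx) : euler (X i) = _ := mkDerivation_X ℂ _ i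
  refine ⟨⟨?_, ?_, ?_, ?_⟩, ⟨?_, ?_, ?_, ?_⟩, ?_, ?_, ?_, ?_⟩ <;>
    simp [h, b, wt]

theorem projects_of_lam {D : BField} {M : PolyField (Fin 8)}
    (h : D (lam 4) = rhoPullback (M (lamVar 4)) ∧ D (lam 6) = rhoPullback (M (lamVar 6)) ∧
      D (lam 8) = rhoPullback (M (lamVar 8)) ∧ D (lam 10) = rhoPullback (M (lamVar 10)) ∧
      D (lam 12) = rhoPullback (M (lamVar 12)) ∧ D (lam 14) = rhoPullback (M (lamVar 14)) ∧
      D (lam 16) = rhoPullback (M (lamVar 16)) ∧ D (lam 18) = rhoPullback (M (lamVar 18))) :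
    Projects D M :=
  projects_of_X
    (forall_fin_eight (P := fun i => D (lam (2 * (i : ℕ) + 4)) = rhoPullback (M (X i))) h)

/-- Rules that expand the pullback of an expression in the `λ_s`. -/
theorem rhoPullback_expand :
    (∀ f g, rhoPullback (f + g) = rhoPullback f + rhoPullback g) ∧
    (∀ f g, rhoPullback (f - g) = rhoPullback f - rhoPullback g) ∧
    (∀ f, rhoPullback (-f) = - rhoPullback f) ∧
    (∀ f g, rhoPullback (f * g) = rhoPullback f * rhoPullback g) ∧
    (∀ f (n : ℕ), rhoPullback (f ^ n) = rhoPullback f ^ n) ∧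
    (rhoPullback 2 = 2 ∧ rhoPullback 3 = 3 ∧ rhoPullback 4 = 4 ∧ rhoPullback 5 = 5 ∧
      rhoPullback 6 = 6 ∧ rhoPullback 7 = 7 ∧ rhoPullback 8 = 8 ∧ rhoPullback 9 = 9 ∧
      rhoPullback 10 = 10 ∧ rhoPullback 12 = 12) ∧
    (∀ a, rhoPullback (C a) = C a) ∧
    rhoPullback 0 = 0 ∧ rhoPullback 1 = 1 :=
  ⟨map_add _, map_sub _, map_neg _, map_mul _, map_pow _,
    ⟨map_ofNat rhoPullback 2, map_ofNat rhoPullback 3, map_ofNat rhoPullback 4,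
    map_ofNat rhoPullback 5, map_ofNat rhoPullback 6, map_ofNat rhoPullback 7,
    map_ofNat rhoPullback 8, map_ofNat rhoPullback 9, map_ofNat rhoPullback 10,
    map_ofNat rhoPullback 12⟩,
    rhoPullback_C, map_zero _, map_one _⟩

/-- The row `v_{2,2m}` equals `2(m + 1) λ_{2m+2}`, so `L₀` is the Euler field of the base, and `λ_s`
has weight `s` in the `b_{i,j}`. -/
theorem euler_projects : Projects euler (base 0) := by
  refine projects_of_lam ⟨?_, ?_, ?_, ?_, ?_, ?_, ?_, ?_⟩ <;>
  · refine poly_ext fun x => ?_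
    simp only [base_lamVar, v_upper, Nat.reduceAdd, rhoPullback_expand, rhoPullback_lamVar, lam,
      vf_expand, euler_b, polyVal_expand x]
    ring1

theorem lie_euler_odd1 : ⁅euler, odd1⁆ = odd1 := by
  refine vf_ext ⟨?_, ?_, ?_, ?_⟩ ⟨?_, ?_, ?_, ?_⟩ ⟨?_, ?_, ?_, ?_⟩ <;>
  · simp only [vf_lie_apply, odd1_b, euler_b, vf_expand]
    ring1

/-- Both sides are vertical and, by `lie_euler_odd1` and commutation of `odd1` with `odd3`, have the
same bracket with `odd1`; rigidity leaves the value on `b₁₁`. The cases of `D₅` and `D₇` are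
identical. -/
theorem lie_euler_odd3 : ⁅euler, odd3⁆ = (3 : ℂ) • odd3 := by
  refine vf_eq_of_projects (M := 0)
    (euler_projects.lie_vertical odd3_projects)
    ((odd3_projects.scalar_smul _).congr (smul_zero _)) (fun f => ?_) ?_
  · have h := fun g => congrArg (fun V => V.apply g) lie_euler_odd1
    simp only [vf_lie_apply, sub_eq_iff_eq_add'] at h
    simp only [vf_lie_apply, vf_expand, odd1_fieldOdd, h]
    ring1
  · refine poly_ext fun x => ?_
    simp only [vf_lie_apply, vf_expand, odd3_b, euler_b, polyVal_expand x]
    ring1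

theorem lie_euler_odd5 : ⁅euler, odd5⁆ = (5 : ℂ) • odd5 := by
  refine vf_eq_of_projects (M := 0)
    (euler_projects.lie_vertical odd5_projects)
    ((odd5_projects.scalar_smul _).congr (smul_zero _)) (fun f => ?_) ?_
  · have h := fun g => congrArg (fun V => V.apply g) lie_euler_odd1
    simp only [vf_lie_apply, sub_eq_iff_eq_add'] at h
    simp only [vf_lie_apply, vf_expand, odd1_fieldOdd, h]
    ring1
  · refine poly_ext fun x => ?_
    simp only [vf_lie_apply, vf_expand, odd5_b, euler_b, polyVal_expand x]
    ring1

theorem lie_euler_odd7 : ⁅euler, odd7⁆ = (7 : ℂ) • odd7 := by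
  refine vf_eq_of_projects (M := 0)
    (euler_projects.lie_vertical odd7_projects)
    ((odd7_projects.scalar_smul _).congr (smul_zero _)) (fun f => ?_) ?_
  · have h := fun g => congrArg (fun V => V.apply g) lie_euler_odd1
    simp only [vf_lie_apply, sub_eq_iff_eq_add'] at h
    simp only [vf_lie_apply, vf_expand, odd1_fieldOdd, h]
    ring1
  · refine poly_ext fun x => ?_
    simp only [vf_lie_apply, vf_expand, odd7_b, euler_b, polyVal_expand x]
    ring1

/-- Commuting the odd fields past the Euler field. -/
theorem odd_euler (f : BRing) :
    odd1 (euler f) = euler (odd1 f) - odd1 f ∧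
    odd3 (euler f) = euler (odd3 f) - 3 * odd3 f ∧
    odd5 (euler f) = euler (odd5 f) - 5 * odd5 f ∧
    odd7 (euler f) = euler (odd7 f) - 7 * odd7 f := by
  have h1 := congrArg (fun V => V.apply f) lie_euler_odd1
  have h3 := congrArg (fun V => V.apply f) lie_euler_odd3
  have h5 := congrArg (fun V => V.apply f) lie_euler_odd5
  have h7 := congrArg (fun V => V.apply f) lie_euler_odd7
  simp only [vf_lie_apply, vf_expand, map_ofNat] at h1 h3 h5 h7
  exact ⟨by linear_combination -h1, by linear_combination -h3, by linear_combination -h5,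
    by linear_combination -h7⟩

/-! ### Fields prescribed by values on `b_{1,j}` and a bracket with `D₁` -/

/-- The vector field `F` with `F(b_{1,2j+1}) = w j` and with `[odd1, F] = Z` on the coordinates
`b_{1,j}` and `b_{2,j}`. -/
noncomputable def liftField (w : Fin 4 → BRing) (Z : BField) : BField :=
  mkDerivation ℂ fun x : Idx =>
    ![w x.2, odd1 (w x.2) - Z (b 1 (2 * (x.2 : ℕ) + 1)),
      odd1 (odd1 (w x.2) - Z (b 1 (2 * (x.2 : ℕ) + 1))) - Z (b 2 (2 * (x.2 : ℕ) + 1))] x.1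

theorem liftField_b_one (w : Fin 4 → BRing) (Z : BField) :
    liftField w Z (b 1 1) = w 0 ∧ liftField w Z (b 1 3) = w 1 ∧
    liftField w Z (b 1 5) = w 2 ∧ liftField w Z (b 1 7) = w 3 := by
  refine ⟨?_, ?_, ?_, ?_⟩ <;> exact mkDerivation_X _ _ _

theorem liftField_b_two (w : Fin 4 → BRing) (Z : BField) :
    liftField w Z (b 2 1) = odd1 (w 0) - Z (b 1 1) ∧
    liftField w Z (b 2 3) = odd1 (w 1) - Z (b 1 3) ∧
    liftField w Z (b 2 5) = odd1 (w 2) - Z (b 1 5) ∧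
    liftField w Z (b 2 7) = odd1 (w 3) - Z (b 1 7) := by
  refine ⟨?_, ?_, ?_, ?_⟩ <;> exact mkDerivation_X _ _ _

theorem liftField_b_three (w : Fin 4 → BRing) (Z : BField) :
    liftField w Z (b 3 1) = odd1 (odd1 (w 0) - Z (b 1 1)) - Z (b 2 1) ∧
    liftField w Z (b 3 3) = odd1 (odd1 (w 1) - Z (b 1 3)) - Z (b 2 3) ∧
    liftField w Z (b 3 5) = odd1 (odd1 (w 2) - Z (b 1 5)) - Z (b 2 5) ∧
    liftField w Z (b 3 7) = odd1 (odd1 (w 3) - Z (b 1 7)) - Z (b 2 7) := by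
  refine ⟨?_, ?_, ?_, ?_⟩ <;> exact mkDerivation_X _ _ _

/-- On `b_{1,j}` and `b_{2,j}` the bracket is `Z` by construction. On `b_{3,j}` the field `odd1`
leaves the coordinates and returns a polynomial, which makes the four hypotheses genuine
compatibility conditions. -/
theorem lie_odd1_liftField (w : Fin 4 → BRing) (Z : BField)
    (h1 : ⁅odd1, liftField w Z⁆ (b 3 1) = Z (b 3 1))
    (h3 : ⁅odd1, liftField w Z⁆ (b 3 3) = Z (b 3 3))
    (h5 : ⁅odd1, liftField w Z⁆ (b 3 5) = Z (b 3 5))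
    (h7 : ⁅odd1, liftField w Z⁆ (b 3 7) = Z (b 3 7)) : ⁅odd1, liftField w Z⁆ = Z := by
  refine vf_ext ⟨?_, ?_, ?_, ?_⟩ ⟨?_, ?_, ?_, ?_⟩ ⟨h1, h3, h5, h7⟩ <;>
  simp only [vf_lie_apply, odd1_b, liftField_b_one, liftField_b_two, liftField_b_three,
    sub_sub_cancel]

/-! ### Brackets of the odd fields with an even field -/

/-- The combination of the odd fields with given coefficients. -/
noncomputable def oddSum (r : Fin 4 → BRing) : BField :=
  r 0 • odd1 + r 1 • odd3 + r 2 • odd5 + r 3 • odd7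

theorem oddSum_projects (r : Fin 4 → BRing) : Projects (oddSum r) 0 := by
  simpa only [oddSum, add_zero] using (((odd1_projects.smul_zero _).add (odd3_projects.smul_zero
    _)).add
    (odd5_projects.smul_zero _)).add (odd7_projects.smul_zero _)

theorem field_ext {U W : BField} (h : ∀ f, U f = W f) : U = W :=
  vf_ext ⟨h _, h _, h _, h _⟩ ⟨h _, h _, h _, h _⟩ ⟨h _, h _, h _, h _⟩

/-- A bracket relation oriented as a rewriting rule that moves `U` past `W`; normal forms of
operator words are computed with it. -/
theorem lie_apply {U W V : BField} (h : ⁅U, W⁆ = V) (f : BRing) : U (W f) = W (U f) + V f := by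
  rw [← h, vf_lie_apply]; ring

/-- The values on `b_{2,j}` and `b_{3,j}` of a field with given bracket with `odd1`. -/
theorem apply_b_two {F V : BField} (h : ⁅odd1, F⁆ = V) :
    F (b 2 1) = odd1 (F (b 1 1)) - V (b 1 1) ∧ F (b 2 3) = odd1 (F (b 1 3)) - V (b 1 3) ∧
    F (b 2 5) = odd1 (F (b 1 5)) - V (b 1 5) ∧ F (b 2 7) = odd1 (F (b 1 7)) - V (b 1 7) := by
  simp only [lie_apply h, odd1_b, add_sub_cancel_right, and_self]

theorem apply_b_three {F V : BField} (h : ⁅odd1, F⁆ = V) :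
    F (b 3 1) = odd1 (F (b 2 1)) - V (b 2 1) ∧ F (b 3 3) = odd1 (F (b 2 3)) - V (b 2 3) ∧
    F (b 3 5) = odd1 (F (b 2 5)) - V (b 2 5) ∧ F (b 3 7) = odd1 (F (b 2 7)) - V (b 2 7) := by
  simp only [lie_apply h, odd1_b, add_sub_cancel_right, and_self]

/-- The commutation relations of the odd fields with the field `D_{2k+2}`. -/
structure OddRelations (F : BField) (k : Fin 7) : Prop where
  one : ⁅odd1, F⁆ = oddSum (M1 k)
  three : ⁅odd3, F⁆ = (1 / 2 : ℂ) • oddSum (M3 k) + (1 / 3 : ℂ) • e3 k • odd1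
  five : ⁅odd5, F⁆ = (1 / 2 : ℂ) • oddSum (M5 k) + (4 / 9 : ℂ) • e57 k • odd3
  seven : ⁅odd7, F⁆ = (1 / 2 : ℂ) • oddSum (M7 k) + (2 / 9 : ℂ) • e57 k • odd5

/-- This is the coefficient form of Jacobi. If `S` commutes with `D₁` and `[D₁, F] = Σ mᵢ D_{2i+1}`,
then `[D₁, [S, F]] = Σ S(mᵢ) D_{2i+1}`, so the coefficients of `[S, F]` must be `D₁`-primitives of
`S(mᵢ)`. The entries of `M3`, `M5`, `M7` are such primitives up to the factor `1/2`; the terms in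
`λ_s` they contain are constants of integration. -/
theorem odd_M1 (k : Fin 7) (i : Fin 4) :
    odd3 (M1 k i) = κ (1 / 2) * odd1 (M3 k i) ∧ odd5 (M1 k i) = κ (1 / 2) * odd1 (M5 k i) ∧
    odd7 (M1 k i) = κ (1 / 2) * odd1 (M7 k i) := by
  have h : κ 2⁻¹ * 2 = (1 : BRing) := by
    refine poly_ext fun x => ?_
    simp only [polyVal_expand x]
    norm_num
  fin_cases k <;> fin_cases i <;>
    simp [M1, M3, M5, M7, vf_expand, fieldOdd_b_one_p, odd1_lam, odd1_b, ← mul_assoc, h]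

theorem odd1_e3 (k : Fin 7) : odd1 (e3 k) = 0 := by
  fin_cases k <;> simp [e3, vf_expand, odd1_lam]

theorem odd1_e57 (k : Fin 7) : odd1 (e57 k) = 0 := by
  fin_cases k <;> simp [e57, vf_expand, odd1_lam]

/-- A criterion for the commutation relation of an odd field with a projectable field. -/
theorem lie_odd_eq {S T F : BField} {M : PolyField (Fin 8)} {m r : Fin 4 → BRing} {a : ℂ}
    {g : BRing} (hS : Projects S 0)
    (hc : ∀ f, odd1 (S f) = S (odd1 f) ∧ S (odd3 f) = odd3 (S f) ∧ S (odd5 f) = odd5 (S f) ∧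
      S (odd7 f) = odd7 (S f))
    (hT : Projects T 0) (hT1 : ∀ f, odd1 (T f) = T (odd1 f)) (hF : Projects F M)
    (h1 : ⁅odd1, F⁆ = oddSum m) (hm : ∀ i, S (m i) = κ (1 / 2) * odd1 (r i)) (hg : odd1 g = 0)
    (h11 : S (F (b 1 1)) - F (S (b 1 1)) =
      ((1 / 2 : ℂ) • oddSum r + a • g • T : BField) (b 1 1)) :
    ⁅S, F⁆ = (1 / 2 : ℂ) • oddSum r + a • g • T := by
  refine vf_eq_of_projects (M := 0) (hS.vertical_lie hF) ?_ (fun f => ?_)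
    ((vf_lie_apply _ _ _).trans h11)
  · simpa only [add_zero, smul_zero] using
      ((oddSum_projects r).scalar_smul _).add ((hT.smul_zero g).scalar_smul a)
  -- Jacobi on an arbitrary `f`: by `hm` the coefficients `S (m i)` match `odd1` of the proposed
  -- ones. The extra term `a • g • T` is invisible here, because `odd1` kills `g` and commutes with
  -- `T`.
  · simp only [vf_lie_apply, vf_expand, oddSum, hc, lie_apply h1, hm, hg, hT1, odd1_fieldOdd']
    ring1

/-- Jacobi determines the three brackets up to vertical fields commuting with `odd1`, and the value
on `b₁₁` removes that ambiguity. Since the odd fields send `b₁₁` to `b₂₃`, `b₂₅`, `b₂₇`, only the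
values of `F` on `b₁₁` and on these coordinates enter. -/
theorem OddRelations.of_projects {F : BField} {k : Fin 7} {M : PolyField (Fin 8)}
    (hF : Projects F M) (h1 : ⁅odd1, F⁆ = oddSum (M1 k))
    (h3 : odd3 (F (b 1 1)) - F (b 2 3) =
      ((1 / 2 : ℂ) • oddSum (M3 k) + (1 / 3 : ℂ) • e3 k • odd1 : BField) (b 1 1))
    (h5 : odd5 (F (b 1 1)) - F (b 2 5) =
      ((1 / 2 : ℂ) • oddSum (M5 k) + (4 / 9 : ℂ) • e57 k • odd3 : BField) (b 1 1))
    (h7 : odd7 (F (b 1 1)) - F (b 2 7) =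
      ((1 / 2 : ℂ) • oddSum (M7 k) + (2 / 9 : ℂ) • e57 k • odd5 : BField) (b 1 1)) :
    OddRelations F k where
  one := h1
  three := lie_odd_eq odd3_projects (fun f => by simp only [odd_comm, and_self]) odd1_projects
    (fun f => rfl) hF h1 (fun i => (odd_M1 k i).1) (odd1_e3 k) (by rw [odd3_b.1, h3])
  five := lie_odd_eq odd5_projects (fun f => by simp only [odd_comm, and_self]) odd3_projects
    (fun f => by rw [odd_comm.1]) hF h1 (fun i => (odd_M1 k i).2.1) (odd1_e57 k)
    (by rw [odd5_b.1, h5])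
  seven := lie_odd_eq odd7_projects (fun f => by simp only [odd_comm, and_self]) odd5_projects
    (fun f => by rw [odd_comm.2.1]) hF h1 (fun i => (odd_M1 k i).2.2) (odd1_e57 k)
    (by rw [odd7_b.1, h7])

/-- Moving the odd fields past the field `D_{2k+2}`. -/
theorem OddRelations.apply {F : BField} {k : Fin 7} (h : OddRelations F k) (f : BRing) :
    odd1 (F f) = F (odd1 f) +
      (M1 k 0 * odd1 f + M1 k 1 * odd3 f + M1 k 2 * odd5 f + M1 k 3 * odd7 f) ∧
    odd3 (F f) = F (odd3 f) + (κ (1 / 2) *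
      (M3 k 0 * odd1 f + M3 k 1 * odd3 f + M3 k 2 * odd5 f + M3 k 3 * odd7 f) +
        κ (1 / 3) * (e3 k * odd1 f)) ∧
    odd5 (F f) = F (odd5 f) + (κ (1 / 2) *
      (M5 k 0 * odd1 f + M5 k 1 * odd3 f + M5 k 2 * odd5 f + M5 k 3 * odd7 f) +
        κ (4 / 9) * (e57 k * odd3 f)) ∧
    odd7 (F f) = F (odd7 f) + (κ (1 / 2) *
      (M7 k 0 * odd1 f + M7 k 1 * odd3 f + M7 k 2 * odd5 f + M7 k 3 * odd7 f) +
        κ (2 / 9) * (e57 k * odd5 f)) := by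
  have h1 := lie_apply h.one f
  have h3 := lie_apply h.three f
  have h5 := lie_apply h.five f
  have h7 := lie_apply h.seven f
  simp only [oddSum, vf_expand] at h1 h3 h5 h7
  exact ⟨h1, h3, h5, h7⟩

/-! ### The fields `D₂` and `D₄`, lifted from their prescribed values -/

/-- The values of `D₂` on `b_{1,1}, b_{1,3}, b_{1,5}, b_{1,7}`. -/
noncomputable def values2 : Fin 4 → BRing :=
  ![- b 1 1 ^ 2 + κ (1 / 2) * b 3 1 + 2 * b 1 3 + κ (7 / 9) * lam 4,
    - b 1 1 * b 1 3 + κ (1 / 2) * b 3 3 + 3 * b 1 5 - κ (4 / 3) * lam 4 * b 1 1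
      + κ (1 / 2) * p 3 3,
    - b 1 1 * b 1 5 + κ (1 / 2) * b 3 5 + 5 * b 1 7 - κ (8 / 9) * lam 4 * b 1 3
      + κ (1 / 2) * p 3 5,
    - b 1 1 * b 1 7 + κ (1 / 2) * b 3 7 - κ (4 / 9) * lam 4 * b 1 5 + κ (1 / 2) * p 3 7]

/-- The values of `D₄` on `b_{1,1}, b_{1,3}, b_{1,5}, b_{1,7}`. -/
noncomputable def values4 : Fin 4 → BRing :=
  ![- 2 * b 1 1 * b 1 3 + b 3 3 + 2 * b 1 5 + κ (2 / 3) * lam 6,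
    - b 1 3 ^ 2 + 3 * b 1 7 + lam 4 * b 1 3 - 2 * lam 6 * b 1 1 - lam 8
      - κ (1 / 2) * b 1 1 * p 3 3 + κ (1 / 2) * p'' 3 3 + κ (1 / 2) * p 3 5,
    - b 1 3 * b 1 5 + 3 * lam 4 * b 1 5 - κ (4 / 3) * lam 6 * b 1 3
      - κ (1 / 2) * b 1 1 * p 3 5 + κ (1 / 2) * p'' 3 5 + κ (1 / 2) * p 5 5,
    - b 1 3 * b 1 7 + 5 * lam 4 * b 1 7 - κ (2 / 3) * lam 6 * b 1 5
      - κ (1 / 2) * b 1 1 * p 3 7 + κ (1 / 2) * p'' 3 7 + κ (1 / 2) * p 5 7]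

/-- The field `D₂`. -/
noncomputable def field2 : BField := liftField values2 (oddSum (M1 0))

/-- The field `D₄`. -/
noncomputable def field4 : BField := liftField values4 (oddSum (M1 1))

/-- Every even field gets its values on `b_{1,j}` in two forms. This one, in the coordinates alone,
serves the explicit checks; `field2_b_one_p`, in terms of `p_{k,l}` and `λ_s`, serves the checks on
an arbitrary `f`, where the `p_{k,l}` are never expanded. -/
theorem field2_b_one :
    field2 (b 1 1) =
      -(κ (10 / 3) * b 1 1 ^ 2) + κ (4 / 9) * b 1 3 + κ (8 / 9) * b 3 1 ∧
    field2 (b 1 3) =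
      4 * b 1 1 ^ 3 + κ (14 / 3) * b 1 1 * b 1 3 - κ (2 / 3) * b 1 1 * b 3 1 + 6 * b 1 5 ∧
    field2 (b 1 5) =
      κ (8 / 3) * b 1 1 ^ 2 * b 1 3 + 2 * b 1 1 * b 1 5 + κ (16 / 9) * b 1 3 ^ 2
      - κ (4 / 9) * b 1 3 * b 3 1 + 8 * b 1 7 ∧
    field2 (b 1 7) =
      κ (4 / 3) * b 1 1 ^ 2 * b 1 5 + 2 * b 1 1 * b 1 7 + κ (8 / 9) * b 1 3 * b 1 5
      - κ (2 / 9) * b 1 5 * b 3 1 := by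
  have h := liftField_b_one values2
  refine ⟨?_, ?_, ?_, ?_⟩ <;>
  · refine poly_ext fun x => ?_
    simp only [field2, h]
    simp only [values2, p''_eq, Matrix.cons_val, vf_expand, odd1_b, p, p33, p35, p37, p55, p57,
      p77, lam, polyVal_expand x]
    ring1

theorem field2_b_two :
    field2 (b 2 1) =
      3 * b 1 1 * b 2 1 + 5 * b 2 3 ∧
    field2 (b 2 3) =
      4 * b 1 1 ^ 2 * b 2 1 + κ (17 / 3) * b 1 3 * b 2 1 - κ (2 / 3) * b 2 1 * b 3 1 + 7 * b 2 5 ∧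
    field2 (b 2 5) =
      κ (8 / 3) * b 1 1 ^ 2 * b 2 3 + κ (16 / 9) * b 1 3 * b 2 3 + 3 * b 1 5 * b 2 1
      - κ (4 / 9) * b 2 3 * b 3 1 + 9 * b 2 7 ∧
    field2 (b 2 7) =
      κ (4 / 3) * b 1 1 ^ 2 * b 2 5 + κ (8 / 9) * b 1 3 * b 2 5 + 3 * b 1 7 * b 2 1
      - κ (2 / 9) * b 2 5 * b 3 1 := by
  have h := liftField_b_two values2
  have h' := liftField_b_one values2
  have hv := field2_b_one
  simp only [field2, h'] at hv
  refine ⟨?_, ?_, ?_, ?_⟩ <;>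
  · refine poly_ext fun x => ?_
    simp only [field2, h]
    simp only [hv]
    simp only [oddSum, vf_expand, odd1_b, odd3_b, odd5_b, odd7_b, M1, M3, M5, M7, e3, e57,
      Matrix.of_apply, Matrix.cons_val, polyVal_expand x]
    ring1

theorem field2_b_three :
    field2 (b 3 1) =
      2 * b 1 1 * b 3 1 + 3 * b 2 1 ^ 2 + 6 * b 3 3 ∧
    field2 (b 3 3) =
      4 * b 1 1 ^ 2 * b 3 1 - 2 * b 1 1 * b 3 3 + κ (20 / 3) * b 1 3 * b 3 1 + 3 * b 2 1 * b 2 3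
      - κ (2 / 3) * b 3 1 ^ 2 + 8 * b 3 5 ∧
    field2 (b 3 5) =
      κ (8 / 3) * b 1 1 ^ 2 * b 3 3 - 2 * b 1 1 * b 3 5 + κ (16 / 9) * b 1 3 * b 3 3
      + 4 * b 1 5 * b 3 1 + 3 * b 2 1 * b 2 5 - κ (4 / 9) * b 3 1 * b 3 3 + 10 * b 3 7 ∧
    field2 (b 3 7) =
      κ (4 / 3) * b 1 1 ^ 2 * b 3 5 - 2 * b 1 1 * b 3 7 + κ (8 / 9) * b 1 3 * b 3 5
      + 4 * b 1 7 * b 3 1 + 3 * b 2 1 * b 2 7 - κ (2 / 9) * b 3 1 * b 3 5 := by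
  have h := liftField_b_three values2
  have h' := liftField_b_two values2
  have hv := field2_b_two
  simp only [field2, h'] at hv
  refine ⟨?_, ?_, ?_, ?_⟩ <;>
  · refine poly_ext fun x => ?_
    simp only [field2, h]
    simp only [hv]
    simp only [oddSum, vf_expand, odd1_b, odd3_b, odd5_b, odd7_b, M1, M3, M5, M7, e3, e57,
      Matrix.of_apply, Matrix.cons_val, polyVal_expand x]
    ring1

/-- Here the prescribed values are seen to be consistent: the compatibility conditions on `b_{3,j}`
are polynomial identities that depend on the particular choice of `values2`. -/
theorem lie_odd1_field2 : ⁅odd1, field2⁆ = oddSum (M1 0) := by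
  have h : field2 = liftField values2 _ := rfl
  apply lie_odd1_liftField <;>
  · refine poly_ext fun x => ?_
    rw [← h]
    simp only [vf_lie_apply, oddSum, vf_expand, field2_b_one, field2_b_two, field2_b_three,
      odd1_b, odd3_b, odd5_b, odd7_b, M1, M3, M5, M7, e3, e57, Matrix.of_apply, Matrix.cons_val,
      polyVal_expand x]
    ring1

/-- `D₂` and `D₄` are not brackets of earlier fields, so their pushforwards are computed on all
eight `λ_s`. The later fields inherit theirs. -/
theorem field2_projects : Projects field2 (base 1) := by
  refine projects_of_lam ⟨?_, ?_, ?_, ?_, ?_, ?_, ?_, ?_⟩ <;>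
  · refine poly_ext fun x => ?_
    simp only [base_lamVar, v_upper, v_lower, Nat.reduceAdd, rhoPullback_expand,
      rhoPullback_lamVar, lam, vf_expand, field2_b_one, field2_b_two, field2_b_three,
      polyVal_expand x]
    ring1

theorem field2_odd : OddRelations field2 0 := by
  refine .of_projects field2_projects lie_odd1_field2 ?_ ?_ ?_ <;>
  · refine poly_ext fun x => ?_
    simp only [oddSum, vf_expand, field2_b_one, field2_b_two, odd1_b, odd3_b, odd5_b, odd7_b, M1,
      M3, M5, M7, e3, e57, Matrix.of_apply, Matrix.cons_val, p, p33, p35, p37, p55, p57, p77, lam,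
      polyVal_expand x]
    ring1

/-- The values of `field2` on `b_{1,j}` in terms of the polynomials `p_{k,l}`. -/
theorem field2_b_one_p :
    field2 (b 1 1) =
      κ (1 / 2) * b 3 1 - b 1 1 * b 1 1 + 2 * b 1 3 + κ (7 / 9) * lam 4 ∧
    field2 (b 1 3) =
      κ (1 / 2) * b 3 3 - b 1 1 * b 1 3 - κ (4 / 3) * lam 4 * b 1 1 + κ (1 / 2) * p 3 3
      + 3 * b 1 5 ∧
    field2 (b 1 5) =
      κ (1 / 2) * b 3 5 - b 1 1 * b 1 5 + κ (1 / 2) * p 3 5 - κ (8 / 9) * lam 4 * b 1 3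
      + 5 * b 1 7 ∧
    field2 (b 1 7) =
      κ (1 / 2) * b 3 7 - b 1 1 * b 1 7 + κ (1 / 2) * p 3 7 - κ (4 / 9) * lam 4 * b 1 5 := by
  refine ⟨?_, ?_, ?_, ?_⟩ <;>
  · refine poly_ext fun x => ?_
    simp only [vf_expand, field2_b_one, odd1_b, odd3_b, odd5_b, odd7_b, p, p33, p35, p37, p55,
      p57, p77, lam, polyVal_expand x]
    ring1

theorem field4_b_one :
    field4 (b 1 1) =
      κ (4 / 3) * b 1 1 ^ 3 - κ (10 / 3) * b 1 1 * b 1 3 - κ (1 / 3) * b 1 1 * b 3 1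
      + κ (2 / 3) * b 1 5 + κ (1 / 6) * b 2 1 ^ 2 + κ (4 / 3) * b 3 3 ∧
    field4 (b 1 3) =
      -(4 * b 1 1 ^ 4) - 6 * b 1 1 ^ 2 * b 1 3 + b 1 1 ^ 2 * b 3 1 + 6 * b 1 1 * b 1 5
      - κ (1 / 2) * b 1 1 * b 2 1 ^ 2 - b 1 1 * b 3 3 - 4 * b 1 3 ^ 2 + 2 * b 1 3 * b 3 1
      + 8 * b 1 7 - κ (1 / 2) * b 2 1 * b 2 3 ∧
    field4 (b 1 5) =
      -(κ (8 / 3) * b 1 1 ^ 3 * b 1 3) - κ 16 * b 1 1 ^ 2 * b 1 5 + κ (8 / 3) * b 1 1 * b 1 3 ^ 2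
      + κ (2 / 3) * b 1 1 * b 1 3 * b 3 1 + 2 * b 1 1 * b 1 7 - κ (16 / 3) * b 1 3 * b 1 5
      - κ (1 / 3) * b 1 3 * b 2 1 ^ 2 - κ (2 / 3) * b 1 3 * b 3 3 + 3 * b 1 5 * b 3 1
      - κ (1 / 2) * b 2 1 * b 2 5 ∧
    field4 (b 1 7) =
      -(κ (4 / 3) * b 1 1 ^ 3 * b 1 5) - κ 22 * b 1 1 ^ 2 * b 1 7
      + κ (4 / 3) * b 1 1 * b 1 3 * b 1 5 + κ (1 / 3) * b 1 1 * b 1 5 * b 3 1 - 12 * b 1 3 * b 1 7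
      + κ (4 / 3) * b 1 5 ^ 2 - κ (1 / 6) * b 1 5 * b 2 1 ^ 2 - κ (1 / 3) * b 1 5 * b 3 3
      + 4 * b 1 7 * b 3 1 - κ (1 / 2) * b 2 1 * b 2 7 := by
  have h := liftField_b_one values4
  refine ⟨?_, ?_, ?_, ?_⟩ <;>
  · refine poly_ext fun x => ?_
    simp only [field4, h]
    simp only [values4, p''_eq, Matrix.cons_val, vf_expand, odd1_b, p, p33, p35, p37, p55, p57,
      p77, lam, polyVal_expand x]
    ring1

theorem field4_b_two :
    field4 (b 2 1) =
      5 * b 1 1 * b 2 3 + b 1 3 * b 2 1 + 7 * b 2 5 ∧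
    field4 (b 2 3) =
      -(4 * b 1 1 ^ 3 * b 2 1) - 9 * b 1 1 ^ 2 * b 2 3 + 7 * b 1 1 * b 1 3 * b 2 1
      + b 1 1 * b 2 1 * b 3 1 - b 1 3 * b 2 3 + 7 * b 1 5 * b 2 1 - κ (1 / 2) * b 2 1 ^ 3
      - κ (3 / 2) * b 2 1 * b 3 3 + κ (3 / 2) * b 2 3 * b 3 1 + 9 * b 2 7 ∧
    field4 (b 2 5) =
      -(κ (8 / 3) * b 1 1 ^ 3 * b 2 3) - κ 15 * b 1 1 ^ 2 * b 2 5
      + κ (8 / 3) * b 1 1 * b 1 3 * b 2 3 + 3 * b 1 1 * b 1 5 * b 2 1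
      + κ (2 / 3) * b 1 1 * b 2 3 * b 3 1 - 10 * b 1 3 * b 2 5 + κ (23 / 3) * b 1 5 * b 2 3
      + 3 * b 1 7 * b 2 1 - κ (1 / 3) * b 2 1 ^ 2 * b 2 3 - κ (1 / 2) * b 2 1 * b 3 5
      - κ (2 / 3) * b 2 3 * b 3 3 + κ (5 / 2) * b 2 5 * b 3 1 ∧
    field4 (b 2 7) =
      -(κ (4 / 3) * b 1 1 ^ 3 * b 2 5) - κ 21 * b 1 1 ^ 2 * b 2 7
      + κ (4 / 3) * b 1 1 * b 1 3 * b 2 5 + 3 * b 1 1 * b 1 7 * b 2 1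
      + κ (1 / 3) * b 1 1 * b 2 5 * b 3 1 - κ 14 * b 1 3 * b 2 7 + κ (4 / 3) * b 1 5 * b 2 5
      + 5 * b 1 7 * b 2 3 - κ (1 / 6) * b 2 1 ^ 2 * b 2 5 - κ (1 / 2) * b 2 1 * b 3 7
      - κ (1 / 3) * b 2 5 * b 3 3 + κ (7 / 2) * b 2 7 * b 3 1 := by
  have h := liftField_b_two values4
  have h' := liftField_b_one values4
  have hv := field4_b_one
  simp only [field4, h'] at hv
  refine ⟨?_, ?_, ?_, ?_⟩ <;>
  · refine poly_ext fun x => ?_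
    simp only [field4, h]
    simp only [hv]
    simp only [oddSum, vf_expand, odd1_b, odd3_b, odd5_b, odd7_b, M1, M3, M5, M7, e3, e57,
      Matrix.of_apply, Matrix.cons_val, polyVal_expand x]
    ring1

theorem field4_b_three :
    field4 (b 3 1) =
      4 * b 1 1 * b 3 3 + 6 * b 2 1 * b 2 3 + 8 * b 3 5 ∧
    field4 (b 3 3) =
      -(4 * b 1 1 ^ 3 * b 3 1) - 8 * b 1 1 ^ 2 * b 3 3 + 6 * b 1 1 * b 1 3 * b 3 1
      - b 1 1 * b 2 1 * b 2 3 + b 1 1 * b 3 1 ^ 2 - 2 * b 1 1 * b 3 5 + b 1 3 * b 2 1 ^ 2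
      - 2 * b 1 3 * b 3 3 + 8 * b 1 5 * b 3 1 - κ (1 / 2) * b 2 1 ^ 2 * b 3 1 + b 2 1 * b 2 5
      + 5 * b 2 3 ^ 2 + 10 * b 3 7 ∧
    field4 (b 3 5) =
      -(κ (8 / 3) * b 1 1 ^ 3 * b 3 3) - κ 14 * b 1 1 ^ 2 * b 3 5
      + κ (8 / 3) * b 1 1 * b 1 3 * b 3 3 + 2 * b 1 1 * b 1 5 * b 3 1 - b 1 1 * b 2 1 * b 2 5
      + κ (2 / 3) * b 1 1 * b 3 1 * b 3 3 - 2 * b 1 1 * b 3 7 - 12 * b 1 3 * b 3 5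
      + b 1 5 * b 2 1 ^ 2 + κ (26 / 3) * b 1 5 * b 3 3 + 4 * b 1 7 * b 3 1
      - κ (1 / 3) * b 2 1 ^ 2 * b 3 3 + b 2 1 * b 2 7 + 5 * b 2 3 * b 2 5 + 2 * b 3 1 * b 3 5
      - κ (2 / 3) * b 3 3 ^ 2 ∧
    field4 (b 3 7) =
      -(κ (4 / 3) * b 1 1 ^ 3 * b 3 5) - κ 20 * b 1 1 ^ 2 * b 3 7
      + κ (4 / 3) * b 1 1 * b 1 3 * b 3 5 + 2 * b 1 1 * b 1 7 * b 3 1 - b 1 1 * b 2 1 * b 2 7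
      + κ (1 / 3) * b 1 1 * b 3 1 * b 3 5 - κ 16 * b 1 3 * b 3 7 + κ (4 / 3) * b 1 5 * b 3 5
      + b 1 7 * b 2 1 ^ 2 + 6 * b 1 7 * b 3 3 - κ (1 / 6) * b 2 1 ^ 2 * b 3 5 + 5 * b 2 3 * b 2 7
      + 3 * b 3 1 * b 3 7 - κ (1 / 3) * b 3 3 * b 3 5 := by
  have h := liftField_b_three values4
  have h' := liftField_b_two values4
  have hv := field4_b_two
  simp only [field4, h'] at hv
  refine ⟨?_, ?_, ?_, ?_⟩ <;>
  · refine poly_ext fun x => ?_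
    simp only [field4, h]
    simp only [hv]
    simp only [oddSum, vf_expand, odd1_b, odd3_b, odd5_b, odd7_b, M1, M3, M5, M7, e3, e57,
      Matrix.of_apply, Matrix.cons_val, polyVal_expand x]
    ring1

/-- As for `D₂`, the content lies in the four coordinates `b_{3,j}`; elsewhere `liftField` was
designed to make the relation hold. -/
theorem lie_odd1_field4 : ⁅odd1, field4⁆ = oddSum (M1 1) := by
  have h : field4 = liftField values4 _ := rfl
  apply lie_odd1_liftField <;>
  · refine poly_ext fun x => ?_
    rw [← h]
    simp only [vf_lie_apply, oddSum, vf_expand, field4_b_one, field4_b_two, field4_b_three,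
      odd1_b, odd3_b, odd5_b, odd7_b, M1, M3, M5, M7, e3, e57, Matrix.of_apply, Matrix.cons_val,
      polyVal_expand x]
    ring1

theorem field4_projects : Projects field4 (base 2) := by
  refine projects_of_lam ⟨?_, ?_, ?_, ?_, ?_, ?_, ?_, ?_⟩ <;>
  · refine poly_ext fun x => ?_
    simp only [base_lamVar, v_upper, v_lower, Nat.reduceAdd, rhoPullback_expand,
      rhoPullback_lamVar, lam, vf_expand, field4_b_one, field4_b_two, field4_b_three,
      polyVal_expand x]
    ring1

theorem field4_odd : OddRelations field4 1 := by
  refine .of_projects field4_projects lie_odd1_field4 ?_ ?_ ?_ <;>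
  · refine poly_ext fun x => ?_
    simp only [oddSum, vf_expand, field4_b_one, field4_b_two, odd1_b, odd3_b, odd5_b, odd7_b, M1,
      M3, M5, M7, e3, e57, Matrix.of_apply, Matrix.cons_val, p, p33, p35, p37, p55, p57, p77, lam,
      polyVal_expand x]
    ring1

/-- The values of `field4` on `b_{1,j}` in terms of the polynomials `p_{k,l}`. -/
theorem field4_b_one_p :
    field4 (b 1 1) =
      b 3 3 - b 1 1 * b 1 3 - b 1 3 * b 1 1 + 2 * b 1 5 + κ (2 / 3) * lam 6 ∧
    field4 (b 1 3) =
      κ (1 / 2) * odd1 (odd1 (p 3 3)) - κ (1 / 2) * b 1 1 * p 3 3 - b 1 3 * b 1 3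
      - 2 * lam 6 * b 1 1 + lam 4 * b 1 3 + κ (1 / 2) * p 3 5 + 3 * b 1 7 - lam 8 ∧
    field4 (b 1 5) =
      κ (1 / 2) * odd1 (odd1 (p 3 5)) - κ (1 / 2) * b 1 1 * p 3 5 - b 1 3 * b 1 5
      - κ (4 / 3) * lam 6 * b 1 3 + κ (1 / 2) * p 5 5 + 3 * lam 4 * b 1 5 ∧
    field4 (b 1 7) =
      κ (1 / 2) * odd1 (odd1 (p 3 7)) - κ (1 / 2) * b 1 1 * p 3 7 - b 1 3 * b 1 7
      + κ (1 / 2) * p 5 7 - κ (2 / 3) * lam 6 * b 1 5 + 5 * lam 4 * b 1 7 := by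
  refine ⟨?_, ?_, ?_, ?_⟩ <;>
  · refine poly_ext fun x => ?_
    simp only [vf_expand, field4_b_one, odd1_b, odd3_b, odd5_b, odd7_b, p, p33, p35, p37, p55,
      p57, p77, lam, polyVal_expand x]
    ring1

/-! ### The first step of the recursion: `D₆` -/

/-- The field `D_{6}`. -/
noncomputable def field6 : BField :=
    (1 / 4 : ℂ) • ((2 : ℂ) • ⁅field2, field4⁆ + b 2 3 • odd1 - b 2 1 • odd3) - (4 / 3 : ℂ)
    • (lam 6 • euler - lam 4 • field2)

/-- The odd summands are vertical, so the pushforward is the same recursion on the base, with `[L₂,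
L₄]` supplied by `lie_base`. In general `[L₂, L_{2j}]` contains `2(j - 1) L_{2j+2}`; dividing `4(8 -
j)/9` by `2(j - 1)` yields the constants `4/3`, `5/9`, `8/27`, `1/6`, `4/45` of the recursion. -/
theorem field6_projects : Projects field6 (base 3) := by
  have hl : lam 6 = rhoPullback (lamVar 6) := rhoPullback_lamVar.2.1.symm
  have h4 : lam 4 = rhoPullback (lamVar 4) := rhoPullback_lamVar.1.symm
  rw [field6, hl, h4]
  refine (((((((field2_projects.lie field4_projects).scalar_smul _).add (odd1_projects.smul_zero
    _)).sub (odd3_projects.smul_zero _))).scalar_smul _).sub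
    (((euler_projects.smul _).sub (field2_projects.smul _)).scalar_smul _)).congr ?_
  rw [lie_base (by norm_num) (by norm_num), baseSum]
  refine base_ext ⟨?_, ?_, ?_, ?_, ?_, ?_, ?_, ?_⟩ <;>
  · refine poly_ext fun x => ?_
    simp only [structUpper, structCoef, Nat.reduceAdd, Nat.reduceLeDiff, Nat.reduceEqDiff,
      Nat.reduceSub, Nat.reduceMul, if_true, if_false, lamVar_const, vf_expand, Nat.cast_ofNat,
      Nat.cast_one, Nat.cast_zero, polyVal_expand x]
    ring1

/-- Jacobi on an arbitrary `f`: `odd1` is moved past `field2` and `field4` by their `OddRelations`,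
which produces the values of these fields on entries of `M1`. The odd summands of the recursion
cancel second derivatives: `b₃₃` in front of `D₁` and `b₃₁` in front of `D₃`. -/
theorem lie_odd1_field6 : ⁅odd1, field6⁆ = oddSum (M1 2) := by
  refine field_ext fun f => poly_ext fun x => ?_
  simp only [field6, p'_eq, vf_lie_apply, oddSum, vf_expand, field2_odd.apply, field4_odd.apply,
    odd_euler, odd_comm, odd1_lam, field2_b_one_p, field4_b_one_p, odd1_b, fieldOdd_b_one_p, M1, M3,
    M5, M7, e3, e57, Matrix.of_apply, Matrix.cons_val, polyVal_expand x]
  ring1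

theorem field6_b_one :
    field6 (b 1 1) =
      κ (20 / 9) * b 1 1 ^ 2 * b 1 3 - κ (28 / 9) * b 1 1 * b 1 5 - κ (7 / 9) * b 1 1 * b 3 3
      - κ (4 / 9) * b 1 3 ^ 2 + κ (2 / 9) * b 1 3 * b 3 1 + κ (8 / 9) * b 1 7
      + κ (5 / 18) * b 2 1 * b 2 3 + κ (16 / 9) * b 3 5 ∧
    field6 (b 1 3) =
      -(κ (20 / 3) * b 1 1 ^ 3 * b 1 3) - κ (32 / 3) * b 1 1 ^ 2 * b 1 5
      + κ (4 / 3) * b 1 1 ^ 2 * b 3 3 - κ (26 / 3) * b 1 1 * b 1 3 ^ 2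
      + κ (1 / 3) * b 1 1 * b 1 3 * b 3 1 + κ (22 / 3) * b 1 1 * b 1 7
      - κ (4 / 3) * b 1 1 * b 2 1 * b 2 3 - κ (4 / 3) * b 1 1 * b 3 5 - 10 * b 1 3 * b 1 5
      + κ (1 / 2) * b 1 3 * b 2 1 ^ 2 + 2 * b 1 3 * b 3 3 + 3 * b 1 5 * b 3 1
      - κ (1 / 2) * b 2 1 * b 2 5 - b 2 3 ^ 2 ∧
    field6 (b 1 5) =
      8 * b 1 1 ^ 3 * b 1 5 - κ (64 / 9) * b 1 1 ^ 2 * b 1 3 ^ 2 - κ 22 * b 1 1 ^ 2 * b 1 7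
      - κ (58 / 9) * b 1 1 * b 1 3 * b 1 5 + κ (8 / 9) * b 1 1 * b 1 3 * b 3 3
      - 2 * b 1 1 * b 1 5 * b 3 1 - κ (16 / 9) * b 1 3 ^ 3 + κ (8 / 9) * b 1 3 ^ 2 * b 3 1
      - κ (76 / 9) * b 1 3 * b 1 7 - κ (8 / 9) * b 1 3 * b 2 1 * b 2 3 - κ (8 / 9) * b 1 3 * b 3 5
      - 6 * b 1 5 ^ 2 + b 1 5 * b 2 1 ^ 2 + 3 * b 1 5 * b 3 3 + 4 * b 1 7 * b 3 1
      - κ (1 / 2) * b 2 1 * b 2 7 - b 2 3 * b 2 5 ∧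
    field6 (b 1 7) =
      12 * b 1 1 ^ 3 * b 1 7 - κ (32 / 9) * b 1 1 ^ 2 * b 1 3 * b 1 5
      - κ 14 * b 1 1 * b 1 3 * b 1 7 + κ (16 / 9) * b 1 1 * b 1 5 ^ 2
      + κ (4 / 9) * b 1 1 * b 1 5 * b 3 3 - 3 * b 1 1 * b 1 7 * b 3 1
      - κ (8 / 9) * b 1 3 ^ 2 * b 1 5 + κ (4 / 9) * b 1 3 * b 1 5 * b 3 1
      - κ (74 / 9) * b 1 5 * b 1 7 - κ (4 / 9) * b 1 5 * b 2 1 * b 2 3 - κ (4 / 9) * b 1 5 * b 3 5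
      + κ (3 / 2) * b 1 7 * b 2 1 ^ 2 + 4 * b 1 7 * b 3 3 - b 2 3 * b 2 7 := by
  refine ⟨?_, ?_, ?_, ?_⟩ <;>
  · refine poly_ext fun x => ?_
    simp only [field6, p'_eq, vf_lie_apply, vf_expand, field2_b_one, field2_b_two, field2_b_three,
      field4_b_one, field4_b_two, field4_b_three, euler_b, odd1_b, odd3_b, odd5_b, odd7_b, p, p33,
      p35, p37, p55, p57, p77, lam, polyVal_expand x]
    ring1

/-- With `[D₁, D₆]` known, the values on `b_{2,j}` follow from those on `b_{1,j}` by one application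
of `odd1`; the commutator defining the field need not be expanded again. -/
theorem field6_b_two :
    field6 (b 2 1) =
      -(4 * b 1 1 ^ 2 * b 2 3) + 4 * b 1 1 * b 1 3 * b 2 1 + 7 * b 1 1 * b 2 5 - b 1 3 * b 2 3
      + 3 * b 1 5 * b 2 1 - κ (1 / 2) * b 2 1 * b 3 3 + κ (1 / 2) * b 2 3 * b 3 1 + 9 * b 2 7 ∧
    field6 (b 2 3) =
      4 * b 1 1 ^ 3 * b 2 3 - κ (32 / 3) * b 1 1 ^ 2 * b 1 3 * b 2 1 - κ 15 * b 1 1 ^ 2 * b 2 5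
      + b 1 1 * b 1 3 * b 2 3 + κ (25 / 3) * b 1 1 * b 1 5 * b 2 1
      + κ (4 / 3) * b 1 1 * b 2 1 * b 3 3 - b 1 1 * b 2 3 * b 3 1 - κ (5 / 3) * b 1 3 ^ 2 * b 2 1
      + κ (4 / 3) * b 1 3 * b 2 1 * b 3 1 - 3 * b 1 3 * b 2 5 + b 1 5 * b 2 3
      + κ (25 / 3) * b 1 7 * b 2 1 - κ (5 / 6) * b 2 1 ^ 2 * b 2 3 - κ (11 / 6) * b 2 1 * b 3 5
      + κ (5 / 2) * b 2 5 * b 3 1 ∧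
    field6 (b 2 5) =
      8 * b 1 1 ^ 3 * b 2 5 - κ (64 / 9) * b 1 1 ^ 2 * b 1 3 * b 2 3 - κ 21 * b 1 1 ^ 2 * b 2 7
      - 8 * b 1 1 * b 1 3 * b 2 5 + κ (77 / 9) * b 1 1 * b 1 5 * b 2 3 + 3 * b 1 1 * b 1 7 * b 2 1
      + κ (8 / 9) * b 1 1 * b 2 3 * b 3 3 - 2 * b 1 1 * b 2 5 * b 3 1
      - κ (16 / 9) * b 1 3 ^ 2 * b 2 3 + b 1 3 * b 1 5 * b 2 1 + κ (8 / 9) * b 1 3 * b 2 3 * b 3 1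
      - κ 14 * b 1 3 * b 2 7 - b 1 5 * b 2 5 + κ (77 / 9) * b 1 7 * b 2 3 + b 2 1 ^ 2 * b 2 5
      - κ (8 / 9) * b 2 1 * b 2 3 ^ 2 - κ (1 / 2) * b 2 1 * b 3 7 - κ (17 / 9) * b 2 3 * b 3 5
      + 2 * b 2 5 * b 3 3 + κ (7 / 2) * b 2 7 * b 3 1 ∧
    field6 (b 2 7) =
      12 * b 1 1 ^ 3 * b 2 7 - κ (32 / 9) * b 1 1 ^ 2 * b 1 3 * b 2 5 - 12 * b 1 1 * b 1 3 * b 2 7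
      + κ (16 / 9) * b 1 1 * b 1 5 * b 2 5 + 5 * b 1 1 * b 1 7 * b 2 3
      + κ (4 / 9) * b 1 1 * b 2 5 * b 3 3 - 3 * b 1 1 * b 2 7 * b 3 1
      - κ (8 / 9) * b 1 3 ^ 2 * b 2 5 + b 1 3 * b 1 7 * b 2 1 + κ (4 / 9) * b 1 3 * b 2 5 * b 3 1
      - 12 * b 1 5 * b 2 7 + κ (79 / 9) * b 1 7 * b 2 5 + κ (3 / 2) * b 2 1 ^ 2 * b 2 7
      - κ (4 / 9) * b 2 1 * b 2 3 * b 2 5 - b 2 3 * b 3 7 - κ (4 / 9) * b 2 5 * b 3 5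
      + 3 * b 2 7 * b 3 3 := by
  simp only [apply_b_two lie_odd1_field6, field6_b_one]
  refine ⟨?_, ?_, ?_, ?_⟩ <;>
  · refine poly_ext fun x => ?_
    simp only [oddSum, vf_expand, odd1_b, odd3_b, odd5_b, odd7_b, M1, M3, M5, M7, e3, e57,
      Matrix.of_apply, Matrix.cons_val, polyVal_expand x]
    ring1

theorem field6_b_three :
    field6 (b 3 1) =
      -(4 * b 1 1 ^ 2 * b 3 3) + 4 * b 1 1 * b 1 3 * b 3 1 - 2 * b 1 1 * b 2 1 * b 2 3
      + 6 * b 1 1 * b 3 5 + 2 * b 1 3 * b 2 1 ^ 2 - 2 * b 1 3 * b 3 3 + 2 * b 1 5 * b 3 1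
      + 8 * b 2 1 * b 2 5 + b 2 3 ^ 2 + 10 * b 3 7 ∧
    field6 (b 3 3) =
      4 * b 1 1 ^ 3 * b 3 3 - κ (32 / 3) * b 1 1 ^ 2 * b 1 3 * b 3 1 - κ 14 * b 1 1 ^ 2 * b 3 5
      + 2 * b 1 1 * b 1 3 * b 3 3 + κ (22 / 3) * b 1 1 * b 1 5 * b 3 1 - b 1 1 * b 2 1 * b 2 5
      - 3 * b 1 1 * b 2 3 ^ 2 + κ (1 / 3) * b 1 1 * b 3 1 * b 3 3 - 2 * b 1 1 * b 3 7
      - κ (8 / 3) * b 1 3 ^ 2 * b 3 1 + 3 * b 1 3 * b 2 1 * b 2 3 + κ (4 / 3) * b 1 3 * b 3 1 ^ 2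
      - 4 * b 1 3 * b 3 5 + b 1 5 * b 2 1 ^ 2 + κ (28 / 3) * b 1 7 * b 3 1
      + κ (1 / 2) * b 2 1 ^ 2 * b 3 3 - κ (4 / 3) * b 2 1 * b 2 3 * b 3 1 + b 2 1 * b 2 7
      + 8 * b 2 3 * b 2 5 + κ (2 / 3) * b 3 1 * b 3 5 ∧
    field6 (b 3 5) =
      8 * b 1 1 ^ 3 * b 3 5 - κ (64 / 9) * b 1 1 ^ 2 * b 1 3 * b 3 3 - κ 20 * b 1 1 ^ 2 * b 3 7
      - 6 * b 1 1 * b 1 3 * b 3 5 + κ (68 / 9) * b 1 1 * b 1 5 * b 3 3 + 2 * b 1 1 * b 1 7 * b 3 1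
      - b 1 1 * b 2 1 * b 2 7 - 3 * b 1 1 * b 2 3 * b 2 5 - 2 * b 1 1 * b 3 1 * b 3 5
      + κ (8 / 9) * b 1 1 * b 3 3 ^ 2 - κ (16 / 9) * b 1 3 ^ 2 * b 3 3 + b 1 3 * b 2 1 * b 2 5
      + κ (8 / 9) * b 1 3 * b 3 1 * b 3 3 - κ 16 * b 1 3 * b 3 7 + 2 * b 1 5 * b 2 1 * b 2 3
      - 2 * b 1 5 * b 3 5 + b 1 7 * b 2 1 ^ 2 + κ (86 / 9) * b 1 7 * b 3 3 + b 2 1 ^ 2 * b 3 5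
      - κ (8 / 9) * b 2 1 * b 2 3 * b 3 3 + b 2 3 * b 2 7 + 7 * b 2 5 ^ 2 + 3 * b 3 1 * b 3 7
      + κ (1 / 9) * b 3 3 * b 3 5 ∧
    field6 (b 3 7) =
      12 * b 1 1 ^ 3 * b 3 7 - κ (32 / 9) * b 1 1 ^ 2 * b 1 3 * b 3 5 - 10 * b 1 1 * b 1 3 * b 3 7
      + κ (16 / 9) * b 1 1 * b 1 5 * b 3 5 + 4 * b 1 1 * b 1 7 * b 3 3 - 3 * b 1 1 * b 2 3 * b 2 7
      - 3 * b 1 1 * b 3 1 * b 3 7 + κ (4 / 9) * b 1 1 * b 3 3 * b 3 5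
      - κ (8 / 9) * b 1 3 ^ 2 * b 3 5 + b 1 3 * b 2 1 * b 2 7 + κ (4 / 9) * b 1 3 * b 3 1 * b 3 5
      - κ 14 * b 1 5 * b 3 7 + 2 * b 1 7 * b 2 1 * b 2 3 + κ (88 / 9) * b 1 7 * b 3 5
      + κ (3 / 2) * b 2 1 ^ 2 * b 3 7 - κ (4 / 9) * b 2 1 * b 2 3 * b 3 5 + 7 * b 2 5 * b 2 7
      + 2 * b 3 3 * b 3 7 - κ (4 / 9) * b 3 5 ^ 2 := by
  simp only [apply_b_three lie_odd1_field6, field6_b_two]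
  refine ⟨?_, ?_, ?_, ?_⟩ <;>
  · refine poly_ext fun x => ?_
    simp only [oddSum, vf_expand, odd1_b, odd3_b, odd5_b, odd7_b, M1, M3, M5, M7, e3, e57,
      Matrix.of_apply, Matrix.cons_val, polyVal_expand x]
    ring1

/-- After the pushforward and the bracket with `odd1`, three identities on `b₁₁` suffice. This
closes the loop for `D₆` and makes its relations available for `D₈`. -/
theorem field6_odd : OddRelations field6 2 := by
  refine .of_projects field6_projects lie_odd1_field6 ?_ ?_ ?_ <;>
  · refine poly_ext fun x => ?_
    simp only [oddSum, vf_expand, field6_b_one, field6_b_two, odd1_b, odd3_b, odd5_b, odd7_b, M1,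
      M3, M5, M7, e3, e57, Matrix.of_apply, Matrix.cons_val, p, p33, p35, p37, p55, p57, p77, lam,
      polyVal_expand x]
    ring1

/-- The values of `field6` on `b_{1,j}` in terms of the polynomials `p_{k,l}`. -/
theorem field6_b_one_p :
    field6 (b 1 1) =
      b 3 5 - b 1 1 * b 1 5 + κ (1 / 4) * odd1 (odd1 (p 3 3)) - b 1 3 * b 1 3 - b 1 5 * b 1 1
      + 2 * b 1 7 + κ (5 / 9) * lam 8 ∧
    field6 (b 1 3) =
      κ (1 / 2) * odd1 (odd1 (p 3 5)) - κ (1 / 2) * b 1 1 * p 3 5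
      + κ (1 / 4) * odd1 (odd3 (p 3 3)) - κ (1 / 2) * b 1 3 * p 3 3 - b 1 5 * b 1 3
      - κ (5 / 3) * lam 8 * b 1 1 + lam 4 * b 1 5 + κ (1 / 2) * p 3 7 - 2 * lam 10 ∧
    field6 (b 1 5) =
      κ (1 / 2) * odd1 (odd1 (p 5 5)) - κ (1 / 2) * b 1 1 * p 5 5
      + κ (1 / 4) * odd1 (odd3 (p 3 5)) - κ (1 / 2) * b 1 3 * p 3 5 - b 1 5 * b 1 5
      - κ (16 / 9) * lam 8 * b 1 3 + 2 * lam 6 * b 1 5 + κ (1 / 2) * p 5 7 + 3 * lam 4 * b 1 7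
      - lam 12 ∧
    field6 (b 1 7) =
      κ (1 / 2) * odd1 (odd1 (p 5 7)) - κ (1 / 2) * b 1 1 * p 5 7
      + κ (1 / 4) * odd1 (odd3 (p 3 7)) - κ (1 / 2) * b 1 3 * p 3 7 - b 1 5 * b 1 7
      - κ (8 / 9) * lam 8 * b 1 5 + κ (1 / 2) * p 7 7 + 4 * lam 6 * b 1 7 := by
  refine ⟨?_, ?_, ?_, ?_⟩ <;>
  · refine poly_ext fun x => ?_
    simp only [vf_expand, field6_b_one, odd1_b, odd3_b, odd5_b, odd7_b, p, p33, p35, p37, p55,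
      p57, p77, lam, polyVal_expand x]
    ring1

/-! ### The recursion for `D₈` -/

/-- The field `D_{8}`. -/
noncomputable def field8 : BField :=
    (1 / 8 : ℂ) • ((2 : ℂ) • ⁅field2, field6⁆ + (κ (1 / 2) * p' 3 3 + b 2 5) • odd1 - b 2 3 • odd3
    - b 2 1 • odd5) - (5 / 9 : ℂ) • (lam 8 • euler - lam 4 • field4)

theorem field8_projects : Projects field8 (base 4) := by
  have hl : lam 8 = rhoPullback (lamVar 8) := rhoPullback_lamVar.2.2.1.symm
  have h4 : lam 4 = rhoPullback (lamVar 4) := rhoPullback_lamVar.1.symm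
  rw [field8, hl, h4]
  refine ((((((((field2_projects.lie field6_projects).scalar_smul _).add (odd1_projects.smul_zero
    _)).sub (odd3_projects.smul_zero _)).sub (odd5_projects.smul_zero _))).scalar_smul _).sub
    (((euler_projects.smul _).sub (field4_projects.smul _)).scalar_smul _)).congr ?_
  rw [lie_base (by norm_num) (by norm_num), baseSum]
  refine base_ext ⟨?_, ?_, ?_, ?_, ?_, ?_, ?_, ?_⟩ <;>
  · refine poly_ext fun x => ?_
    simp only [structUpper, structCoef, Nat.reduceAdd, Nat.reduceLeDiff, Nat.reduceEqDiff,
      Nat.reduceSub, Nat.reduceMul, if_true, if_false, lamVar_const, vf_expand, Nat.cast_ofNat,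
      Nat.cast_one, Nat.cast_zero, polyVal_expand x]
    ring1

/-- The recursion involves `D₂`, `D₆` and, through the `λ₄` term, `D₄`; accordingly the relations of
all three are used. Values on the entries of `M1` are needed only for `D₂` and `D₆`, whose bracket
is taken; the coefficients `λ₄` and `λ₈` are constants for `odd1`. -/
theorem lie_odd1_field8 : ⁅odd1, field8⁆ = oddSum (M1 3) := by
  refine field_ext fun f => poly_ext fun x => ?_
  simp only [field8, p'_eq, vf_lie_apply, oddSum, vf_expand, field2_odd.apply, field4_odd.apply,
    field6_odd.apply, odd_euler, odd_comm, odd1_lam, field2_b_one_p, field6_b_one_p, odd1_b,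
    fieldOdd_b_one_p, M1, M3, M5, M7, e3, e57, Matrix.of_apply, Matrix.cons_val, polyVal_expand x]
  ring1

theorem field8_b_one :
    field8 (b 1 1) =
      κ (16 / 9) * b 1 1 ^ 2 * b 1 5 + κ (8 / 9) * b 1 1 * b 1 3 ^ 2 - κ (26 / 9) * b 1 1 * b 1 7
      - κ (11 / 9) * b 1 1 * b 3 5 - κ (10 / 9) * b 1 3 * b 1 5 - κ (2 / 9) * b 1 3 * b 3 3
      + κ (7 / 9) * b 1 5 * b 3 1 + κ (2 / 9) * b 2 1 * b 2 5 + κ (1 / 9) * b 2 3 ^ 2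
      + κ (20 / 9) * b 3 7 ∧
    field8 (b 1 3) =
      -(κ (16 / 3) * b 1 1 ^ 3 * b 1 5) - κ (8 / 3) * b 1 1 ^ 2 * b 1 3 ^ 2
      - κ (46 / 3) * b 1 1 ^ 2 * b 1 7 + κ (5 / 3) * b 1 1 ^ 2 * b 3 5
      - κ (62 / 3) * b 1 1 * b 1 3 * b 1 5 + κ (2 / 3) * b 1 1 * b 1 3 * b 3 3
      - κ (1 / 3) * b 1 1 * b 1 5 * b 3 1 - κ (5 / 3) * b 1 1 * b 2 1 * b 2 5
      - κ (1 / 3) * b 1 1 * b 2 3 ^ 2 - κ (5 / 3) * b 1 1 * b 3 7 - 12 * b 1 3 * b 1 7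
      + 2 * b 1 3 * b 3 5 - 6 * b 1 5 ^ 2 + b 1 5 * b 2 1 ^ 2 + 3 * b 1 5 * b 3 3
      + 4 * b 1 7 * b 3 1 - κ (1 / 2) * b 2 1 * b 2 7 - κ (5 / 2) * b 2 3 * b 2 5 ∧
    field8 (b 1 5) =
      12 * b 1 1 ^ 3 * b 1 7 + κ (28 / 9) * b 1 1 ^ 2 * b 1 3 * b 1 5
      - κ (40 / 9) * b 1 1 * b 1 3 ^ 3 - κ (86 / 9) * b 1 1 * b 1 3 * b 1 7
      + κ (10 / 9) * b 1 1 * b 1 3 * b 3 5 - 8 * b 1 1 * b 1 5 ^ 2 - 2 * b 1 1 * b 1 5 * b 3 3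
      - 3 * b 1 1 * b 1 7 * b 3 1 + κ (1 / 2) * b 1 1 * b 2 3 * b 2 5
      - κ (22 / 9) * b 1 3 ^ 2 * b 1 5 + κ (10 / 9) * b 1 3 ^ 2 * b 3 3
      + κ (1 / 9) * b 1 3 * b 1 5 * b 3 1 - κ (29 / 18) * b 1 3 * b 2 1 * b 2 5
      - κ (5 / 9) * b 1 3 * b 2 3 ^ 2 - κ (10 / 9) * b 1 3 * b 3 7 - κ 14 * b 1 5 * b 1 7
      + κ (3 / 2) * b 1 5 * b 2 1 * b 2 3 + 3 * b 1 5 * b 3 5 + κ (3 / 2) * b 1 7 * b 2 1 ^ 2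
      + 4 * b 1 7 * b 3 3 - b 2 3 * b 2 7 - κ (3 / 2) * b 2 5 ^ 2 ∧
    field8 (b 1 7) =
      κ 20 * b 1 1 ^ 2 * b 1 3 * b 1 7 - κ (40 / 9) * b 1 1 ^ 2 * b 1 5 ^ 2
      - κ (20 / 9) * b 1 1 * b 1 3 ^ 2 * b 1 5 - κ (88 / 9) * b 1 1 * b 1 5 * b 1 7
      + κ (5 / 9) * b 1 1 * b 1 5 * b 3 5 - 3 * b 1 1 * b 1 7 * b 3 3
      + κ (1 / 2) * b 1 1 * b 2 3 * b 2 7 + 4 * b 1 3 ^ 2 * b 1 7 - κ (20 / 9) * b 1 3 * b 1 5 ^ 2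
      + κ (5 / 9) * b 1 3 * b 1 5 * b 3 3 - 2 * b 1 3 * b 1 7 * b 3 1
      - κ (1 / 2) * b 1 3 * b 2 1 * b 2 7 + κ (5 / 9) * b 1 5 ^ 2 * b 3 1
      - κ (5 / 9) * b 1 5 * b 2 1 * b 2 5 - κ (5 / 18) * b 1 5 * b 2 3 ^ 2
      - κ (5 / 9) * b 1 5 * b 3 7 - 8 * b 1 7 ^ 2 + κ (5 / 2) * b 1 7 * b 2 1 * b 2 3
      + 4 * b 1 7 * b 3 5 - κ (3 / 2) * b 2 5 * b 2 7 := by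
  refine ⟨?_, ?_, ?_, ?_⟩ <;>
  · refine poly_ext fun x => ?_
    simp only [field8, p'_eq, vf_lie_apply, vf_expand, field2_b_one, field2_b_two, field2_b_three,
      field4_b_one, field4_b_two, field4_b_three, field6_b_one, field6_b_two, field6_b_three,
      euler_b, odd1_b, odd3_b, odd5_b, odd7_b, p, p33, p35, p37, p55, p57, p77, lam,
      polyVal_expand x]
    ring1

theorem field8_b_two :
    field8 (b 2 1) =
      -(8 * b 1 1 ^ 2 * b 2 5) + 8 * b 1 1 * b 1 5 * b 2 1 + 9 * b 1 1 * b 2 7 - 3 * b 1 3 * b 2 5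
      + b 1 5 * b 2 3 + 5 * b 1 7 * b 2 1 - b 2 1 * b 3 5 + b 2 5 * b 3 1 ∧
    field8 (b 2 3) =
      8 * b 1 1 ^ 3 * b 2 5 - κ (40 / 3) * b 1 1 ^ 2 * b 1 5 * b 2 1 - κ 21 * b 1 1 ^ 2 * b 2 7
      - κ (8 / 3) * b 1 1 * b 1 3 ^ 2 * b 2 1 - b 1 1 * b 1 3 * b 2 5 + 3 * b 1 1 * b 1 5 * b 2 3
      + κ (29 / 3) * b 1 1 * b 1 7 * b 2 1 + κ (5 / 3) * b 1 1 * b 2 1 * b 3 5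
      - 2 * b 1 1 * b 2 5 * b 3 1 - κ (8 / 3) * b 1 3 * b 1 5 * b 2 1
      + κ (2 / 3) * b 1 3 * b 2 1 * b 3 3 - 5 * b 1 3 * b 2 7 + κ (5 / 3) * b 1 5 * b 2 1 * b 3 1
      - b 1 5 * b 2 5 + 3 * b 1 7 * b 2 3 - κ (2 / 3) * b 2 1 ^ 2 * b 2 5
      - κ (1 / 3) * b 2 1 * b 2 3 ^ 2 - κ (13 / 6) * b 2 1 * b 3 7 - κ (1 / 2) * b 2 3 * b 3 5
      + κ (1 / 2) * b 2 5 * b 3 3 + κ (7 / 2) * b 2 7 * b 3 1 ∧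
    field8 (b 2 5) =
      12 * b 1 1 ^ 3 * b 2 7 + 12 * b 1 1 ^ 2 * b 1 3 * b 2 5
      - κ (116 / 9) * b 1 1 ^ 2 * b 1 5 * b 2 3 - κ (40 / 9) * b 1 1 * b 1 3 ^ 2 * b 2 3
      + 4 * b 1 1 * b 1 3 * b 1 5 * b 2 1 - 12 * b 1 1 * b 1 3 * b 2 7 + b 1 1 * b 1 5 * b 2 5
      + κ (85 / 9) * b 1 1 * b 1 7 * b 2 3 + κ (29 / 18) * b 1 1 * b 2 3 * b 3 5
      - κ (3 / 2) * b 1 1 * b 2 5 * b 3 3 - 3 * b 1 1 * b 2 7 * b 3 1 + 3 * b 1 3 ^ 2 * b 2 5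
      - κ (49 / 9) * b 1 3 * b 1 5 * b 2 3 + b 1 3 * b 1 7 * b 2 1
      - κ (1 / 2) * b 1 3 * b 2 1 * b 3 5 + κ (10 / 9) * b 1 3 * b 2 3 * b 3 3
      - κ (3 / 2) * b 1 3 * b 2 5 * b 3 1 + 3 * b 1 5 ^ 2 * b 2 1
      - κ (1 / 2) * b 1 5 * b 2 1 * b 3 3 + κ (29 / 18) * b 1 5 * b 2 3 * b 3 1
      - 3 * b 1 5 * b 2 7 + b 1 7 * b 2 5 + κ (3 / 2) * b 2 1 ^ 2 * b 2 7
      + κ (7 / 18) * b 2 1 * b 2 3 * b 2 5 - κ (5 / 9) * b 2 3 ^ 3 - κ (19 / 9) * b 2 3 * b 3 7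
      + 3 * b 2 7 * b 3 3 ∧
    field8 (b 2 7) =
      κ 20 * b 1 1 ^ 2 * b 1 3 * b 2 7 - κ (40 / 9) * b 1 1 ^ 2 * b 1 5 * b 2 5
      - 4 * b 1 1 ^ 2 * b 1 7 * b 2 3 - κ (20 / 9) * b 1 1 * b 1 3 ^ 2 * b 2 5
      + 4 * b 1 1 * b 1 3 * b 1 7 * b 2 1 - 10 * b 1 1 * b 1 5 * b 2 7
      + κ (83 / 9) * b 1 1 * b 1 7 * b 2 5 + κ (1 / 2) * b 1 1 * b 2 3 * b 3 7
      + κ (5 / 9) * b 1 1 * b 2 5 * b 3 5 - κ (5 / 2) * b 1 1 * b 2 7 * b 3 3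
      + 5 * b 1 3 ^ 2 * b 2 7 - κ (20 / 9) * b 1 3 * b 1 5 * b 2 5 - b 1 3 * b 1 7 * b 2 3
      - κ (1 / 2) * b 1 3 * b 2 1 * b 3 7 + κ (5 / 9) * b 1 3 * b 2 5 * b 3 3
      - κ (5 / 2) * b 1 3 * b 2 7 * b 3 1 + 3 * b 1 5 * b 1 7 * b 2 1
      + κ (5 / 9) * b 1 5 * b 2 5 * b 3 1 - κ (1 / 2) * b 1 7 * b 2 1 * b 3 3
      + κ (1 / 2) * b 1 7 * b 2 3 * b 3 1 - b 1 7 * b 2 7 + κ (5 / 2) * b 2 1 * b 2 3 * b 2 7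
      - κ (5 / 9) * b 2 1 * b 2 5 ^ 2 - κ (5 / 18) * b 2 3 ^ 2 * b 2 5
      - κ (37 / 18) * b 2 5 * b 3 7 + κ (5 / 2) * b 2 7 * b 3 5 := by
  simp only [apply_b_two lie_odd1_field8, field8_b_one]
  refine ⟨?_, ?_, ?_, ?_⟩ <;>
  · refine poly_ext fun x => ?_
    simp only [oddSum, vf_expand, odd1_b, odd3_b, odd5_b, odd7_b, M1, M3, M5, M7, e3, e57,
      Matrix.of_apply, Matrix.cons_val, polyVal_expand x]
    ring1

theorem field8_b_three :
    field8 (b 3 1) =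
      -(8 * b 1 1 ^ 2 * b 3 5) + 8 * b 1 1 * b 1 5 * b 3 1 - 4 * b 1 1 * b 2 1 * b 2 5
      + 8 * b 1 1 * b 3 7 - 4 * b 1 3 * b 3 5 + 4 * b 1 5 * b 2 1 ^ 2 + 4 * b 1 7 * b 3 1
      + 10 * b 2 1 * b 2 7 + 2 * b 2 3 * b 2 5 ∧
    field8 (b 3 3) =
      8 * b 1 1 ^ 3 * b 3 5 - κ (40 / 3) * b 1 1 ^ 2 * b 1 5 * b 3 1 - κ 20 * b 1 1 ^ 2 * b 3 7
      - κ (8 / 3) * b 1 1 * b 1 3 ^ 2 * b 3 1 + 4 * b 1 1 * b 1 5 * b 3 3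
      + κ (26 / 3) * b 1 1 * b 1 7 * b 3 1 - b 1 1 * b 2 1 * b 2 7 - 6 * b 1 1 * b 2 3 * b 2 5
      - κ (1 / 3) * b 1 1 * b 3 1 * b 3 5 - κ (14 / 3) * b 1 3 * b 1 5 * b 3 1
      + b 1 3 * b 2 1 * b 2 5 + κ (2 / 3) * b 1 3 * b 3 1 * b 3 3 - 6 * b 1 3 * b 3 7
      + 5 * b 1 5 * b 2 1 * b 2 3 + κ (5 / 3) * b 1 5 * b 3 1 ^ 2 - 2 * b 1 5 * b 3 5
      + b 1 7 * b 2 1 ^ 2 + 2 * b 1 7 * b 3 3 + b 2 1 ^ 2 * b 3 5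
      - κ (5 / 3) * b 2 1 * b 2 5 * b 3 1 - κ (1 / 3) * b 2 3 ^ 2 * b 3 1 + 10 * b 2 3 * b 2 7
      + b 2 5 ^ 2 + κ (4 / 3) * b 3 1 * b 3 7 ∧
    field8 (b 3 5) =
      12 * b 1 1 ^ 3 * b 3 7 + 12 * b 1 1 ^ 2 * b 1 3 * b 3 5
      - κ (116 / 9) * b 1 1 ^ 2 * b 1 5 * b 3 3 - κ (40 / 9) * b 1 1 * b 1 3 ^ 2 * b 3 3
      + 4 * b 1 1 * b 1 3 * b 1 5 * b 3 1 - 10 * b 1 1 * b 1 3 * b 3 7 + 2 * b 1 1 * b 1 5 * b 3 5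
      + κ (76 / 9) * b 1 1 * b 1 7 * b 3 3 - b 1 1 * b 2 3 * b 2 7 - 5 * b 1 1 * b 2 5 ^ 2
      - 3 * b 1 1 * b 3 1 * b 3 7 + κ (1 / 9) * b 1 1 * b 3 3 * b 3 5 + 4 * b 1 3 ^ 2 * b 3 5
      - κ (58 / 9) * b 1 3 * b 1 5 * b 3 3 - b 1 3 * b 2 1 * b 2 7 - b 1 3 * b 2 3 * b 2 5
      - 2 * b 1 3 * b 3 1 * b 3 5 + κ (10 / 9) * b 1 3 * b 3 3 ^ 2 + 2 * b 1 5 ^ 2 * b 3 1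
      + 5 * b 1 5 * b 2 1 * b 2 5 + b 1 5 * b 2 3 ^ 2 + κ (10 / 9) * b 1 5 * b 3 1 * b 3 3
      - 4 * b 1 5 * b 3 7 + 2 * b 1 7 * b 2 1 * b 2 3 + κ (3 / 2) * b 2 1 ^ 2 * b 3 7
      + κ (3 / 2) * b 2 1 * b 2 3 * b 3 5 - κ (29 / 18) * b 2 1 * b 2 5 * b 3 3
      - κ (5 / 9) * b 2 3 ^ 2 * b 3 3 + κ (1 / 2) * b 2 3 * b 2 5 * b 3 1 + 10 * b 2 5 * b 2 7
      + κ (8 / 9) * b 3 3 * b 3 7 ∧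
    field8 (b 3 7) =
      κ 20 * b 1 1 ^ 2 * b 1 3 * b 3 7 - κ (40 / 9) * b 1 1 ^ 2 * b 1 5 * b 3 5
      - 4 * b 1 1 ^ 2 * b 1 7 * b 3 3 - κ (20 / 9) * b 1 1 * b 1 3 ^ 2 * b 3 5
      + 4 * b 1 1 * b 1 3 * b 1 7 * b 3 1 - 8 * b 1 1 * b 1 5 * b 3 7
      + κ (74 / 9) * b 1 1 * b 1 7 * b 3 5 - 5 * b 1 1 * b 2 5 * b 2 7 - 2 * b 1 1 * b 3 3 * b 3 7
      + κ (5 / 9) * b 1 1 * b 3 5 ^ 2 + 6 * b 1 3 ^ 2 * b 3 7 - κ (20 / 9) * b 1 3 * b 1 5 * b 3 5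
      - 2 * b 1 3 * b 1 7 * b 3 3 - b 1 3 * b 2 3 * b 2 7 - 3 * b 1 3 * b 3 1 * b 3 7
      + κ (5 / 9) * b 1 3 * b 3 3 * b 3 5 + 2 * b 1 5 * b 1 7 * b 3 1 + 3 * b 1 5 * b 2 1 * b 2 7
      + κ (5 / 9) * b 1 5 * b 3 1 * b 3 5 + 2 * b 1 7 * b 2 1 * b 2 5 + b 1 7 * b 2 3 ^ 2
      - 2 * b 1 7 * b 3 7 + κ (5 / 2) * b 2 1 * b 2 3 * b 3 7 - κ (5 / 9) * b 2 1 * b 2 5 * b 3 5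
      - κ (1 / 2) * b 2 1 * b 2 7 * b 3 3 - κ (5 / 18) * b 2 3 ^ 2 * b 3 5
      + κ (1 / 2) * b 2 3 * b 2 7 * b 3 1 + 9 * b 2 7 ^ 2 + κ (4 / 9) * b 3 5 * b 3 7 := by
  simp only [apply_b_three lie_odd1_field8, field8_b_two]
  refine ⟨?_, ?_, ?_, ?_⟩ <;>
  · refine poly_ext fun x => ?_
    simp only [oddSum, vf_expand, odd1_b, odd3_b, odd5_b, odd7_b, M1, M3, M5, M7, e3, e57,
      Matrix.of_apply, Matrix.cons_val, polyVal_expand x]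
    ring1

theorem field8_odd : OddRelations field8 3 := by
  refine .of_projects field8_projects lie_odd1_field8 ?_ ?_ ?_ <;>
  · refine poly_ext fun x => ?_
    simp only [oddSum, vf_expand, field8_b_one, field8_b_two, odd1_b, odd3_b, odd5_b, odd7_b, M1,
      M3, M5, M7, e3, e57, Matrix.of_apply, Matrix.cons_val, p, p33, p35, p37, p55, p57, p77, lam,
      polyVal_expand x]
    ring1

/-- The values of `field8` on `b_{1,j}` in terms of the polynomials `p_{k,l}`. -/
theorem field8_b_one_p :
    field8 (b 1 1) =
      b 3 7 - b 1 1 * b 1 7 + κ (1 / 2) * odd1 (odd1 (p 3 5)) - b 1 3 * b 1 5 - b 1 5 * b 1 3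
      - b 1 7 * b 1 1 + κ (4 / 9) * lam 10 ∧
    field8 (b 1 3) =
      κ (1 / 2) * odd1 (odd1 (p 3 7)) - κ (1 / 2) * b 1 1 * p 3 7
      + κ (1 / 2) * odd1 (odd3 (p 3 5)) - κ (1 / 2) * b 1 3 * p 3 5 - κ (1 / 2) * b 1 5 * p 3 3
      - b 1 7 * b 1 3 - κ (4 / 3) * lam 10 * b 1 1 + lam 4 * b 1 7 - 3 * lam 12 ∧
    field8 (b 1 5) =
      κ (1 / 2) * odd1 (odd1 (p 5 7)) - κ (1 / 2) * b 1 1 * p 5 7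
      + κ (1 / 2) * odd1 (odd3 (p 5 5)) - κ (1 / 2) * b 1 3 * p 5 5 - κ (1 / 2) * b 1 5 * p 3 5
      - b 1 7 * b 1 5 + lam 12 * b 1 1 - κ (20 / 9) * lam 10 * b 1 3 + lam 8 * b 1 5
      + 2 * lam 6 * b 1 7 - 2 * lam 14 ∧
    field8 (b 1 7) =
      κ (1 / 2) * odd1 (odd1 (p 7 7)) - κ (1 / 2) * b 1 1 * p 7 7
      + κ (1 / 2) * odd1 (odd3 (p 5 7)) - κ (1 / 2) * b 1 3 * p 5 7 - κ (1 / 2) * b 1 5 * p 3 7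
      - b 1 7 * b 1 7 - κ (10 / 9) * lam 10 * b 1 5 + 3 * lam 8 * b 1 7 - lam 16 := by
  refine ⟨?_, ?_, ?_, ?_⟩ <;>
  · refine poly_ext fun x => ?_
    simp only [vf_expand, field8_b_one, odd1_b, odd3_b, odd5_b, odd7_b, p, p33, p35, p37, p55,
      p57, p77, lam, polyVal_expand x]
    ring1

/-! ### The recursion for `D₁₀` -/

/-- The field `D_{10}`. -/
noncomputable def field10 : BField :=
    (1 / 12 : ℂ) • ((2 : ℂ) • ⁅field2, field8⁆ + (p' 3 5 + b 2 7) • odd1 - b 2 5 • odd3 - b 2 3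
    • odd5 - b 2 1 • odd7) - (8 / 27 : ℂ) • (lam 10 • euler - lam 4 • field6)

theorem field10_projects : Projects field10 (base 5) := by
  have hl : lam 10 = rhoPullback (lamVar 10) := rhoPullback_lamVar.2.2.2.1.symm
  have h4 : lam 4 = rhoPullback (lamVar 4) := rhoPullback_lamVar.1.symm
  rw [field10, hl, h4]
  refine (((((((((field2_projects.lie field8_projects).scalar_smul _).add (odd1_projects.smul_zero
    _)).sub (odd3_projects.smul_zero _)).sub (odd5_projects.smul_zero _)).sub
    (odd7_projects.smul_zero _))).scalar_smul _).sub
    (((euler_projects.smul _).sub (field6_projects.smul _)).scalar_smul _)).congr ?_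
  rw [lie_base (by norm_num) (by norm_num), baseSum]
  refine base_ext ⟨?_, ?_, ?_, ?_, ?_, ?_, ?_, ?_⟩ <;>
  · refine poly_ext fun x => ?_
    simp only [structUpper, structCoef, Nat.reduceAdd, Nat.reduceLeDiff, Nat.reduceEqDiff,
      Nat.reduceSub, Nat.reduceMul, if_true, if_false, lamVar_const, vf_expand, Nat.cast_ofNat,
      Nat.cast_one, Nat.cast_zero, polyVal_expand x]
    ring1

/-- The entries of `M1` are `b_{1,2(k-i)+1}` with `b_{1,-1} = -1`, a sequence that slides one place
per row. At this row it has run out on the left, because `b_{1,9} = 0`. -/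
theorem lie_odd1_field10 : ⁅odd1, field10⁆ = oddSum (M1 4) := by
  refine field_ext fun f => poly_ext fun x => ?_
  simp only [field10, p'_eq, vf_lie_apply, oddSum, vf_expand, field2_odd.apply, field6_odd.apply,
    field8_odd.apply, odd_euler, odd_comm, odd1_lam, field2_b_one_p, field8_b_one_p, odd1_b,
    fieldOdd_b_one_p, M1, M3, M5, M7, e3, e57, Matrix.of_apply, Matrix.cons_val, polyVal_expand x]
  ring1

theorem field10_b_one :
    field10 (b 1 1) =
      κ (4 / 3) * b 1 1 ^ 2 * b 1 7 + κ (4 / 3) * b 1 1 * b 1 3 * b 1 5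
      - κ (5 / 3) * b 1 1 * b 3 7 - κ (4 / 3) * b 1 3 * b 1 7 - κ (2 / 3) * b 1 3 * b 3 5
      - κ (2 / 3) * b 1 5 ^ 2 + κ (1 / 3) * b 1 5 * b 3 3 + κ (4 / 3) * b 1 7 * b 3 1
      + κ (1 / 6) * b 2 1 * b 2 7 + κ (1 / 6) * b 2 3 * b 2 5 ∧
    field10 (b 1 3) =
      -(4 * b 1 1 ^ 3 * b 1 7) - 4 * b 1 1 ^ 2 * b 1 3 * b 1 5 + 2 * b 1 1 ^ 2 * b 3 7
      - κ 24 * b 1 1 * b 1 3 * b 1 7 + b 1 1 * b 1 3 * b 3 5 - 12 * b 1 1 * b 1 5 ^ 2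
      - b 1 1 * b 1 7 * b 3 1 - 2 * b 1 1 * b 2 1 * b 2 7 - κ (1 / 2) * b 1 1 * b 2 3 * b 2 5
      - κ (1 / 2) * b 1 3 * b 2 1 * b 2 5 + 2 * b 1 3 * b 3 7 - κ 14 * b 1 5 * b 1 7
      + κ (1 / 2) * b 1 5 * b 2 1 * b 2 3 + 3 * b 1 5 * b 3 5 + κ (3 / 2) * b 1 7 * b 2 1 ^ 2
      + 4 * b 1 7 * b 3 3 - 3 * b 2 3 * b 2 7 - κ (3 / 2) * b 2 5 ^ 2 ∧
    field10 (b 1 5) =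
      κ (28 / 3) * b 1 1 ^ 2 * b 1 3 * b 1 7 + 8 * b 1 1 ^ 2 * b 1 5 ^ 2
      - κ (20 / 3) * b 1 1 * b 1 3 ^ 2 * b 1 5 + κ (4 / 3) * b 1 1 * b 1 3 * b 3 7
      - κ 18 * b 1 1 * b 1 5 * b 1 7 - 2 * b 1 1 * b 1 5 * b 3 5 - 3 * b 1 1 * b 1 7 * b 3 3
      + κ (1 / 2) * b 1 1 * b 2 3 * b 2 7 + b 1 1 * b 2 5 ^ 2 - κ (4 / 3) * b 1 3 ^ 2 * b 1 7
      + κ (4 / 3) * b 1 3 ^ 2 * b 3 5 - κ (2 / 3) * b 1 3 * b 1 5 ^ 2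
      + κ (1 / 3) * b 1 3 * b 1 5 * b 3 3 - κ (2 / 3) * b 1 3 * b 1 7 * b 3 1
      - κ (11 / 6) * b 1 3 * b 2 1 * b 2 7 - κ (4 / 3) * b 1 3 * b 2 3 * b 2 5
      + κ (1 / 2) * b 1 5 * b 2 3 ^ 2 + 3 * b 1 5 * b 3 7 - 8 * b 1 7 ^ 2
      + κ (5 / 2) * b 1 7 * b 2 1 * b 2 3 + 4 * b 1 7 * b 3 5 - κ (7 / 2) * b 2 5 * b 2 7 ∧
    field10 (b 1 7) =
      κ (32 / 3) * b 1 1 ^ 2 * b 1 5 * b 1 7 + 8 * b 1 1 * b 1 3 ^ 2 * b 1 7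
      - κ (16 / 3) * b 1 1 * b 1 3 * b 1 5 ^ 2 + κ (2 / 3) * b 1 1 * b 1 5 * b 3 7
      - 10 * b 1 1 * b 1 7 ^ 2 - 3 * b 1 1 * b 1 7 * b 3 5 + b 1 1 * b 2 5 * b 2 7
      + κ (10 / 3) * b 1 3 * b 1 5 * b 1 7 + κ (2 / 3) * b 1 3 * b 1 5 * b 3 5
      - 2 * b 1 3 * b 1 7 * b 3 3 - κ (4 / 3) * b 1 5 ^ 3 + κ (2 / 3) * b 1 5 ^ 2 * b 3 3
      - κ (1 / 3) * b 1 5 * b 1 7 * b 3 1 - κ (5 / 3) * b 1 5 * b 2 1 * b 2 7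
      - κ (2 / 3) * b 1 5 * b 2 3 * b 2 5 + 2 * b 1 7 * b 2 1 * b 2 5 + b 1 7 * b 2 3 ^ 2
      + 4 * b 1 7 * b 3 7 - 2 * b 2 7 ^ 2 := by
  refine ⟨?_, ?_, ?_, ?_⟩ <;>
  · refine poly_ext fun x => ?_
    simp only [field10, p'_eq, vf_lie_apply, vf_expand, field2_b_one, field2_b_two,
      field2_b_three, field6_b_one, field6_b_two, field6_b_three, field8_b_one, field8_b_two,
      field8_b_three, euler_b, odd1_b, odd3_b, odd5_b, odd7_b, p, p33, p35, p37, p55, p57, p77, lam,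
      polyVal_expand x]
    ring1

theorem field10_b_two :
    field10 (b 2 1) =
      -(12 * b 1 1 ^ 2 * b 2 7) - 4 * b 1 1 * b 1 3 * b 2 5 + 4 * b 1 1 * b 1 5 * b 2 3
      + 12 * b 1 1 * b 1 7 * b 2 1 - 5 * b 1 3 * b 2 7 - b 1 5 * b 2 5 + 3 * b 1 7 * b 2 3
      - κ (3 / 2) * b 2 1 * b 3 7 - κ (1 / 2) * b 2 3 * b 3 5 + κ (1 / 2) * b 2 5 * b 3 3
      + κ (3 / 2) * b 2 7 * b 3 1 ∧
    field10 (b 2 3) =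
      12 * b 1 1 ^ 3 * b 2 7 + 4 * b 1 1 ^ 2 * b 1 3 * b 2 5 - 4 * b 1 1 ^ 2 * b 1 5 * b 2 3
      - κ 16 * b 1 1 ^ 2 * b 1 7 * b 2 1 - 4 * b 1 1 * b 1 3 * b 1 5 * b 2 1
      - 3 * b 1 1 * b 1 3 * b 2 7 + b 1 1 * b 1 5 * b 2 5 + 5 * b 1 1 * b 1 7 * b 2 3
      + 2 * b 1 1 * b 2 1 * b 3 7 + κ (1 / 2) * b 1 1 * b 2 3 * b 3 5
      - κ (1 / 2) * b 1 1 * b 2 5 * b 3 3 - 3 * b 1 1 * b 2 7 * b 3 1 - 2 * b 1 3 * b 1 7 * b 2 1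
      + κ (1 / 2) * b 1 3 * b 2 1 * b 3 5 - κ (1 / 2) * b 1 3 * b 2 5 * b 3 1 - b 1 5 ^ 2 * b 2 1
      + κ (1 / 2) * b 1 5 * b 2 1 * b 3 3 + κ (1 / 2) * b 1 5 * b 2 3 * b 3 1 - 3 * b 1 5 * b 2 7
      + 2 * b 1 7 * b 2 1 * b 3 1 + b 1 7 * b 2 5 - κ (1 / 2) * b 2 1 ^ 2 * b 2 7
      - κ (1 / 2) * b 2 1 * b 2 3 * b 2 5 - b 2 3 * b 3 7 + b 2 7 * b 3 3 ∧
    field10 (b 2 5) =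
      κ 20 * b 1 1 ^ 2 * b 1 3 * b 2 7 - κ (44 / 3) * b 1 1 ^ 2 * b 1 7 * b 2 3
      + 4 * b 1 1 * b 1 3 ^ 2 * b 2 5 - κ (32 / 3) * b 1 1 * b 1 3 * b 1 5 * b 2 3
      + 4 * b 1 1 * b 1 3 * b 1 7 * b 2 1 + 8 * b 1 1 * b 1 5 ^ 2 * b 2 1 - b 1 1 * b 1 5 * b 2 7
      + 3 * b 1 1 * b 1 7 * b 2 5 + κ (11 / 6) * b 1 1 * b 2 3 * b 3 7
      - κ (5 / 2) * b 1 1 * b 2 7 * b 3 3 + 5 * b 1 3 ^ 2 * b 2 7 + b 1 3 * b 1 5 * b 2 5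
      - κ (19 / 3) * b 1 3 * b 1 7 * b 2 3 - κ (1 / 2) * b 1 3 * b 2 1 * b 3 7
      + κ (4 / 3) * b 1 3 * b 2 3 * b 3 5 - b 1 3 * b 2 5 * b 3 3
      - κ (5 / 2) * b 1 3 * b 2 7 * b 3 1 - κ (5 / 3) * b 1 5 ^ 2 * b 2 3
      + 8 * b 1 5 * b 1 7 * b 2 1 - 2 * b 1 5 * b 2 1 * b 3 5 + κ (4 / 3) * b 1 5 * b 2 3 * b 3 3
      - κ (1 / 2) * b 1 7 * b 2 1 * b 3 3 + κ (11 / 6) * b 1 7 * b 2 3 * b 3 1 - b 1 7 * b 2 7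
      + κ (7 / 6) * b 2 1 * b 2 3 * b 2 7 + b 2 1 * b 2 5 ^ 2 - κ (5 / 6) * b 2 3 ^ 2 * b 2 5
      - κ (1 / 2) * b 2 5 * b 3 7 + κ (1 / 2) * b 2 7 * b 3 5 ∧
    field10 (b 2 7) =
      κ 16 * b 1 1 ^ 2 * b 1 5 * b 2 7 - κ (40 / 3) * b 1 1 ^ 2 * b 1 7 * b 2 5
      + 8 * b 1 1 * b 1 3 ^ 2 * b 2 7 - κ (16 / 3) * b 1 1 * b 1 3 * b 1 5 * b 2 5
      + 8 * b 1 1 * b 1 5 * b 1 7 * b 2 1 + b 1 1 * b 1 7 * b 2 7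
      + κ (5 / 3) * b 1 1 * b 2 5 * b 3 7 - 2 * b 1 1 * b 2 7 * b 3 5 + 8 * b 1 3 * b 1 5 * b 2 7
      - κ (17 / 3) * b 1 3 * b 1 7 * b 2 5 + κ (2 / 3) * b 1 3 * b 2 5 * b 3 5
      - 2 * b 1 3 * b 2 7 * b 3 3 - κ (4 / 3) * b 1 5 ^ 2 * b 2 5 + b 1 5 * b 1 7 * b 2 3
      - b 1 5 * b 2 1 * b 3 7 + κ (2 / 3) * b 1 5 * b 2 5 * b 3 3 - 2 * b 1 5 * b 2 7 * b 3 1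
      + 5 * b 1 7 ^ 2 * b 2 1 - b 1 7 * b 2 1 * b 3 5 + κ (5 / 3) * b 1 7 * b 2 5 * b 3 1
      + κ (4 / 3) * b 2 1 * b 2 5 * b 2 7 + b 2 3 ^ 2 * b 2 7 - κ (2 / 3) * b 2 3 * b 2 5 ^ 2 := by
  simp only [apply_b_two lie_odd1_field10, field10_b_one]
  refine ⟨?_, ?_, ?_, ?_⟩ <;>
  · refine poly_ext fun x => ?_
    simp only [oddSum, vf_expand, odd1_b, odd3_b, odd5_b, odd7_b, M1, M3, M5, M7, e3, e57,
      Matrix.of_apply, Matrix.cons_val, polyVal_expand x]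
    ring1

theorem field10_b_three :
    field10 (b 3 1) =
      -(12 * b 1 1 ^ 2 * b 3 7) - 4 * b 1 1 * b 1 3 * b 3 5 + 4 * b 1 1 * b 1 5 * b 3 3
      + 12 * b 1 1 * b 1 7 * b 3 1 - 6 * b 1 1 * b 2 1 * b 2 7 - 2 * b 1 3 * b 2 1 * b 2 5
      - 6 * b 1 3 * b 3 7 + 2 * b 1 5 * b 2 1 * b 2 3 - 2 * b 1 5 * b 3 5 + 6 * b 1 7 * b 2 1 ^ 2
      + 2 * b 1 7 * b 3 3 + 2 * b 2 3 * b 2 7 + b 2 5 ^ 2 ∧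
    field10 (b 3 3) =
      12 * b 1 1 ^ 3 * b 3 7 + 4 * b 1 1 ^ 2 * b 1 3 * b 3 5 - 4 * b 1 1 ^ 2 * b 1 5 * b 3 3
      - κ 16 * b 1 1 ^ 2 * b 1 7 * b 3 1 - 4 * b 1 1 * b 1 3 * b 1 5 * b 3 1
      - 2 * b 1 1 * b 1 3 * b 3 7 + 2 * b 1 1 * b 1 5 * b 3 5 + 6 * b 1 1 * b 1 7 * b 3 3
      - 8 * b 1 1 * b 2 3 * b 2 7 - b 1 1 * b 2 5 ^ 2 - b 1 1 * b 3 1 * b 3 7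
      - 4 * b 1 3 * b 1 7 * b 3 1 + b 1 3 * b 2 1 * b 2 7 - 2 * b 1 3 * b 2 3 * b 2 5
      - 2 * b 1 5 ^ 2 * b 3 1 + b 1 5 * b 2 1 * b 2 5 + 2 * b 1 5 * b 2 3 ^ 2
      + b 1 5 * b 3 1 * b 3 3 - 4 * b 1 5 * b 3 7 + 7 * b 1 7 * b 2 1 * b 2 3
      + 2 * b 1 7 * b 3 1 ^ 2 + κ (3 / 2) * b 2 1 ^ 2 * b 3 7 + κ (1 / 2) * b 2 1 * b 2 3 * b 3 5
      - κ (1 / 2) * b 2 1 * b 2 5 * b 3 3 - 2 * b 2 1 * b 2 7 * b 3 1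
      - κ (1 / 2) * b 2 3 * b 2 5 * b 3 1 + 2 * b 2 5 * b 2 7 ∧
    field10 (b 3 5) =
      κ 20 * b 1 1 ^ 2 * b 1 3 * b 3 7 - κ (44 / 3) * b 1 1 ^ 2 * b 1 7 * b 3 3
      + 4 * b 1 1 * b 1 3 ^ 2 * b 3 5 - κ (32 / 3) * b 1 1 * b 1 3 * b 1 5 * b 3 3
      + 4 * b 1 1 * b 1 3 * b 1 7 * b 3 1 + 8 * b 1 1 * b 1 5 ^ 2 * b 3 1
      + 4 * b 1 1 * b 1 7 * b 3 5 - 8 * b 1 1 * b 2 5 * b 2 7 - κ (2 / 3) * b 1 1 * b 3 3 * b 3 7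
      + 6 * b 1 3 ^ 2 * b 3 7 + 2 * b 1 3 * b 1 5 * b 3 5 - κ (22 / 3) * b 1 3 * b 1 7 * b 3 3
      - b 1 3 * b 2 3 * b 2 7 - 3 * b 1 3 * b 2 5 ^ 2 - 3 * b 1 3 * b 3 1 * b 3 7
      + κ (1 / 3) * b 1 3 * b 3 3 * b 3 5 - κ (8 / 3) * b 1 5 ^ 2 * b 3 3
      + 6 * b 1 5 * b 1 7 * b 3 1 + b 1 5 * b 2 1 * b 2 7 + 3 * b 1 5 * b 2 3 * b 2 5
      - 2 * b 1 5 * b 3 1 * b 3 5 + κ (4 / 3) * b 1 5 * b 3 3 ^ 2 + 7 * b 1 7 * b 2 1 * b 2 5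
      + b 1 7 * b 2 3 ^ 2 + κ (4 / 3) * b 1 7 * b 3 1 * b 3 3 - 2 * b 1 7 * b 3 7
      + κ (5 / 2) * b 2 1 * b 2 3 * b 3 7 - κ (11 / 6) * b 2 1 * b 2 7 * b 3 3
      + κ (1 / 2) * b 2 3 ^ 2 * b 3 5 - κ (4 / 3) * b 2 3 * b 2 5 * b 3 3
      + κ (1 / 2) * b 2 3 * b 2 7 * b 3 1 + b 2 5 ^ 2 * b 3 1 + b 2 7 ^ 2 ∧
    field10 (b 3 7) =
      κ 16 * b 1 1 ^ 2 * b 1 5 * b 3 7 - κ (40 / 3) * b 1 1 ^ 2 * b 1 7 * b 3 5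
      + 8 * b 1 1 * b 1 3 ^ 2 * b 3 7 - κ (16 / 3) * b 1 1 * b 1 3 * b 1 5 * b 3 5
      + 8 * b 1 1 * b 1 5 * b 1 7 * b 3 1 + 2 * b 1 1 * b 1 7 * b 3 7 - 7 * b 1 1 * b 2 7 ^ 2
      - κ (1 / 3) * b 1 1 * b 3 5 * b 3 7 + 10 * b 1 3 * b 1 5 * b 3 7
      - κ (20 / 3) * b 1 3 * b 1 7 * b 3 5 - 3 * b 1 3 * b 2 5 * b 2 7 - 2 * b 1 3 * b 3 3 * b 3 7
      + κ (2 / 3) * b 1 3 * b 3 5 ^ 2 - κ (4 / 3) * b 1 5 ^ 2 * b 3 5 + b 1 5 * b 2 3 * b 2 7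
      - 3 * b 1 5 * b 3 1 * b 3 7 + κ (2 / 3) * b 1 5 * b 3 3 * b 3 5 + 4 * b 1 7 ^ 2 * b 3 1
      + 7 * b 1 7 * b 2 1 * b 2 7 + 2 * b 1 7 * b 2 3 * b 2 5 + κ (2 / 3) * b 1 7 * b 3 1 * b 3 5
      + 2 * b 2 1 * b 2 5 * b 3 7 - κ (5 / 3) * b 2 1 * b 2 7 * b 3 5 + b 2 3 ^ 2 * b 3 7
      - κ (2 / 3) * b 2 3 * b 2 5 * b 3 5 + b 2 5 * b 2 7 * b 3 1 := by
  simp only [apply_b_three lie_odd1_field10, field10_b_two]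
  refine ⟨?_, ?_, ?_, ?_⟩ <;>
  · refine poly_ext fun x => ?_
    simp only [oddSum, vf_expand, odd1_b, odd3_b, odd5_b, odd7_b, M1, M3, M5, M7, e3, e57,
      Matrix.of_apply, Matrix.cons_val, polyVal_expand x]
    ring1

theorem field10_odd : OddRelations field10 4 := by
  refine .of_projects field10_projects lie_odd1_field10 ?_ ?_ ?_ <;>
  · refine poly_ext fun x => ?_
    simp only [oddSum, vf_expand, field10_b_one, field10_b_two, odd1_b, odd3_b, odd5_b, odd7_b,
      M1, M3, M5, M7, e3, e57, Matrix.of_apply, Matrix.cons_val, p, p33, p35, p37, p55, p57, p77,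
      lam, polyVal_expand x]
    ring1

/-- The values of `field10` on `b_{1,j}` in terms of the polynomials `p_{k,l}`. -/
theorem field10_b_one_p :
    field10 (b 1 1) =
      κ (1 / 2) * odd1 (odd1 (p 3 7)) - b 1 3 * b 1 7 + κ (1 / 4) * odd1 (odd1 (p 5 5))
      - b 1 5 * b 1 5 - b 1 7 * b 1 3 + κ (1 / 3) * lam 12 ∧
    field10 (b 1 3) =
      κ (1 / 2) * odd1 (odd3 (p 3 7)) - κ (1 / 2) * b 1 3 * p 3 7
      + κ (1 / 4) * odd1 (odd3 (p 5 5)) - κ (1 / 2) * b 1 5 * p 3 5 - κ (1 / 2) * b 1 7 * p 3 3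
      - lam 12 * b 1 1 - 4 * lam 14 ∧
    field10 (b 1 5) =
      κ (1 / 2) * odd1 (odd3 (p 5 7)) - κ (1 / 2) * b 1 3 * p 5 7
      + κ (1 / 4) * odd1 (odd5 (p 5 5)) - κ (1 / 2) * b 1 5 * p 5 5 - κ (1 / 2) * b 1 7 * p 3 5
      + 2 * lam 14 * b 1 1 - κ (5 / 3) * lam 12 * b 1 3 + lam 8 * b 1 7 - 3 * lam 16 ∧
    field10 (b 1 7) =
      κ (1 / 2) * odd1 (odd3 (p 7 7)) - κ (1 / 2) * b 1 3 * p 7 7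
      + κ (1 / 4) * odd1 (odd5 (p 5 7)) - κ (1 / 2) * b 1 5 * p 5 7 - κ (1 / 2) * b 1 7 * p 3 7
      + lam 16 * b 1 1 - κ (4 / 3) * lam 12 * b 1 5 + 2 * lam 10 * b 1 7 - 2 * lam 18 := by
  refine ⟨?_, ?_, ?_, ?_⟩ <;>
  · refine poly_ext fun x => ?_
    simp only [vf_expand, field10_b_one, odd1_b, odd3_b, odd5_b, odd7_b, p, p33, p35, p37, p55,
      p57, p77, lam, polyVal_expand x]
    ring1

/-! ### The recursion for `D₁₂` -/

/-- The field `D_{12}`. -/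
noncomputable def field12 : BField :=
    (1 / 16 : ℂ) • ((2 : ℂ) • ⁅field2, field10⁆ + (p' 3 7 + κ (1 / 2) * p' 5 5) • odd1 - b 2 7
    • odd3 - b 2 5 • odd5 - b 2 3 • odd7) - (1 / 6 : ℂ) • (lam 12 • euler - lam 4 • field8)

theorem field12_projects : Projects field12 (base 6) := by
  have hl : lam 12 = rhoPullback (lamVar 12) := rhoPullback_lamVar.2.2.2.2.1.symm
  have h4 : lam 4 = rhoPullback (lamVar 4) := rhoPullback_lamVar.1.symm
  rw [field12, hl, h4]
  refine (((((((((field2_projects.lie field10_projects).scalar_smul _).add (odd1_projects.smul_zero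
    _)).sub (odd3_projects.smul_zero _)).sub (odd5_projects.smul_zero _)).sub
    (odd7_projects.smul_zero _))).scalar_smul _).sub
    (((euler_projects.smul _).sub (field8_projects.smul _)).scalar_smul _)).congr ?_
  rw [lie_base (by norm_num) (by norm_num), baseSum]
  refine base_ext ⟨?_, ?_, ?_, ?_, ?_, ?_, ?_, ?_⟩ <;>
  · refine poly_ext fun x => ?_
    simp only [structUpper, structCoef, Nat.reduceAdd, Nat.reduceLeDiff, Nat.reduceEqDiff,
      Nat.reduceSub, Nat.reduceMul, if_true, if_false, lamVar_const, vf_expand, Nat.cast_ofNat,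
      Nat.cast_one, Nat.cast_zero, polyVal_expand x]
    ring1

theorem lie_odd1_field12 : ⁅odd1, field12⁆ = oddSum (M1 5) := by
  refine field_ext fun f => poly_ext fun x => ?_
  simp only [field12, p'_eq, vf_lie_apply, oddSum, vf_expand, field2_odd.apply, field8_odd.apply,
    field10_odd.apply, odd_euler, odd_comm, odd1_lam, field2_b_one_p, field10_b_one_p, odd1_b,
    fieldOdd_b_one_p, M1, M3, M5, M7, e3, e57, Matrix.of_apply, Matrix.cons_val, polyVal_expand x]
  ring1

theorem field12_b_one :
    field12 (b 1 1) =
      κ (8 / 9) * b 1 1 * b 1 3 * b 1 7 + κ (4 / 9) * b 1 1 * b 1 5 ^ 2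
      - κ (10 / 9) * b 1 3 * b 3 7 - κ (14 / 9) * b 1 5 * b 1 7 - κ (1 / 9) * b 1 5 * b 3 5
      + κ (8 / 9) * b 1 7 * b 3 3 + κ (1 / 9) * b 2 3 * b 2 7 + κ (1 / 18) * b 2 5 ^ 2 ∧
    field12 (b 1 3) =
      -(κ (8 / 3) * b 1 1 ^ 2 * b 1 3 * b 1 7) - κ (4 / 3) * b 1 1 ^ 2 * b 1 5 ^ 2
      + κ (4 / 3) * b 1 1 * b 1 3 * b 3 7 - κ (82 / 3) * b 1 1 * b 1 5 * b 1 7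
      + κ (1 / 3) * b 1 1 * b 1 5 * b 3 5 - κ (2 / 3) * b 1 1 * b 1 7 * b 3 3
      - κ (1 / 3) * b 1 1 * b 2 3 * b 2 7 - κ (1 / 6) * b 1 1 * b 2 5 ^ 2 - b 1 3 * b 2 1 * b 2 7
      + 3 * b 1 5 * b 3 7 - 8 * b 1 7 ^ 2 + b 1 7 * b 2 1 * b 2 3 + 4 * b 1 7 * b 3 5
      - κ (7 / 2) * b 2 5 * b 2 7 ∧
    field12 (b 1 5) =
      κ 20 * b 1 1 ^ 2 * b 1 5 * b 1 7 - κ (40 / 9) * b 1 1 * b 1 3 ^ 2 * b 1 7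
      - κ (20 / 9) * b 1 1 * b 1 3 * b 1 5 ^ 2 - 2 * b 1 1 * b 1 5 * b 3 7
      - 10 * b 1 1 * b 1 7 ^ 2 - 3 * b 1 1 * b 1 7 * b 3 5 + κ (5 / 2) * b 1 1 * b 2 5 * b 2 7
      + κ (14 / 9) * b 1 3 ^ 2 * b 3 7 - κ (2 / 9) * b 1 3 * b 1 5 * b 1 7
      + κ (5 / 9) * b 1 3 * b 1 5 * b 3 5 - κ (4 / 9) * b 1 3 * b 1 7 * b 3 3
      - κ (14 / 9) * b 1 3 * b 2 3 * b 2 7 - κ (5 / 18) * b 1 3 * b 2 5 ^ 2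
      - κ (1 / 2) * b 1 5 * b 2 1 * b 2 7 + κ (1 / 2) * b 1 7 * b 2 1 * b 2 5 + b 1 7 * b 2 3 ^ 2
      + 4 * b 1 7 * b 3 7 - 2 * b 2 7 ^ 2 ∧
    field12 (b 1 7) =
      12 * b 1 1 ^ 2 * b 1 7 ^ 2 + κ (52 / 9) * b 1 1 * b 1 3 * b 1 5 * b 1 7
      - κ (28 / 9) * b 1 1 * b 1 5 ^ 3 - 3 * b 1 1 * b 1 7 * b 3 7 + κ (3 / 2) * b 1 1 * b 2 7 ^ 2
      + κ (7 / 9) * b 1 3 * b 1 5 * b 3 7 + 4 * b 1 3 * b 1 7 ^ 2 - 2 * b 1 3 * b 1 7 * b 3 5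
      + κ (1 / 2) * b 1 3 * b 2 5 * b 2 7 - κ (10 / 9) * b 1 5 ^ 2 * b 1 7
      + κ (7 / 9) * b 1 5 ^ 2 * b 3 5 - κ (2 / 9) * b 1 5 * b 1 7 * b 3 3
      - κ (23 / 18) * b 1 5 * b 2 3 * b 2 7 - κ (7 / 18) * b 1 5 * b 2 5 ^ 2
      + κ (3 / 2) * b 1 7 * b 2 3 * b 2 5 := by
  refine ⟨?_, ?_, ?_, ?_⟩ <;>
  · refine poly_ext fun x => ?_
    simp only [field12, p'_eq, vf_lie_apply, vf_expand, field2_b_one, field2_b_two,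
      field2_b_three, field8_b_one, field8_b_two, field8_b_three, field10_b_one, field10_b_two,
      field10_b_three, euler_b, odd1_b, odd3_b, odd5_b, odd7_b, p, p33, p35, p37, p55, p57, p77,
      lam, polyVal_expand x]
    ring1

theorem field12_b_two :
    field12 (b 2 1) =
      -(8 * b 1 1 * b 1 3 * b 2 7) + 8 * b 1 1 * b 1 7 * b 2 3 - 3 * b 1 5 * b 2 7 + b 1 7 * b 2 5
      - b 2 3 * b 3 7 + b 2 7 * b 3 3 ∧
    field12 (b 2 3) =
      8 * b 1 1 ^ 2 * b 1 3 * b 2 7 - 8 * b 1 1 ^ 2 * b 1 7 * b 2 3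
      - κ (8 / 3) * b 1 1 * b 1 3 * b 1 7 * b 2 1 - κ (4 / 3) * b 1 1 * b 1 5 ^ 2 * b 2 1
      - b 1 1 * b 1 5 * b 2 7 + 3 * b 1 1 * b 1 7 * b 2 5 + b 1 1 * b 2 3 * b 3 7
      - b 1 1 * b 2 7 * b 3 3 + κ (1 / 3) * b 1 3 * b 2 1 * b 3 7 - b 1 3 * b 2 7 * b 3 1
      - κ (4 / 3) * b 1 5 * b 1 7 * b 2 1 + κ (1 / 3) * b 1 5 * b 2 1 * b 3 5
      + κ (1 / 3) * b 1 7 * b 2 1 * b 3 3 + b 1 7 * b 2 3 * b 3 1 - b 1 7 * b 2 7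
      - κ (1 / 3) * b 2 1 * b 2 3 * b 2 7 - κ (1 / 6) * b 2 1 * b 2 5 ^ 2
      - κ (1 / 2) * b 2 5 * b 3 7 + κ (1 / 2) * b 2 7 * b 3 5 ∧
    field12 (b 2 5) =
      4 * b 1 1 ^ 2 * b 1 5 * b 2 7 - 4 * b 1 1 ^ 2 * b 1 7 * b 2 5
      + 8 * b 1 1 * b 1 3 ^ 2 * b 2 7 - κ (112 / 9) * b 1 1 * b 1 3 * b 1 7 * b 2 3
      - κ (20 / 9) * b 1 1 * b 1 5 ^ 2 * b 2 3 + κ 20 * b 1 1 * b 1 5 * b 1 7 * b 2 1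
      + b 1 1 * b 1 7 * b 2 7 + κ (1 / 2) * b 1 1 * b 2 5 * b 3 7
      - κ (1 / 2) * b 1 1 * b 2 7 * b 3 5 + 3 * b 1 3 * b 1 5 * b 2 7 - b 1 3 * b 1 7 * b 2 5
      + κ (14 / 9) * b 1 3 * b 2 3 * b 3 7 - 2 * b 1 3 * b 2 7 * b 3 3
      - κ (20 / 9) * b 1 5 * b 1 7 * b 2 3 - κ (5 / 2) * b 1 5 * b 2 1 * b 3 7
      + κ (5 / 9) * b 1 5 * b 2 3 * b 3 5 - κ (1 / 2) * b 1 5 * b 2 7 * b 3 1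
      + 5 * b 1 7 ^ 2 * b 2 1 - κ (5 / 2) * b 1 7 * b 2 1 * b 3 5
      + κ (14 / 9) * b 1 7 * b 2 3 * b 3 3 + κ (1 / 2) * b 1 7 * b 2 5 * b 3 1
      + κ (5 / 2) * b 2 1 * b 2 5 * b 2 7 - κ (5 / 9) * b 2 3 ^ 2 * b 2 7
      - κ (5 / 18) * b 2 3 * b 2 5 ^ 2 ∧
    field12 (b 2 7) =
      12 * b 1 1 * b 1 3 * b 1 5 * b 2 7 - κ (92 / 9) * b 1 1 * b 1 3 * b 1 7 * b 2 5
      - κ (28 / 9) * b 1 1 * b 1 5 ^ 2 * b 2 5 + 4 * b 1 1 * b 1 5 * b 1 7 * b 2 3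
      + 12 * b 1 1 * b 1 7 ^ 2 * b 2 1 + b 1 3 * b 1 7 * b 2 7
      + κ (23 / 18) * b 1 3 * b 2 5 * b 3 7 - κ (3 / 2) * b 1 3 * b 2 7 * b 3 5
      + 3 * b 1 5 ^ 2 * b 2 7 - κ (37 / 9) * b 1 5 * b 1 7 * b 2 5
      - κ (1 / 2) * b 1 5 * b 2 3 * b 3 7 + κ (7 / 9) * b 1 5 * b 2 5 * b 3 5
      - κ (3 / 2) * b 1 5 * b 2 7 * b 3 3 + 3 * b 1 7 ^ 2 * b 2 3 - 3 * b 1 7 * b 2 1 * b 3 7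
      - κ (1 / 2) * b 1 7 * b 2 3 * b 3 5 + κ (23 / 18) * b 1 7 * b 2 5 * b 3 3
      + κ (3 / 2) * b 2 1 * b 2 7 ^ 2 + κ (13 / 18) * b 2 3 * b 2 5 * b 2 7
      - κ (7 / 18) * b 2 5 ^ 3 := by
  simp only [apply_b_two lie_odd1_field12, field12_b_one]
  refine ⟨?_, ?_, ?_, ?_⟩ <;>
  · refine poly_ext fun x => ?_
    simp only [oddSum, vf_expand, odd1_b, odd3_b, odd5_b, odd7_b, M1, M3, M5, M7, e3, e57,
      Matrix.of_apply, Matrix.cons_val, polyVal_expand x]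
    ring1

theorem field12_b_three :
    field12 (b 3 1) =
      -(8 * b 1 1 * b 1 3 * b 3 7) + 8 * b 1 1 * b 1 7 * b 3 3 - 4 * b 1 3 * b 2 1 * b 2 7
      - 4 * b 1 5 * b 3 7 + 4 * b 1 7 * b 2 1 * b 2 3 + 2 * b 2 5 * b 2 7 ∧
    field12 (b 3 3) =
      8 * b 1 1 ^ 2 * b 1 3 * b 3 7 - 8 * b 1 1 ^ 2 * b 1 7 * b 3 3
      - κ (8 / 3) * b 1 1 * b 1 3 * b 1 7 * b 3 1 - κ (4 / 3) * b 1 1 * b 1 5 ^ 2 * b 3 1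
      + 4 * b 1 1 * b 1 7 * b 3 5 - 2 * b 1 1 * b 2 5 * b 2 7 - 4 * b 1 3 * b 2 3 * b 2 7
      - κ (2 / 3) * b 1 3 * b 3 1 * b 3 7 - κ (10 / 3) * b 1 5 * b 1 7 * b 3 1
      + b 1 5 * b 2 1 * b 2 7 + κ (1 / 3) * b 1 5 * b 3 1 * b 3 5 + b 1 7 * b 2 1 * b 2 5
      + 4 * b 1 7 * b 2 3 ^ 2 + κ (4 / 3) * b 1 7 * b 3 1 * b 3 3 - 2 * b 1 7 * b 3 7
      + b 2 1 * b 2 3 * b 3 7 - b 2 1 * b 2 7 * b 3 3 - κ (1 / 3) * b 2 3 * b 2 7 * b 3 1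
      - κ (1 / 6) * b 2 5 ^ 2 * b 3 1 + b 2 7 ^ 2 ∧
    field12 (b 3 5) =
      4 * b 1 1 ^ 2 * b 1 5 * b 3 7 - 4 * b 1 1 ^ 2 * b 1 7 * b 3 5
      + 8 * b 1 1 * b 1 3 ^ 2 * b 3 7 - κ (112 / 9) * b 1 1 * b 1 3 * b 1 7 * b 3 3
      - κ (20 / 9) * b 1 1 * b 1 5 ^ 2 * b 3 3 + κ 20 * b 1 1 * b 1 5 * b 1 7 * b 3 1
      + 2 * b 1 1 * b 1 7 * b 3 7 - b 1 1 * b 2 7 ^ 2 + 4 * b 1 3 * b 1 5 * b 3 7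
      - 6 * b 1 3 * b 2 5 * b 2 7 - κ (4 / 9) * b 1 3 * b 3 3 * b 3 7
      - κ (38 / 9) * b 1 5 * b 1 7 * b 3 3 + b 1 5 * b 2 3 * b 2 7 - 3 * b 1 5 * b 3 1 * b 3 7
      + κ (5 / 9) * b 1 5 * b 3 3 * b 3 5 + 4 * b 1 7 ^ 2 * b 3 1 + b 1 7 * b 2 1 * b 2 7
      + 5 * b 1 7 * b 2 3 * b 2 5 - 2 * b 1 7 * b 3 1 * b 3 5 + κ (14 / 9) * b 1 7 * b 3 3 ^ 2
      + κ (1 / 2) * b 2 1 * b 2 5 * b 3 7 - κ (1 / 2) * b 2 1 * b 2 7 * b 3 5 + b 2 3 ^ 2 * b 3 7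
      - κ (14 / 9) * b 2 3 * b 2 7 * b 3 3 - κ (5 / 18) * b 2 5 ^ 2 * b 3 3
      + κ (5 / 2) * b 2 5 * b 2 7 * b 3 1 ∧
    field12 (b 3 7) =
      12 * b 1 1 * b 1 3 * b 1 5 * b 3 7 - κ (92 / 9) * b 1 1 * b 1 3 * b 1 7 * b 3 5
      - κ (28 / 9) * b 1 1 * b 1 5 ^ 2 * b 3 5 + 4 * b 1 1 * b 1 5 * b 1 7 * b 3 3
      + 12 * b 1 1 * b 1 7 ^ 2 * b 3 1 + 2 * b 1 3 * b 1 7 * b 3 7 - 5 * b 1 3 * b 2 7 ^ 2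
      - κ (2 / 9) * b 1 3 * b 3 5 * b 3 7 + 4 * b 1 5 ^ 2 * b 3 7
      - κ (46 / 9) * b 1 5 * b 1 7 * b 3 5 - b 1 5 * b 2 5 * b 2 7 - 2 * b 1 5 * b 3 3 * b 3 7
      + κ (7 / 9) * b 1 5 * b 3 5 ^ 2 + 2 * b 1 7 ^ 2 * b 3 3 + 5 * b 1 7 * b 2 3 * b 2 7
      + b 1 7 * b 2 5 ^ 2 - 3 * b 1 7 * b 3 1 * b 3 7 + κ (7 / 9) * b 1 7 * b 3 3 * b 3 5
      + κ (3 / 2) * b 2 3 * b 2 5 * b 3 7 - κ (23 / 18) * b 2 3 * b 2 7 * b 3 5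
      - κ (7 / 18) * b 2 5 ^ 2 * b 3 5 + κ (1 / 2) * b 2 5 * b 2 7 * b 3 3
      + κ (3 / 2) * b 2 7 ^ 2 * b 3 1 := by
  simp only [apply_b_three lie_odd1_field12, field12_b_two]
  refine ⟨?_, ?_, ?_, ?_⟩ <;>
  · refine poly_ext fun x => ?_
    simp only [oddSum, vf_expand, odd1_b, odd3_b, odd5_b, odd7_b, M1, M3, M5, M7, e3, e57,
      Matrix.of_apply, Matrix.cons_val, polyVal_expand x]
    ring1

theorem field12_odd : OddRelations field12 5 := by
  refine .of_projects field12_projects lie_odd1_field12 ?_ ?_ ?_ <;>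
  · refine poly_ext fun x => ?_
    simp only [oddSum, vf_expand, field12_b_one, field12_b_two, odd1_b, odd3_b, odd5_b, odd7_b,
      M1, M3, M5, M7, e3, e57, Matrix.of_apply, Matrix.cons_val, p, p33, p35, p37, p55, p57, p77,
      lam, polyVal_expand x]
    ring1

/-- The values of `field12` on `b_{1,j}` in terms of the polynomials `p_{k,l}`. -/
theorem field12_b_one_p :
    field12 (b 1 1) =
      κ (1 / 2) * odd1 (odd1 (p 5 7)) - b 1 5 * b 1 7 - b 1 7 * b 1 5 + κ (2 / 9) * lam 14 ∧
    field12 (b 1 3) =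
      κ (1 / 2) * odd1 (odd3 (p 5 7)) - κ (1 / 2) * b 1 5 * p 3 7 - κ (1 / 2) * b 1 7 * p 3 5
      - κ (2 / 3) * lam 14 * b 1 1 - 5 * lam 16 ∧
    field12 (b 1 5) =
      κ (1 / 2) * odd1 (odd5 (p 5 7)) - κ (1 / 2) * b 1 5 * p 5 7 - κ (1 / 2) * b 1 7 * p 5 5
      + 3 * lam 16 * b 1 1 - κ (10 / 9) * lam 14 * b 1 3 - 4 * lam 18 ∧
    field12 (b 1 7) =
      κ (1 / 2) * odd1 (odd5 (p 7 7)) - κ (1 / 2) * b 1 5 * p 7 7 - κ (1 / 2) * b 1 7 * p 5 7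
      + 2 * lam 18 * b 1 1 + lam 16 * b 1 3 - κ (14 / 9) * lam 14 * b 1 5 + lam 12 * b 1 7 := by
  refine ⟨?_, ?_, ?_, ?_⟩ <;>
  · refine poly_ext fun x => ?_
    simp only [vf_expand, field12_b_one, odd1_b, odd3_b, odd5_b, odd7_b, p, p33, p35, p37, p55,
      p57, p77, lam, polyVal_expand x]
    ring1

/-! ### The recursion for `D₁₄` -/

/-- The field `D_{14}`. -/
noncomputable def field14 : BField :=
    (1 / 20 : ℂ) • ((2 : ℂ) • ⁅field2, field12⁆ + p' 5 7 • odd1 - b 2 7 • odd5 - b 2 5 • odd7)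
    - (4 / 45 : ℂ) • (lam 14 • euler - lam 4 • field10)

theorem field14_projects : Projects field14 (base 7) := by
  have hl : lam 14 = rhoPullback (lamVar 14) := rhoPullback_lamVar.2.2.2.2.2.1.symm
  have h4 : lam 4 = rhoPullback (lamVar 4) := rhoPullback_lamVar.1.symm
  rw [field14, hl, h4]
  refine ((((((((field2_projects.lie field12_projects).scalar_smul _).add (odd1_projects.smul_zero
    _)).sub (odd5_projects.smul_zero _)).sub (odd7_projects.smul_zero _))).scalar_smul _).sub
    (((euler_projects.smul _).sub (field10_projects.smul _)).scalar_smul _)).congr ?_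
  rw [lie_base (by norm_num) (by norm_num), baseSum]
  refine base_ext ⟨?_, ?_, ?_, ?_, ?_, ?_, ?_, ?_⟩ <;>
  · refine poly_ext fun x => ?_
    simp only [structUpper, structCoef, Nat.reduceAdd, Nat.reduceLeDiff, Nat.reduceEqDiff,
      Nat.reduceSub, Nat.reduceMul, if_true, if_false, lamVar_const, vf_expand, Nat.cast_ofNat,
      Nat.cast_one, Nat.cast_zero, polyVal_expand x]
    ring1

theorem lie_odd1_field14 : ⁅odd1, field14⁆ = oddSum (M1 6) := by
  refine field_ext fun f => poly_ext fun x => ?_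
  simp only [field14, p'_eq, vf_lie_apply, oddSum, vf_expand, field2_odd.apply, field10_odd.apply,
    field12_odd.apply, odd_euler, odd_comm, odd1_lam, field2_b_one_p, field12_b_one_p, odd1_b,
    fieldOdd_b_one_p, M1, M3, M5, M7, e3, e57, Matrix.of_apply, Matrix.cons_val, polyVal_expand x]
  ring1

theorem field14_b_one :
    field14 (b 1 1) =
      κ (4 / 9) * b 1 1 * b 1 5 * b 1 7 - κ (5 / 9) * b 1 5 * b 3 7 - κ (8 / 9) * b 1 7 ^ 2
      + κ (4 / 9) * b 1 7 * b 3 5 + κ (1 / 18) * b 2 5 * b 2 7 ∧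
    field14 (b 1 3) =
      -(κ (4 / 3) * b 1 1 ^ 2 * b 1 5 * b 1 7) + κ (2 / 3) * b 1 1 * b 1 5 * b 3 7
      - κ (46 / 3) * b 1 1 * b 1 7 ^ 2 - κ (1 / 3) * b 1 1 * b 1 7 * b 3 5
      - κ (1 / 6) * b 1 1 * b 2 5 * b 2 7 - κ (1 / 2) * b 1 5 * b 2 1 * b 2 7
      + κ (1 / 2) * b 1 7 * b 2 1 * b 2 5 + 4 * b 1 7 * b 3 7 - 2 * b 2 7 ^ 2 ∧
    field14 (b 1 5) =
      12 * b 1 1 ^ 2 * b 1 7 ^ 2 - κ (20 / 9) * b 1 1 * b 1 3 * b 1 5 * b 1 7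
      - 3 * b 1 1 * b 1 7 * b 3 7 + κ (3 / 2) * b 1 1 * b 2 7 ^ 2
      + κ (7 / 9) * b 1 3 * b 1 5 * b 3 7 + κ (4 / 9) * b 1 3 * b 1 7 ^ 2
      - κ (2 / 9) * b 1 3 * b 1 7 * b 3 5 - κ (5 / 18) * b 1 3 * b 2 5 * b 2 7
      - κ (1 / 2) * b 1 5 * b 2 3 * b 2 7 + κ (1 / 2) * b 1 7 * b 2 3 * b 2 5 ∧
    field14 (b 1 7) =
      8 * b 1 1 * b 1 3 * b 1 7 ^ 2 - κ (28 / 9) * b 1 1 * b 1 5 ^ 2 * b 1 7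
      - 2 * b 1 3 * b 1 7 * b 3 7 + b 1 3 * b 2 7 ^ 2 + κ (8 / 9) * b 1 5 ^ 2 * b 3 7
      + κ (2 / 9) * b 1 5 * b 1 7 ^ 2 - κ (1 / 9) * b 1 5 * b 1 7 * b 3 5
      - κ (8 / 9) * b 1 5 * b 2 5 * b 2 7 + κ (1 / 2) * b 1 7 * b 2 5 ^ 2 := by
  refine ⟨?_, ?_, ?_, ?_⟩ <;>
  · refine poly_ext fun x => ?_
    simp only [field14, p'_eq, vf_lie_apply, vf_expand, field2_b_one, field2_b_two,
      field2_b_three, field10_b_one, field10_b_two, field10_b_three, field12_b_one, field12_b_two,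
      field12_b_three, euler_b, odd1_b, odd3_b, odd5_b, odd7_b, p, p33, p35, p37, p55, p57, p77,
      lam, polyVal_expand x]
    ring1

theorem field14_b_two :
    field14 (b 2 1) =
      -(4 * b 1 1 * b 1 5 * b 2 7) + 4 * b 1 1 * b 1 7 * b 2 5 - b 1 7 * b 2 7
      - κ (1 / 2) * b 2 5 * b 3 7 + κ (1 / 2) * b 2 7 * b 3 5 ∧
    field14 (b 2 3) =
      4 * b 1 1 ^ 2 * b 1 5 * b 2 7 - 4 * b 1 1 ^ 2 * b 1 7 * b 2 5
      - κ (4 / 3) * b 1 1 * b 1 5 * b 1 7 * b 2 1 + b 1 1 * b 1 7 * b 2 7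
      + κ (1 / 2) * b 1 1 * b 2 5 * b 3 7 - κ (1 / 2) * b 1 1 * b 2 7 * b 3 5
      + κ (1 / 6) * b 1 5 * b 2 1 * b 3 7 - κ (1 / 2) * b 1 5 * b 2 7 * b 3 1
      - κ (1 / 3) * b 1 7 ^ 2 * b 2 1 + κ (1 / 6) * b 1 7 * b 2 1 * b 3 5
      + κ (1 / 2) * b 1 7 * b 2 5 * b 3 1 - κ (1 / 6) * b 2 1 * b 2 5 * b 2 7 ∧
    field14 (b 2 5) =
      4 * b 1 1 * b 1 3 * b 1 5 * b 2 7 - 4 * b 1 1 * b 1 3 * b 1 7 * b 2 5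
      - κ (20 / 9) * b 1 1 * b 1 5 * b 1 7 * b 2 3 + 12 * b 1 1 * b 1 7 ^ 2 * b 2 1
      + b 1 3 * b 1 7 * b 2 7 + κ (1 / 2) * b 1 3 * b 2 5 * b 3 7
      - κ (1 / 2) * b 1 3 * b 2 7 * b 3 5 + κ (5 / 18) * b 1 5 * b 2 3 * b 3 7
      - κ (1 / 2) * b 1 5 * b 2 7 * b 3 3 - κ (5 / 9) * b 1 7 ^ 2 * b 2 3
      - 3 * b 1 7 * b 2 1 * b 3 7 + κ (5 / 18) * b 1 7 * b 2 3 * b 3 5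
      + κ (1 / 2) * b 1 7 * b 2 5 * b 3 3 + κ (3 / 2) * b 2 1 * b 2 7 ^ 2
      - κ (5 / 18) * b 2 3 * b 2 5 * b 2 7 ∧
    field14 (b 2 7) =
      4 * b 1 1 * b 1 5 ^ 2 * b 2 7 - κ (64 / 9) * b 1 1 * b 1 5 * b 1 7 * b 2 5
      + 8 * b 1 1 * b 1 7 ^ 2 * b 2 3 + b 1 5 * b 1 7 * b 2 7 + κ (8 / 9) * b 1 5 * b 2 5 * b 3 7
      - b 1 5 * b 2 7 * b 3 5 - κ (7 / 9) * b 1 7 ^ 2 * b 2 5 - 2 * b 1 7 * b 2 3 * b 3 7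
      + κ (8 / 9) * b 1 7 * b 2 5 * b 3 5 + b 2 3 * b 2 7 ^ 2 - κ (7 / 18) * b 2 5 ^ 2 * b 2 7 := by
  simp only [apply_b_two lie_odd1_field14, field14_b_one]
  refine ⟨?_, ?_, ?_, ?_⟩ <;>
  · refine poly_ext fun x => ?_
    simp only [oddSum, vf_expand, odd1_b, odd3_b, odd5_b, odd7_b, M1, M3, M5, M7, e3, e57,
      Matrix.of_apply, Matrix.cons_val, polyVal_expand x]
    ring1

theorem field14_b_three :
    field14 (b 3 1) =
      -(4 * b 1 1 * b 1 5 * b 3 7) + 4 * b 1 1 * b 1 7 * b 3 5 - 2 * b 1 5 * b 2 1 * b 2 7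
      + 2 * b 1 7 * b 2 1 * b 2 5 - 2 * b 1 7 * b 3 7 + b 2 7 ^ 2 ∧
    field14 (b 3 3) =
      4 * b 1 1 ^ 2 * b 1 5 * b 3 7 - 4 * b 1 1 ^ 2 * b 1 7 * b 3 5
      - κ (4 / 3) * b 1 1 * b 1 5 * b 1 7 * b 3 1 + 2 * b 1 1 * b 1 7 * b 3 7 - b 1 1 * b 2 7 ^ 2
      - 2 * b 1 5 * b 2 3 * b 2 7 - κ (1 / 3) * b 1 5 * b 3 1 * b 3 7
      - κ (4 / 3) * b 1 7 ^ 2 * b 3 1 + b 1 7 * b 2 1 * b 2 7 + 2 * b 1 7 * b 2 3 * b 2 5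
      + κ (2 / 3) * b 1 7 * b 3 1 * b 3 5 + κ (1 / 2) * b 2 1 * b 2 5 * b 3 7
      - κ (1 / 2) * b 2 1 * b 2 7 * b 3 5 - κ (1 / 6) * b 2 5 * b 2 7 * b 3 1 ∧
    field14 (b 3 5) =
      4 * b 1 1 * b 1 3 * b 1 5 * b 3 7 - 4 * b 1 1 * b 1 3 * b 1 7 * b 3 5
      - κ (20 / 9) * b 1 1 * b 1 5 * b 1 7 * b 3 3 + 12 * b 1 1 * b 1 7 ^ 2 * b 3 1
      + 2 * b 1 3 * b 1 7 * b 3 7 - b 1 3 * b 2 7 ^ 2 - 2 * b 1 5 * b 2 5 * b 2 7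
      - κ (2 / 9) * b 1 5 * b 3 3 * b 3 7 - κ (14 / 9) * b 1 7 ^ 2 * b 3 3 + b 1 7 * b 2 3 * b 2 7
      + 2 * b 1 7 * b 2 5 ^ 2 - 3 * b 1 7 * b 3 1 * b 3 7 + κ (7 / 9) * b 1 7 * b 3 3 * b 3 5
      + κ (1 / 2) * b 2 3 * b 2 5 * b 3 7 - κ (1 / 2) * b 2 3 * b 2 7 * b 3 5
      - κ (5 / 18) * b 2 5 * b 2 7 * b 3 3 + κ (3 / 2) * b 2 7 ^ 2 * b 3 1 ∧
    field14 (b 3 7) =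
      4 * b 1 1 * b 1 5 ^ 2 * b 3 7 - κ (64 / 9) * b 1 1 * b 1 5 * b 1 7 * b 3 5
      + 8 * b 1 1 * b 1 7 ^ 2 * b 3 3 + 2 * b 1 5 * b 1 7 * b 3 7 - 3 * b 1 5 * b 2 7 ^ 2
      - κ (1 / 9) * b 1 5 * b 3 5 * b 3 7 - κ (16 / 9) * b 1 7 ^ 2 * b 3 5
      + 3 * b 1 7 * b 2 5 * b 2 7 - 2 * b 1 7 * b 3 3 * b 3 7 + κ (8 / 9) * b 1 7 * b 3 5 ^ 2
      + κ (1 / 2) * b 2 5 ^ 2 * b 3 7 - κ (8 / 9) * b 2 5 * b 2 7 * b 3 5 + b 2 7 ^ 2 * b 3 3 := by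
  simp only [apply_b_three lie_odd1_field14, field14_b_two]
  refine ⟨?_, ?_, ?_, ?_⟩ <;>
  · refine poly_ext fun x => ?_
    simp only [oddSum, vf_expand, odd1_b, odd3_b, odd5_b, odd7_b, M1, M3, M5, M7, e3, e57,
      Matrix.of_apply, Matrix.cons_val, polyVal_expand x]
    ring1

theorem field14_odd : OddRelations field14 6 := by
  refine .of_projects field14_projects lie_odd1_field14 ?_ ?_ ?_ <;>
  · refine poly_ext fun x => ?_
    simp only [oddSum, vf_expand, field14_b_one, field14_b_two, odd1_b, odd3_b, odd5_b, odd7_b,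
      M1, M3, M5, M7, e3, e57, Matrix.of_apply, Matrix.cons_val, p, p33, p35, p37, p55, p57, p77,
      lam, polyVal_expand x]
    ring1

/-- The values of `field14` on `b_{1,j}` in terms of the polynomials `p_{k,l}`. -/
theorem field14_b_one_p :
    field14 (b 1 1) =
      κ (1 / 4) * odd1 (odd1 (p 7 7)) - b 1 7 * b 1 7 + κ (1 / 9) * lam 16 ∧
    field14 (b 1 3) =
      κ (1 / 4) * odd1 (odd3 (p 7 7)) - κ (1 / 2) * b 1 7 * p 3 7 - κ (1 / 3) * lam 16 * b 1 1
      - 6 * lam 18 ∧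
    field14 (b 1 5) =
      κ (1 / 4) * odd1 (odd5 (p 7 7)) - κ (1 / 2) * b 1 7 * p 5 7 + 4 * lam 18 * b 1 1
      - κ (5 / 9) * lam 16 * b 1 3 ∧
    field14 (b 1 7) =
      κ (1 / 4) * odd1 (odd7 (p 7 7)) - κ (1 / 2) * b 1 7 * p 7 7 + 2 * lam 18 * b 1 3
      - κ (7 / 9) * lam 16 * b 1 5 := by
  refine ⟨?_, ?_, ?_, ?_⟩ <;>
  · refine poly_ext fun x => ?_
    simp only [vf_expand, field14_b_one, odd1_b, odd3_b, odd5_b, odd7_b, p, p33, p35, p37, p55,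
      p57, p77, lam, polyVal_expand x]
    ring1

/-! ### Brackets of two even fields by rigidity -/

/-- The combination of the even fields with given coefficients. -/
noncomputable def evenSum (a : ℕ → ParamRing) : BField :=
  rhoPullback (a 0) • euler + rhoPullback (a 1) • field2 + rhoPullback (a 2) • field4 +
    rhoPullback (a 3) • field6 + rhoPullback (a 4) • field8 + rhoPullback (a 5) • field10 +
    rhoPullback (a 6) • field12 + rhoPullback (a 7) • field14

theorem evenSum_projects (a : ℕ → ParamRing) : Projects (evenSum a) (baseSum a) :=
  (((((((euler_projects.smul _).add (field2_projects.smul _)).add (field4_projects.smul _)).add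
    (field6_projects.smul _)).add (field8_projects.smul _)).add (field10_projects.smul _)).add
    (field12_projects.smul _)).add (field14_projects.smul _)

/-- The polynomials `D_i (p_{j,k})` for odd `i`. -/
noncomputable def oddQ : ℕ → ℕ → ℕ → BRing
  | 1, j, k => odd1 (p j k)
  | 3, j, k => odd3 (p j k)
  | 5, j, k => odd5 (p j k)
  | 7, j, k => odd7 (p j k)
  | _, _, _ => 0

/-- A criterion for the commutation relation of two even fields. -/
theorem lie_even_eq {U W V : BField} {i j : ℕ} {c : ℂ} {r : Fin 4 → BRing}
    (hU : Projects U (base i)) (hW : Projects W (base j)) (hij : i < j) (hj : j < 8)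
    (hV : V = evenSum (structUpper i j) + c • oddSum r)
    (h : ∀ f, odd1 (U (W f) - W (U f)) - (U (W (odd1 f)) - W (U (odd1 f))) =
      odd1 (V f) - V (odd1 f))
    (h11 : U (W (b 1 1)) - W (U (b 1 1)) = V (b 1 1)) :
    ⁅U, W⁆ = V := by
  refine vf_eq_of_projects (hU.lie hW) (M := ⁅base i, base j⁆) ?_ (fun f => ?_) ?_
  -- The coefficients of the even part are those of the base relation and the odd part is vertical,
  -- so both sides project to `⁅base i, base j⁆`.
  · rw [lie_base hij hj, hV]
    simpa only [smul_zero, add_zero] using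
      (evenSum_projects _).add ((oddSum_projects r).scalar_smul c)
  · simpa only [vf_lie_apply] using h f
  · rw [vf_lie_apply, h11]

/-- The one bracket with `D₂` that no recursion formula contains: the sequence of fields stops at
`D₁₄`, so this is a closing condition and needs proof. -/
theorem lie_field2_field14 : ⁅field2, field14⁆ =
    evenSum (structUpper 1 7) + (1 / 2 : ℂ) • oddSum (A2 5) := by
  refine lie_even_eq field2_projects field14_projects (by norm_num) (by norm_num) rfl
    (fun f => poly_ext fun x => ?_) (poly_ext fun x => ?_) <;>
  simp only [evenSum, structUpper, structCoef, Nat.reduceAdd, Nat.reduceLeDiff, Nat.reduceEqDiff,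
    Nat.reduceSub, Nat.reduceMul, if_true, if_false, lamVar_const, C_0, zero_mul, mul_zero,
    map_zero,
    zero_smul, zero_add, add_zero, Nat.cast_ofNat, Nat.cast_one, Nat.cast_zero, A2, p'_eq]
  -- Bracket with `odd1`: both sides are brought to normal form as operators on `f`. The symmetry
  -- `odd_p_symm` identifies the different expressions of the same `D_i(p_{j,k})`.
  · simp only [oddSum, vf_expand, rhoPullback_expand, rhoPullback_lamVar, p_one, field2_odd.apply,
      field12_odd.apply, field14_odd.apply, odd_euler, odd_comm, odd1_lam, field2_b_one_p,
      field14_b_one_p, odd1_b, fieldOdd_b_one_p, odd_p_symm, M1, M3, M5, M7, e3, e57,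
      Matrix.of_apply, Matrix.cons_val, polyVal_expand x]
    ring1
  -- Value on `b₁₁`: an identity between explicit polynomials in the twelve coordinates.
  · simp only [oddSum, vf_expand, rhoPullback_expand, rhoPullback_lamVar, euler_b, field2_b_one,
      field2_b_two, field2_b_three, field12_b_one, field12_b_two, field12_b_three, field14_b_one,
      field14_b_two, field14_b_three, odd1_b, odd3_b, odd5_b, odd7_b, p, p33, p35, p37, p55, p57,
      p77, lam, Matrix.of_apply, Matrix.cons_val, polyVal_expand x]
    ring1

/-- The pattern of all fifteen relations: the pushforward is handled by `lie_even_eq`, the first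
goal is Jacobi on an arbitrary `f`, the second the value on `b₁₁`. Only the even fields with nonzero
coefficient enter, besides the two bracketed ones and `D₂`, whose value occurs through `[D₁, D₄]` or
the right-hand side. -/
theorem lie_field4_field6 : ⁅field4, field6⁆ =
    evenSum (structUpper 2 3) + (1 / 4 : ℂ) • oddSum (fourA oddQ 4 6) := by
  refine lie_even_eq field4_projects field6_projects (by norm_num) (by norm_num) rfl
    (fun f => poly_ext fun x => ?_) (poly_ext fun x => ?_) <;>
  simp only [evenSum, structUpper, structCoef, Nat.reduceAdd, Nat.reduceLeDiff, Nat.reduceEqDiff,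
    Nat.reduceSub, Nat.reduceMul, if_true, if_false, lamVar_const, C_0, zero_mul, mul_zero,
    map_zero,
    zero_smul, zero_add, add_zero, Nat.cast_ofNat, Nat.cast_one, Nat.cast_zero, fourA, oddQ]
  · simp only [oddSum, vf_expand, rhoPullback_expand, rhoPullback_lamVar, p_one, field2_odd.apply,
      field4_odd.apply, field6_odd.apply, field10_odd.apply, odd_euler, odd_comm, odd1_lam,
      field4_b_one_p, field6_b_one_p, odd1_b, fieldOdd_b_one_p, odd_p_symm, M1, M3, M5, M7, e3, e57,
      Matrix.of_apply, Matrix.cons_val, polyVal_expand x]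
    ring1
  · simp only [oddSum, vf_expand, rhoPullback_expand, rhoPullback_lamVar, euler_b, field2_b_one,
      field2_b_two, field2_b_three, field4_b_one, field4_b_two, field4_b_three, field6_b_one,
      field6_b_two, field6_b_three, field10_b_one, field10_b_two, field10_b_three, odd1_b, odd3_b,
      odd5_b, odd7_b, p, p33, p35, p37, p55, p57, p77, lam, Matrix.cons_val, polyVal_expand x]
    ring1

theorem lie_field4_field8 : ⁅field4, field8⁆ =
    evenSum (structUpper 2 4) + (1 / 4 : ℂ) • oddSum (fourA oddQ 4 8) := by
  refine lie_even_eq field4_projects field8_projects (by norm_num) (by norm_num) rfl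
    (fun f => poly_ext fun x => ?_) (poly_ext fun x => ?_) <;>
  simp only [evenSum, structUpper, structCoef, Nat.reduceAdd, Nat.reduceLeDiff, Nat.reduceEqDiff,
    Nat.reduceSub, Nat.reduceMul, if_true, if_false, lamVar_const, C_0, zero_mul, mul_zero,
    map_zero,
    zero_smul, zero_add, add_zero, Nat.cast_ofNat, Nat.cast_one, Nat.cast_zero, fourA, oddQ]
  · simp only [oddSum, vf_expand, rhoPullback_expand, rhoPullback_lamVar, p_one, field2_odd.apply,
      field4_odd.apply, field6_odd.apply, field8_odd.apply, field12_odd.apply, odd_euler, odd_comm,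
      odd1_lam, field4_b_one_p, field8_b_one_p, odd1_b, fieldOdd_b_one_p, odd_p_symm, M1, M3, M5,
      M7, e3, e57, Matrix.of_apply, Matrix.cons_val, polyVal_expand x]
    ring1
  · simp only [oddSum, vf_expand, rhoPullback_expand, rhoPullback_lamVar, euler_b, field2_b_one,
      field2_b_two, field2_b_three, field4_b_one, field4_b_two, field4_b_three, field6_b_one,
      field6_b_two, field6_b_three, field8_b_one, field8_b_two, field8_b_three, field12_b_one,
      field12_b_two, field12_b_three, odd1_b, odd3_b, odd5_b, odd7_b, p, p33, p35, p37, p55, p57,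
      p77, lam, Matrix.cons_val, polyVal_expand x]
    ring1

theorem lie_field4_field10 : ⁅field4, field10⁆ =
    evenSum (structUpper 2 5) + (1 / 4 : ℂ) • oddSum (fourA oddQ 4 10) := by
  refine lie_even_eq field4_projects field10_projects (by norm_num) (by norm_num) rfl
    (fun f => poly_ext fun x => ?_) (poly_ext fun x => ?_) <;>
  simp only [evenSum, structUpper, structCoef, Nat.reduceAdd, Nat.reduceLeDiff, Nat.reduceEqDiff,
    Nat.reduceSub, Nat.reduceMul, if_true, if_false, lamVar_const, C_0, zero_mul, mul_zero,
    map_zero,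
    zero_smul, zero_add, add_zero, Nat.cast_ofNat, Nat.cast_one, Nat.cast_zero, fourA, oddQ]
  · simp only [oddSum, vf_expand, rhoPullback_expand, rhoPullback_lamVar, p_one, field2_odd.apply,
      field4_odd.apply, field8_odd.apply, field10_odd.apply, field14_odd.apply, odd_euler, odd_comm,
      odd1_lam, field4_b_one_p, field10_b_one_p, odd1_b, fieldOdd_b_one_p, odd_p_symm, M1, M3, M5,
      M7, e3, e57, Matrix.of_apply, Matrix.cons_val, polyVal_expand x]
    ring1
  · simp only [oddSum, vf_expand, rhoPullback_expand, rhoPullback_lamVar, euler_b, field2_b_one,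
      field2_b_two, field2_b_three, field4_b_one, field4_b_two, field4_b_three, field8_b_one,
      field8_b_two, field8_b_three, field10_b_one, field10_b_two, field10_b_three, field14_b_one,
      field14_b_two, field14_b_three, odd1_b, odd3_b, odd5_b, odd7_b, p, p33, p35, p37, p55, p57,
      p77, lam, Matrix.cons_val, polyVal_expand x]
    ring1

theorem lie_field4_field12 : ⁅field4, field12⁆ =
    evenSum (structUpper 2 6) + (1 / 4 : ℂ) • oddSum (fourA oddQ 4 12) := by
  refine lie_even_eq field4_projects field12_projects (by norm_num) (by norm_num) rfl
    (fun f => poly_ext fun x => ?_) (poly_ext fun x => ?_) <;>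
  simp only [evenSum, structUpper, structCoef, Nat.reduceAdd, Nat.reduceLeDiff, Nat.reduceEqDiff,
    Nat.reduceSub, Nat.reduceMul, if_true, if_false, lamVar_const, C_0, zero_mul, mul_zero,
    map_zero,
    zero_smul, zero_add, add_zero, Nat.cast_ofNat, Nat.cast_one, Nat.cast_zero, fourA, oddQ]
  · simp only [oddSum, vf_expand, rhoPullback_expand, rhoPullback_lamVar, p_one, field2_odd.apply,
      field4_odd.apply, field10_odd.apply, field12_odd.apply, odd_euler, odd_comm, odd1_lam,
      field4_b_one_p, field12_b_one_p, odd1_b, fieldOdd_b_one_p, odd_p_symm, M1, M3, M5, M7, e3,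
      e57, Matrix.of_apply, Matrix.cons_val, polyVal_expand x]
    ring1
  · simp only [oddSum, vf_expand, rhoPullback_expand, rhoPullback_lamVar, euler_b, field2_b_one,
      field2_b_two, field2_b_three, field4_b_one, field4_b_two, field4_b_three, field10_b_one,
      field10_b_two, field10_b_three, field12_b_one, field12_b_two, field12_b_three, odd1_b, odd3_b,
      odd5_b, odd7_b, p, p33, p35, p37, p55, p57, p77, lam, Matrix.cons_val, polyVal_expand x]
    ring1

theorem lie_field4_field14 : ⁅field4, field14⁆ =
    evenSum (structUpper 2 7) + (1 / 4 : ℂ) • oddSum (fourA oddQ 4 14) := by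
  refine lie_even_eq field4_projects field14_projects (by norm_num) (by norm_num) rfl
    (fun f => poly_ext fun x => ?_) (poly_ext fun x => ?_) <;>
  simp only [evenSum, structUpper, structCoef, Nat.reduceAdd, Nat.reduceLeDiff, Nat.reduceEqDiff,
    Nat.reduceSub, Nat.reduceMul, if_true, if_false, lamVar_const, C_0, zero_mul, mul_zero,
    map_zero,
    zero_smul, zero_add, add_zero, Nat.cast_ofNat, Nat.cast_one, Nat.cast_zero, fourA, oddQ]
  · simp only [oddSum, vf_expand, rhoPullback_expand, rhoPullback_lamVar, p_one, field2_odd.apply,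
      field4_odd.apply, field12_odd.apply, field14_odd.apply, odd_euler, odd_comm, odd1_lam,
      field4_b_one_p, field14_b_one_p, odd1_b, fieldOdd_b_one_p, odd_p_symm, M1, M3, M5, M7, e3,
      e57, Matrix.of_apply, Matrix.cons_val, polyVal_expand x]
    ring1
  · simp only [oddSum, vf_expand, rhoPullback_expand, rhoPullback_lamVar, euler_b, field2_b_one,
      field2_b_two, field2_b_three, field4_b_one, field4_b_two, field4_b_three, field12_b_one,
      field12_b_two, field12_b_three, field14_b_one, field14_b_two, field14_b_three, odd1_b, odd3_b,
      odd5_b, odd7_b, p, p33, p35, p37, p55, p57, p77, lam, Matrix.cons_val, polyVal_expand x]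
    ring1

theorem lie_field6_field8 : ⁅field6, field8⁆ =
    evenSum (structUpper 3 4) + (1 / 4 : ℂ) • oddSum (fourA oddQ 6 8) := by
  refine lie_even_eq field6_projects field8_projects (by norm_num) (by norm_num) rfl
    (fun f => poly_ext fun x => ?_) (poly_ext fun x => ?_) <;>
  simp only [evenSum, structUpper, structCoef, Nat.reduceAdd, Nat.reduceLeDiff, Nat.reduceEqDiff,
    Nat.reduceSub, Nat.reduceMul, if_true, if_false, lamVar_const, C_0, zero_mul, mul_zero,
    map_zero,
    zero_smul, zero_add, add_zero, Nat.cast_ofNat, Nat.cast_one, Nat.cast_zero, fourA, oddQ]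
  · simp only [oddSum, vf_expand, rhoPullback_expand, rhoPullback_lamVar, p_one, field2_odd.apply,
      field4_odd.apply, field6_odd.apply, field8_odd.apply, field10_odd.apply, field14_odd.apply,
      odd_euler, odd_comm, odd1_lam, field6_b_one_p, field8_b_one_p, odd1_b, fieldOdd_b_one_p,
      odd_p_symm, M1, M3, M5, M7, e3, e57, Matrix.of_apply, Matrix.cons_val, polyVal_expand x]
    ring1
  · simp only [oddSum, vf_expand, rhoPullback_expand, rhoPullback_lamVar, euler_b, field2_b_one,
      field2_b_two, field2_b_three, field4_b_one, field4_b_two, field4_b_three, field6_b_one,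
      field6_b_two, field6_b_three, field8_b_one, field8_b_two, field8_b_three, field10_b_one,
      field10_b_two, field10_b_three, field14_b_one, field14_b_two, field14_b_three, odd1_b, odd3_b,
      odd5_b, odd7_b, p, p33, p35, p37, p55, p57, p77, lam, Matrix.cons_val, polyVal_expand x]
    ring1

theorem lie_field6_field10 : ⁅field6, field10⁆ =
    evenSum (structUpper 3 5) + (1 / 4 : ℂ) • oddSum (fourA oddQ 6 10) := by
  refine lie_even_eq field6_projects field10_projects (by norm_num) (by norm_num) rfl
    (fun f => poly_ext fun x => ?_) (poly_ext fun x => ?_) <;>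
  simp only [evenSum, structUpper, structCoef, Nat.reduceAdd, Nat.reduceLeDiff, Nat.reduceEqDiff,
    Nat.reduceSub, Nat.reduceMul, if_true, if_false, lamVar_const, C_0, zero_mul, mul_zero,
    map_zero,
    zero_smul, zero_add, add_zero, Nat.cast_ofNat, Nat.cast_one, Nat.cast_zero, fourA, oddQ]
  · simp only [oddSum, vf_expand, rhoPullback_expand, rhoPullback_lamVar, p_one, field2_odd.apply,
      field4_odd.apply, field6_odd.apply, field8_odd.apply, field10_odd.apply, field12_odd.apply,
      odd_euler, odd_comm, odd1_lam, field6_b_one_p, field10_b_one_p, odd1_b, fieldOdd_b_one_p,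
      odd_p_symm, M1, M3, M5, M7, e3, e57, Matrix.of_apply, Matrix.cons_val, polyVal_expand x]
    ring1
  · simp only [oddSum, vf_expand, rhoPullback_expand, rhoPullback_lamVar, euler_b, field2_b_one,
      field2_b_two, field2_b_three, field4_b_one, field4_b_two, field4_b_three, field6_b_one,
      field6_b_two, field6_b_three, field8_b_one, field8_b_two, field8_b_three, field10_b_one,
      field10_b_two, field10_b_three, field12_b_one, field12_b_two, field12_b_three, odd1_b, odd3_b,
      odd5_b, odd7_b, p, p33, p35, p37, p55, p57, p77, lam, Matrix.cons_val, polyVal_expand x]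
    ring1

theorem lie_field6_field12 : ⁅field6, field12⁆ =
    evenSum (structUpper 3 6) + (1 / 4 : ℂ) • oddSum (fourA oddQ 6 12) := by
  refine lie_even_eq field6_projects field12_projects (by norm_num) (by norm_num) rfl
    (fun f => poly_ext fun x => ?_) (poly_ext fun x => ?_) <;>
  simp only [evenSum, structUpper, structCoef, Nat.reduceAdd, Nat.reduceLeDiff, Nat.reduceEqDiff,
    Nat.reduceSub, Nat.reduceMul, if_true, if_false, lamVar_const, C_0, zero_mul, mul_zero,
    map_zero,
    zero_smul, zero_add, add_zero, Nat.cast_ofNat, Nat.cast_one, Nat.cast_zero, fourA, oddQ]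
  · simp only [oddSum, vf_expand, rhoPullback_expand, rhoPullback_lamVar, p_one, field2_odd.apply,
      field4_odd.apply, field6_odd.apply, field10_odd.apply, field12_odd.apply, field14_odd.apply,
      odd_euler, odd_comm, odd1_lam, field6_b_one_p, field12_b_one_p, odd1_b, fieldOdd_b_one_p,
      odd_p_symm, M1, M3, M5, M7, e3, e57, Matrix.of_apply, Matrix.cons_val, polyVal_expand x]
    ring1
  · simp only [oddSum, vf_expand, rhoPullback_expand, rhoPullback_lamVar, euler_b, field2_b_one,
      field2_b_two, field2_b_three, field4_b_one, field4_b_two, field4_b_three, field6_b_one,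
      field6_b_two, field6_b_three, field10_b_one, field10_b_two, field10_b_three, field12_b_one,
      field12_b_two, field12_b_three, field14_b_one, field14_b_two, field14_b_three, odd1_b, odd3_b,
      odd5_b, odd7_b, p, p33, p35, p37, p55, p57, p77, lam, Matrix.cons_val, polyVal_expand x]
    ring1

/-- From total index `3 + 7` on, the coefficient of `D₀` is a multiple of `λ_s` with `s ≥ 20` and
vanishes; the rules for the Euler field are no longer used. -/
theorem lie_field6_field14 : ⁅field6, field14⁆ =
    evenSum (structUpper 3 7) + (1 / 4 : ℂ) • oddSum (fourA oddQ 6 14) := by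
  refine lie_even_eq field6_projects field14_projects (by norm_num) (by norm_num) rfl
    (fun f => poly_ext fun x => ?_) (poly_ext fun x => ?_) <;>
  simp only [evenSum, structUpper, structCoef, Nat.reduceAdd, Nat.reduceLeDiff, Nat.reduceEqDiff,
    Nat.reduceSub, Nat.reduceMul, if_true, if_false, lamVar_const, C_0, zero_mul, mul_zero,
    map_zero,
    zero_smul, zero_add, add_zero, Nat.cast_ofNat, Nat.cast_one, Nat.cast_zero, fourA, oddQ]
  · simp only [oddSum, vf_expand, rhoPullback_expand, rhoPullback_lamVar, p_one, field2_odd.apply,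
      field4_odd.apply, field6_odd.apply, field12_odd.apply, field14_odd.apply, odd_comm, odd1_lam,
      field6_b_one_p, field14_b_one_p, odd1_b, fieldOdd_b_one_p, odd_p_symm, M1, M3, M5, M7, e3,
      e57, Matrix.of_apply, Matrix.cons_val, polyVal_expand x]
    ring1
  · simp only [oddSum, vf_expand, rhoPullback_expand, rhoPullback_lamVar, field2_b_one,
      field2_b_two, field2_b_three, field4_b_one, field4_b_two, field4_b_three, field6_b_one,
      field6_b_two, field6_b_three, field12_b_one, field12_b_two, field12_b_three, field14_b_one,
      field14_b_two, field14_b_three, odd1_b, odd3_b, odd5_b, odd7_b, p, p33, p35, p37, p55, p57,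
      p77, lam, Matrix.cons_val, polyVal_expand x]
    ring1

theorem lie_field8_field10 : ⁅field8, field10⁆ =
    evenSum (structUpper 4 5) + (1 / 4 : ℂ) • oddSum (fourA oddQ 8 10) := by
  refine lie_even_eq field8_projects field10_projects (by norm_num) (by norm_num) rfl
    (fun f => poly_ext fun x => ?_) (poly_ext fun x => ?_) <;>
  simp only [evenSum, structUpper, structCoef, Nat.reduceAdd, Nat.reduceLeDiff, Nat.reduceEqDiff,
    Nat.reduceSub, Nat.reduceMul, if_true, if_false, lamVar_const, C_0, zero_mul, mul_zero,
    map_zero,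
    zero_smul, zero_add, add_zero, Nat.cast_ofNat, Nat.cast_one, Nat.cast_zero, fourA, oddQ]
  · simp only [oddSum, vf_expand, rhoPullback_expand, rhoPullback_lamVar, p_one, field2_odd.apply,
      field4_odd.apply, field6_odd.apply, field8_odd.apply, field10_odd.apply, field12_odd.apply,
      field14_odd.apply, odd_euler, odd_comm, odd1_lam, field8_b_one_p, field10_b_one_p, odd1_b,
      fieldOdd_b_one_p, odd_p_symm, M1, M3, M5, M7, e3, e57, Matrix.of_apply, Matrix.cons_val,
      polyVal_expand x]
    ring1
  · simp only [oddSum, vf_expand, rhoPullback_expand, rhoPullback_lamVar, euler_b, field2_b_one,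
      field2_b_two, field2_b_three, field4_b_one, field4_b_two, field4_b_three, field6_b_one,
      field6_b_two, field6_b_three, field8_b_one, field8_b_two, field8_b_three, field10_b_one,
      field10_b_two, field10_b_three, field12_b_one, field12_b_two, field12_b_three, field14_b_one,
      field14_b_two, field14_b_three, odd1_b, odd3_b, odd5_b, odd7_b, p, p33, p35, p37, p55, p57,
      p77, lam, Matrix.cons_val, polyVal_expand x]
    ring1

theorem lie_field8_field12 : ⁅field8, field12⁆ =
    evenSum (structUpper 4 6) + (1 / 4 : ℂ) • oddSum (fourA oddQ 8 12) := by
  refine lie_even_eq field8_projects field12_projects (by norm_num) (by norm_num) rfl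
    (fun f => poly_ext fun x => ?_) (poly_ext fun x => ?_) <;>
  simp only [evenSum, structUpper, structCoef, Nat.reduceAdd, Nat.reduceLeDiff, Nat.reduceEqDiff,
    Nat.reduceSub, Nat.reduceMul, if_true, if_false, lamVar_const, C_0, zero_mul, mul_zero,
    map_zero,
    zero_smul, zero_add, add_zero, Nat.cast_ofNat, Nat.cast_one, Nat.cast_zero, fourA, oddQ]
  · simp only [oddSum, vf_expand, rhoPullback_expand, rhoPullback_lamVar, p_one, field2_odd.apply,
      field4_odd.apply, field6_odd.apply, field8_odd.apply, field10_odd.apply, field12_odd.apply,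
      field14_odd.apply, odd_comm, odd1_lam, field8_b_one_p, field12_b_one_p, odd1_b,
      fieldOdd_b_one_p, odd_p_symm, M1, M3, M5, M7, e3, e57, Matrix.of_apply, Matrix.cons_val,
      polyVal_expand x]
    ring1
  · simp only [oddSum, vf_expand, rhoPullback_expand, rhoPullback_lamVar, field2_b_one,
      field2_b_two, field2_b_three, field4_b_one, field4_b_two, field4_b_three, field6_b_one,
      field6_b_two, field6_b_three, field8_b_one, field8_b_two, field8_b_three, field10_b_one,
      field10_b_two, field10_b_three, field12_b_one, field12_b_two, field12_b_three, field14_b_one,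
      field14_b_two, field14_b_three, odd1_b, odd3_b, odd5_b, odd7_b, p, p33, p35, p37, p55, p57,
      p77, lam, Matrix.cons_val, polyVal_expand x]
    ring1

theorem lie_field8_field14 : ⁅field8, field14⁆ =
    evenSum (structUpper 4 7) + (1 / 4 : ℂ) • oddSum (fourA oddQ 8 14) := by
  refine lie_even_eq field8_projects field14_projects (by norm_num) (by norm_num) rfl
    (fun f => poly_ext fun x => ?_) (poly_ext fun x => ?_) <;>
  simp only [evenSum, structUpper, structCoef, Nat.reduceAdd, Nat.reduceLeDiff, Nat.reduceEqDiff,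
    Nat.reduceSub, Nat.reduceMul, if_true, if_false, lamVar_const, C_0, zero_mul, mul_zero,
    map_zero,
    zero_smul, zero_add, add_zero, Nat.cast_ofNat, Nat.cast_one, Nat.cast_zero, fourA, oddQ]
  · simp only [oddSum, vf_expand, rhoPullback_expand, rhoPullback_lamVar, p_one, field4_odd.apply,
      field6_odd.apply, field8_odd.apply, field12_odd.apply, field14_odd.apply, odd_comm, odd1_lam,
      field8_b_one_p, field14_b_one_p, odd1_b, fieldOdd_b_one_p, odd_p_symm, M1, M3, M5, M7, e3,
      e57, Matrix.of_apply, Matrix.cons_val, polyVal_expand x]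
    ring1
  · simp only [oddSum, vf_expand, rhoPullback_expand, rhoPullback_lamVar, field4_b_one,
      field4_b_two, field4_b_three, field6_b_one, field6_b_two, field6_b_three, field8_b_one,
      field8_b_two, field8_b_three, field12_b_one, field12_b_two, field12_b_three, field14_b_one,
      field14_b_two, field14_b_three, odd1_b, odd3_b, odd5_b, odd7_b, p, p33, p35, p37, p55, p57,
      p77, lam, Matrix.cons_val, polyVal_expand x]
    ring1

theorem lie_field10_field12 : ⁅field10, field12⁆ =
    evenSum (structUpper 5 6) + (1 / 4 : ℂ) • oddSum (fourA oddQ 10 12) := by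
  refine lie_even_eq field10_projects field12_projects (by norm_num) (by norm_num) rfl
    (fun f => poly_ext fun x => ?_) (poly_ext fun x => ?_) <;>
  simp only [evenSum, structUpper, structCoef, Nat.reduceAdd, Nat.reduceLeDiff, Nat.reduceEqDiff,
    Nat.reduceSub, Nat.reduceMul, if_true, if_false, lamVar_const, C_0, zero_mul, mul_zero,
    map_zero,
    zero_smul, zero_add, add_zero, Nat.cast_ofNat, Nat.cast_one, Nat.cast_zero, fourA, oddQ]
  · simp only [oddSum, vf_expand, rhoPullback_expand, rhoPullback_lamVar, p_one, field4_odd.apply,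
      field6_odd.apply, field8_odd.apply, field10_odd.apply, field12_odd.apply, field14_odd.apply,
      odd_comm, odd1_lam, field10_b_one_p, field12_b_one_p, odd1_b, fieldOdd_b_one_p, odd_p_symm,
      M1, M3, M5, M7, e3, e57, Matrix.of_apply, Matrix.cons_val, polyVal_expand x]
    ring1
  · simp only [oddSum, vf_expand, rhoPullback_expand, rhoPullback_lamVar, field4_b_one,
      field4_b_two, field4_b_three, field6_b_one, field6_b_two, field6_b_three, field8_b_one,
      field8_b_two, field8_b_three, field10_b_one, field10_b_two, field10_b_three, field12_b_one,
      field12_b_two, field12_b_three, field14_b_one, field14_b_two, field14_b_three, odd1_b, odd3_b,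
      odd5_b, odd7_b, p, p33, p35, p37, p55, p57, p77, lam, Matrix.cons_val, polyVal_expand x]
    ring1

theorem lie_field10_field14 : ⁅field10, field14⁆ =
    evenSum (structUpper 5 7) + (1 / 4 : ℂ) • oddSum (fourA oddQ 10 14) := by
  refine lie_even_eq field10_projects field14_projects (by norm_num) (by norm_num) rfl
    (fun f => poly_ext fun x => ?_) (poly_ext fun x => ?_) <;>
  simp only [evenSum, structUpper, structCoef, Nat.reduceAdd, Nat.reduceLeDiff, Nat.reduceEqDiff,
    Nat.reduceSub, Nat.reduceMul, if_true, if_false, lamVar_const, C_0, zero_mul, mul_zero,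
    map_zero,
    zero_smul, zero_add, add_zero, Nat.cast_ofNat, Nat.cast_one, Nat.cast_zero, fourA, oddQ]
  · simp only [oddSum, vf_expand, rhoPullback_expand, rhoPullback_lamVar, p_one, field6_odd.apply,
      field8_odd.apply, field10_odd.apply, field12_odd.apply, field14_odd.apply, odd_comm, odd1_lam,
      field10_b_one_p, field14_b_one_p, odd1_b, fieldOdd_b_one_p, odd_p_symm, M1, M3, M5, M7, e3,
      e57, Matrix.of_apply, Matrix.cons_val, polyVal_expand x]
    ring1
  · simp only [oddSum, vf_expand, rhoPullback_expand, rhoPullback_lamVar, field6_b_one,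
      field6_b_two, field6_b_three, field8_b_one, field8_b_two, field8_b_three, field10_b_one,
      field10_b_two, field10_b_three, field12_b_one, field12_b_two, field12_b_three, field14_b_one,
      field14_b_two, field14_b_three, odd1_b, odd3_b, odd5_b, odd7_b, p, p33, p35, p37, p55, p57,
      p77, lam, Matrix.cons_val, polyVal_expand x]
    ring1

/-- By weight, the coefficient of `D_{2k}` is a multiple of `λ_{26-2k}`, which is zero for `k < 4`;
only the fields from `D₈` on can occur. -/
theorem lie_field12_field14 : ⁅field12, field14⁆ =
    evenSum (structUpper 6 7) + (1 / 4 : ℂ) • oddSum (fourA oddQ 12 14) := by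
  refine lie_even_eq field12_projects field14_projects (by norm_num) (by norm_num) rfl
    (fun f => poly_ext fun x => ?_) (poly_ext fun x => ?_) <;>
  simp only [evenSum, structUpper, structCoef, Nat.reduceAdd, Nat.reduceLeDiff, Nat.reduceEqDiff,
    Nat.reduceSub, Nat.reduceMul, if_true, if_false, lamVar_const, C_0, zero_mul, mul_zero,
    map_zero,
    zero_smul, zero_add, add_zero, Nat.cast_ofNat, Nat.cast_one, Nat.cast_zero, fourA, oddQ]
  · simp only [oddSum, vf_expand, rhoPullback_expand, rhoPullback_lamVar, p_one, field8_odd.apply,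
      field10_odd.apply, field12_odd.apply, field14_odd.apply, odd_comm, odd1_lam, field12_b_one_p,
      field14_b_one_p, odd1_b, fieldOdd_b_one_p, odd_p_symm, M1, M3, M5, M7, e3, e57,
      Matrix.of_apply, Matrix.cons_val, polyVal_expand x]
    ring1
  · simp only [oddSum, vf_expand, rhoPullback_expand, rhoPullback_lamVar, field8_b_one,
      field8_b_two, field8_b_three, field10_b_one, field10_b_two, field10_b_three, field12_b_one,
      field12_b_two, field12_b_three, field14_b_one, field14_b_two, field14_b_three, odd1_b, odd3_b,
      odd5_b, odd7_b, p, p33, p35, p37, p55, p57, p77, lam, Matrix.cons_val, polyVal_expand x]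
    ring1

/-! ### Brackets with `D₂` and with the Euler field -/

/-- The definition of `D₆` solved for the bracket it contains. In this and the next four lemmas the
multiplier in `linear_combination` is `2(j - 1)`, the coefficient of the new field in `[D₂,
D_{2j}]`. -/
theorem lie_field2_field4 : ⁅field2, field4⁆ =
    evenSum (structUpper 1 2) + (1 / 2 : ℂ) • oddSum (A2 0) := by
  refine field_ext fun f => poly_ext fun x => ?_
  -- Unfolding only the left side of this trivial equation turns the recursion into a usable
  -- identity, with `field6` itself kept folded on the right.
  have h : polyVal x (field6 f) = polyVal x (field6 f) := rfl
  conv_lhs at h => rw [field6]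
  simp only [evenSum, structUpper, structCoef, Nat.reduceAdd, Nat.reduceLeDiff, Nat.reduceEqDiff,
    Nat.reduceSub, Nat.reduceMul, if_true, if_false, lamVar_const, Nat.cast_ofNat, Nat.cast_one,
    Nat.cast_zero, oddSum, A2, p'_eq, Matrix.of_apply, Matrix.cons_val, vf_expand,
    rhoPullback_expand, rhoPullback_lamVar, polyVal_expand x] at h ⊢
  linear_combination 2 * h

theorem lie_field2_field6 : ⁅field2, field6⁆ =
    evenSum (structUpper 1 3) + (1 / 2 : ℂ) • oddSum (A2 1) := by
  refine field_ext fun f => poly_ext fun x => ?_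
  have h : polyVal x (field8 f) = polyVal x (field8 f) := rfl
  conv_lhs at h => rw [field8]
  simp only [evenSum, structUpper, structCoef, Nat.reduceAdd, Nat.reduceLeDiff, Nat.reduceEqDiff,
    Nat.reduceSub, Nat.reduceMul, if_true, if_false, lamVar_const, Nat.cast_ofNat, Nat.cast_one,
    Nat.cast_zero, oddSum, A2, p'_eq, Matrix.of_apply, Matrix.cons_val, vf_expand,
    rhoPullback_expand, rhoPullback_lamVar, polyVal_expand x] at h ⊢
  linear_combination 4 * h

theorem lie_field2_field8 : ⁅field2, field8⁆ =
    evenSum (structUpper 1 4) + (1 / 2 : ℂ) • oddSum (A2 2) := by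
  refine field_ext fun f => poly_ext fun x => ?_
  have h : polyVal x (field10 f) = polyVal x (field10 f) := rfl
  conv_lhs at h => rw [field10]
  simp only [evenSum, structUpper, structCoef, Nat.reduceAdd, Nat.reduceLeDiff, Nat.reduceEqDiff,
    Nat.reduceSub, Nat.reduceMul, if_true, if_false, lamVar_const, Nat.cast_ofNat, Nat.cast_one,
    Nat.cast_zero, oddSum, A2, p'_eq, Matrix.of_apply, Matrix.cons_val, vf_expand,
    rhoPullback_expand, rhoPullback_lamVar, polyVal_expand x] at h ⊢
  linear_combination 6 * h

theorem lie_field2_field10 : ⁅field2, field10⁆ =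
    evenSum (structUpper 1 5) + (1 / 2 : ℂ) • oddSum (A2 3) := by
  refine field_ext fun f => poly_ext fun x => ?_
  have h : polyVal x (field12 f) = polyVal x (field12 f) := rfl
  conv_lhs at h => rw [field12]
  simp only [evenSum, structUpper, structCoef, Nat.reduceAdd, Nat.reduceLeDiff, Nat.reduceEqDiff,
    Nat.reduceSub, Nat.reduceMul, if_true, if_false, lamVar_const, Nat.cast_ofNat, Nat.cast_one,
    Nat.cast_zero, oddSum, A2, p'_eq, Matrix.of_apply, Matrix.cons_val, vf_expand,
    rhoPullback_expand, rhoPullback_lamVar, polyVal_expand x] at h ⊢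
  linear_combination 8 * h

theorem lie_field2_field12 : ⁅field2, field12⁆ =
    evenSum (structUpper 1 6) + (1 / 2 : ℂ) • oddSum (A2 4) := by
  refine field_ext fun f => poly_ext fun x => ?_
  have h : polyVal x (field14 f) = polyVal x (field14 f) := rfl
  conv_lhs at h => rw [field14]
  simp only [evenSum, structUpper, structCoef, Nat.reduceAdd, Nat.reduceLeDiff, Nat.reduceEqDiff,
    Nat.reduceSub, Nat.reduceMul, if_true, if_false, lamVar_const, Nat.cast_ofNat, Nat.cast_one,
    Nat.cast_zero, oddSum, A2, p'_eq, Matrix.of_apply, Matrix.cons_val, vf_expand,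
    rhoPullback_expand, rhoPullback_lamVar, polyVal_expand x] at h ⊢
  linear_combination 10 * h

/-- In the general formula with first index `0` only the term with `λ₀ = 1` survives; the term just
below it carries the factor `λ₂ = 0`. -/
theorem lie_base_zero {k : ℕ} (h0 : 0 < k) (hk : k < 8) :
    ⁅base 0, base k⁆ = (2 * k : ℂ) • base k := by
  have ext {U W : PolyField (Fin 8)} (h : ∀ f, U f = W f) : U = W :=
    base_ext ⟨h _, h _, h _, h _, h _, h _, h _, h _⟩
  rw [lie_base h0 hk]
  interval_cases k <;>
  · refine ext fun f => poly_ext fun x => ?_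
    simp only [baseSum, structUpper, structCoef, Nat.reduceAdd, Nat.reduceLeDiff,
      Nat.reduceEqDiff, Nat.reduceSub, Nat.reduceMul, if_true, if_false, lamVar_const,
      vf_expand, Nat.cast_ofNat, Nat.cast_one, Nat.cast_zero, polyVal_expand x]
    ring1

/-- The weight of an entry is the difference of the weights of `D_{2k+3}` and `D_{2i+1}`. It is
written as a difference in `ℂ` because it is negative at some of the zero entries. -/
theorem euler_M1 (k : Fin 7) (i : Fin 4) :
    euler (M1 k i) = C (2 * (k + 1 : ℂ) - 2 * i) * M1 k i := by
  refine poly_ext fun x => ?_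
  fin_cases k <;> fin_cases i <;>
    norm_num [M1, vf_expand, euler_b, polyVal_expand x]

/-- A criterion for the homogeneity of an even field. -/
theorem lie_euler_eq {F : BField} {k : Fin 7} {m : ℕ} {c : ℂ} (hF : Projects F (base m))
    (h : OddRelations F k) (hm : m = k + 1) (hc : c = 2 * m)
    (h11 : euler (F (b 1 1)) = C (c + 2) * F (b 1 1)) : ⁅euler, F⁆ = c • F := by
  -- Rigidity again: the common pushforward is `2m L_{2m}`, the bracket with `odd1` is homogeneous
  -- because the entries of `M1` are, and `h11` is homogeneity of the single polynomial `F (b 1 1)`.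
  refine vf_eq_of_projects (euler_projects.lie hF)
    ((hF.scalar_smul _).congr (hc ▸ (lie_base_zero (by omega) (by omega)).symm)) (fun f => ?_) ?_
  · refine poly_ext fun x => ?_
    simp only [vf_lie_apply, vf_expand, odd_euler, lie_apply h.one, oddSum, euler_M1,
      polyVal_expand x, hc, hm, Nat.cast_add, Nat.cast_one]
    norm_num
    ring1
  · refine poly_ext fun x => ?_
    simp only [vf_lie_apply, vf_expand, euler_b, h11, polyVal_expand x]
    ring1

theorem lie_euler_field2 : ⁅euler, field2⁆ = (2 : ℂ) • field2 := by
  refine lie_euler_eq field2_projects field2_odd rfl (by norm_num) (poly_ext fun x => ?_)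
  simp only [field2_b_one, euler_b, vf_expand, polyVal_expand x]
  ring1

theorem lie_euler_field4 : ⁅euler, field4⁆ = (4 : ℂ) • field4 := by
  refine lie_euler_eq field4_projects field4_odd rfl (by norm_num) (poly_ext fun x => ?_)
  simp only [field4_b_one, euler_b, vf_expand, polyVal_expand x]
  ring1

theorem lie_euler_field6 : ⁅euler, field6⁆ = (6 : ℂ) • field6 := by
  refine lie_euler_eq field6_projects field6_odd rfl (by norm_num) (poly_ext fun x => ?_)
  simp only [field6_b_one, euler_b, vf_expand, polyVal_expand x]
  ring1

theorem lie_euler_field8 : ⁅euler, field8⁆ = (8 : ℂ) • field8 := by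
  refine lie_euler_eq field8_projects field8_odd rfl (by norm_num) (poly_ext fun x => ?_)
  simp only [field8_b_one, euler_b, vf_expand, polyVal_expand x]
  ring1

theorem lie_euler_field10 : ⁅euler, field10⁆ = (10 : ℂ) • field10 := by
  refine lie_euler_eq field10_projects field10_odd rfl (by norm_num) (poly_ext fun x => ?_)
  simp only [field10_b_one, euler_b, vf_expand, polyVal_expand x]
  ring1

theorem lie_euler_field12 : ⁅euler, field12⁆ = (12 : ℂ) • field12 := by
  refine lie_euler_eq field12_projects field12_odd rfl (by norm_num) (poly_ext fun x => ?_)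
  simp only [field12_b_one, euler_b, vf_expand, polyVal_expand x]
  ring1

theorem lie_euler_field14 : ⁅euler, field14⁆ = (14 : ℂ) • field14 := by
  refine lie_euler_eq field14_projects field14_odd rfl (by norm_num) (poly_ext fun x => ?_)
  simp only [field14_b_one, euler_b, vf_expand, polyVal_expand x]
  ring1

/-! ### The family of vector fields -/

/-- The family of vector fields `D_s`. -/
noncomputable def fieldFamily : ℕ → VF
  | 0 => euler
  | 1 => odd1
  | 2 => field2
  | 3 => odd3
  | 4 => field4
  | 5 => odd5
  | 6 => field6
  | 7 => odd7
  | 8 => field8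
  | 10 => field10
  | 12 => field12
  | 14 => field14
  -- Values outside the index set are irrelevant; uniqueness is claimed on `indices` only.
  | _ => 0

theorem oddSum_M1 : oddSum (M1 0) = b 1 1 • odd1 - odd3 ∧
    oddSum (M1 1) = b 1 3 • odd1 + b 1 1 • odd3 - odd5 := by
  constructor <;> refine field_ext fun f => ?_ <;>
  · simp only [oddSum, M1, Matrix.of_apply, Matrix.cons_val, vf_expand]
    ring1

theorem fieldFamily_isDetermined : IsDetermined fieldFamily where
  eq_zero := rfl
  eq_one := rfl
  eq_three := rfl
  eq_five := rfl
  eq_seven := rfl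
  two_one := (liftField_b_one values2 _).1
  two_three := (liftField_b_one values2 _).2.1
  two_five := (liftField_b_one values2 _).2.2.1
  two_seven := (liftField_b_one values2 _).2.2.2
  four_one := (liftField_b_one values4 _).1
  four_three := (liftField_b_one values4 _).2.1
  four_five := (liftField_b_one values4 _).2.2.1
  four_seven := (liftField_b_one values4 _).2.2.2
  -- Among the defining conditions only the two brackets with `D₁` require an argument; the others
  -- hold by construction.
  lie_one_two := lie_odd1_field2.trans oddSum_M1.1
  lie_one_four := lie_odd1_field4.trans oddSum_M1.2
  six := rfl
  eight := rfl
  ten := rfl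
  twelve := rfl
  fourteen := rfl

/-- The defining conditions determine the fields. -/
theorem IsDetermined.eq_fieldFamily {D : ℕ → VF} (hD : IsDetermined D) :
    ∀ s ∈ indices, D s = fieldFamily s := by
  have h := fieldFamily_isDetermined
  have h0 : D 0 = fieldFamily 0 := hD.eq_zero
  have h1 : D 1 = fieldFamily 1 := hD.eq_one
  have h3 : D 3 = fieldFamily 3 := hD.eq_three
  have h5 : D 5 = fieldFamily 5 := hD.eq_five
  have h7 : D 7 = fieldFamily 7 := hD.eq_seven
  -- `D₂` and `D₄` are given on `b_{1,j}` alone; the bracket with `D₁` transports equality to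
  -- `b_{2,j}` and `b_{3,j}`.
  have h2 : D 2 = fieldFamily 2 := by
    refine vf_eq_of_lie_odd1_of_b (U := D 2) (W := fieldFamily 2) ?_
      ⟨hD.two_one.trans h.two_one.symm, hD.two_three.trans h.two_three.symm,
        hD.two_five.trans h.two_five.symm, hD.two_seven.trans h.two_seven.symm⟩
    have e := hD.lie_one_two
    rw [h1, h3] at e
    exact e.trans h.lie_one_two.symm
  have h4 : D 4 = fieldFamily 4 := by
    refine vf_eq_of_lie_odd1_of_b (U := D 4) (W := fieldFamily 4) ?_
      ⟨hD.four_one.trans h.four_one.symm, hD.four_three.trans h.four_three.symm,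
        hD.four_five.trans h.four_five.symm, hD.four_seven.trans h.four_seven.symm⟩
    have e := hD.lie_one_four
    rw [h1, h3, h5] at e
    exact e.trans h.lie_one_four.symm
  have h6 : D 6 = fieldFamily 6 := by rw [hD.six, h.six, h0, h1, h2, h3, h4]
  have h8 : D 8 = fieldFamily 8 := by rw [hD.eight, h.eight, h0, h1, h2, h3, h4, h5, h6]
  have h10 : D 10 = fieldFamily 10 := by
    rw [hD.ten, h.ten, h0, h1, h2, h3, h5, h6, h7, h8]
  have h12 : D 12 = fieldFamily 12 := by
    rw [hD.twelve, h.twelve, h0, h1, h2, h3, h5, h7, h8, h10]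
  have h14 : D 14 = fieldFamily 14 := by
    rw [hD.fourteen, h.fourteen, h0, h1, h2, h5, h7, h10, h12]
  intro s hs
  simp only [indices, Finset.mem_insert, Finset.mem_singleton] at hs
  rcases hs with rfl | rfl | rfl | rfl | rfl | rfl | rfl | rfl | rfl | rfl | rfl | rfl <;>
    assumption

theorem fieldFamily_odd_projects (t : Fin 4) : HasPushforward (fieldFamily (2 * t + 1)) 0 :=
  match t with
  | 0 => odd1_projects
  | 1 => odd3_projects
  | 2 => odd5_projects
  | 3 => odd7_projects

theorem fieldFamily_even_projects (k : Fin 8) : HasPushforward (fieldFamily (2 * k)) (L k) :=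
  match k with
  | 0 => euler_projects
  | 1 => field2_projects
  | 2 => field4_projects
  | 3 => field6_projects
  | 4 => field8_projects
  | 5 => field10_projects
  | 6 => field12_projects
  | 7 => field14_projects

/-! ### The commutation relations -/

/-- The structure polynomials `c_{2i,2j}^{2k}`. -/
noncomputable def structPoly (i j k : Fin 8) : ParamRing :=
  if i < j then structUpper i j k else if j < i then - structUpper j i k else 0

theorem structPoly_isStructurePolynomials : IsStructurePolynomials structPoly := by
  have key {i j : Fin 8} (h : i < j) : ⁅L i, L j⁆ = ∑ k : Fin 8, structUpper i j k • L k := by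
    rw [Fin.sum_univ_eight]
    exact lie_base h j.2
  intro i j
  rcases lt_trichotomy i j with h | rfl | h
  · simp only [structPoly, if_pos h, key h]
  · simp only [structPoly, lt_irrefl, if_false, zero_smul, Finset.sum_const_zero, lie_self]
  · rw [← lie_skew, key h]
    simp only [structPoly, if_pos h, if_neg h.not_gt]
    rw [← Finset.sum_neg_distrib]
    exact Finset.sum_congr rfl fun k _ => (neg_smul _ _).symm

theorem C2_eq (j : Fin 6) (k : Fin 8) : C2 j k = structUpper 1 (j + 2) k := by
  refine poly_ext fun x => ?_
  have h (n : ℕ) [n.AtLeastTwo] : polyVal x (OfNat.ofNat n) = OfNat.ofNat n :=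
    map_ofNat (eval x) n
  fin_cases j <;> fin_cases k <;>
    norm_num [C2, structUpper, structCoef, lamVar_const, polyVal_expand x, h] <;> ring

theorem oddComb_fieldFamily (r : Fin 4 → BRing) : oddComb fieldFamily r = oddSum r :=
  Fin.sum_univ_four _

theorem evenComb_fieldFamily (a : ℕ → ParamRing) :
    evenComb fieldFamily (fun k => a k) = evenSum a :=
  Fin.sum_univ_eight _

theorem fieldFamily_oddRelations (k : Fin 7) : OddRelations (fieldFamily (2 * k + 2)) k :=
  match k with
  | 0 => field2_odd
  | 1 => field4_odd
  | 2 => field6_odd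
  | 3 => field8_odd
  | 4 => field10_odd
  | 5 => field12_odd
  | 6 => field14_odd

theorem fieldFamily_lie_two (j : Fin 6) :
    Eq (α := VF) ⁅fieldFamily 2, fieldFamily (2 * j + 4)⁆
      (evenSum (structUpper 1 (j + 2)) + (1 / 2 : ℂ) • oddSum (A2 j)) :=
  match j with
  | 0 => lie_field2_field4
  | 1 => lie_field2_field6
  | 2 => lie_field2_field8
  | 3 => lie_field2_field10
  | 4 => lie_field2_field12
  | 5 => lie_field2_field14

theorem fieldFamily_lie_even {m n : ℕ} (hm : 2 ≤ m) (hmn : m < n) (hn : n < 8) :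
    Eq (α := VF) ⁅fieldFamily (2 * m), fieldFamily (2 * n)⁆ (evenSum (structUpper m n) +
      (1 / 4 : ℂ) • oddSum (fourA (fun i j k => fieldFamily i (p j k)) (2 * m) (2 * n))) := by
  interval_cases n <;> interval_cases m
  exacts [lie_field4_field6, lie_field4_field8, lie_field6_field8, lie_field4_field10,
    lie_field6_field10, lie_field8_field10, lie_field4_field12, lie_field6_field12,
    lie_field8_field12, lie_field10_field12, lie_field4_field14, lie_field6_field14,
    lie_field8_field14, lie_field10_field14, lie_field12_field14]

theorem fieldFamily_lie_zero : ∀ k ∈ indices, ⁅fieldFamily 0, fieldFamily k⁆ =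
    (k : ℂ) • fieldFamily k := by
  intro s hs
  simp only [indices, Finset.mem_insert, Finset.mem_singleton] at hs
  rcases hs with rfl | rfl | rfl | rfl | rfl | rfl | rfl | rfl | rfl | rfl | rfl | rfl
  · simp
  · rw [Nat.cast_one, one_smul]; exact lie_euler_odd1
  exacts [lie_euler_field2, lie_euler_odd3, lie_euler_field4, lie_euler_odd5, lie_euler_field6,
    lie_euler_odd7, lie_euler_field8, lie_euler_field10, lie_euler_field12, lie_euler_field14]

theorem fieldFamily_lie_odd (k m : Fin 4) :
    ⁅fieldFamily (2 * k + 1), fieldFamily (2 * m + 1)⁆ = 0 := by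
  have skew {U W : VF} (h : ⁅U, W⁆ = 0) : ⁅W, U⁆ = 0 := by rw [← lie_skew, h, neg_zero]
  have h1 : ⁅fieldFamily 1, fieldFamily 3⁆ = 0 := lie_odd1_three
  have h2 : ⁅fieldFamily 1, fieldFamily 5⁆ = 0 := lie_odd1_five
  have h3 : ⁅fieldFamily 1, fieldFamily 7⁆ = 0 := lie_odd1_seven
  have h4 : ⁅fieldFamily 3, fieldFamily 5⁆ = 0 := lie_three_five
  have h5 : ⁅fieldFamily 3, fieldFamily 7⁆ = 0 := lie_three_seven
  have h6 : ⁅fieldFamily 5, fieldFamily 7⁆ = 0 := lie_five_seven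
  fin_cases k <;> fin_cases m
  exacts [lie_self _, h1, h2, h3, skew h1, lie_self _, h4, h5, skew h2, skew h4, lie_self _, h6,
    skew h3, skew h5, skew h6, lie_self _]

theorem fieldFamily_commutationRelations : CommutationRelations structPoly fieldFamily where
  lie_zero := fieldFamily_lie_zero
  lie_odd := fieldFamily_lie_odd
  lie_one k := by rw [oddComb_fieldFamily]; exact (fieldFamily_oddRelations k).one
  lie_three k := by rw [oddComb_fieldFamily]; exact (fieldFamily_oddRelations k).three
  lie_five k := by rw [oddComb_fieldFamily]; exact (fieldFamily_oddRelations k).five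
  lie_seven k := by rw [oddComb_fieldFamily]; exact (fieldFamily_oddRelations k).seven
  lie_two j := by
    have h : C2 j = fun k : Fin 8 => structUpper 1 (j + 2) k := funext (C2_eq j)
    rw [oddComb_fieldFamily, h, evenComb_fieldFamily]
    exact fieldFamily_lie_two j
  lie_even m n hm hmn := by
    have h : structPoly m n = fun k : Fin 8 => structUpper m n k :=
      funext fun k => if_pos hmn
    rw [oddComb_fieldFamily, h, evenComb_fieldFamily]
    exact fieldFamily_lie_even hm hmn n.2

theorem structPoly_one (j : Fin 6) (k : Fin 8) : structPoly 1 (Fin.natAdd 2 j) k = C2 j k := by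
  have h : (1 : Fin 8) < Fin.natAdd 2 j := by
    rw [Fin.lt_def, Fin.val_natAdd]
    exact Nat.lt_of_lt_of_le one_lt_two (Nat.le_add_right 2 j)
  rw [C2_eq, structPoly, if_pos h, Fin.val_natAdd, add_comm 2]
  rfl

/-! ### Homogeneity -/

/-- Monomials are eigenvectors of the Euler field: by Leibniz the eigenvalue is additive in the
exponent, as is the weight, so single powers decide. -/
theorem eulerField_monomial (d : Idx →₀ ℕ) :
    eulerField (monomial d 1) = C (Finsupp.weight wt d : ℂ) * monomial d 1 := by
  induction d using Finsupp.induction_linear with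
  | zero =>
    have h : (monomial (0 : Idx →₀ ℕ) 1 : BRing) = 1 := rfl
    rw [h, Derivation.map_one_eq_zero, map_zero, Nat.cast_zero, C_0, zero_mul]
  | add d e hd he =>
    have h : (monomial (d + e) 1 : BRing) = monomial d 1 * monomial e 1 := by
      rw [monomial_mul, one_mul]
    rw [h, Derivation.leibniz, hd, he, smul_eq_mul, smul_eq_mul, map_add, Nat.cast_add, C_add]
    ring
  | single i n =>
    have h : (monomial (Finsupp.single i n) 1 : BRing) = X i ^ n := (X_pow_eq_monomial ..).symm
    rw [h, Derivation.leibniz_pow, eulerField, mkDerivation_X, Finsupp.weight_single]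
    rcases n with _ | n
    · simp
    · simp only [Nat.add_sub_cancel, smul_eq_mul, nsmul_eq_mul, Nat.cast_mul, C_mul, map_natCast,
        pow_succ]
      ring

theorem coeff_eulerField (f : BRing) (d : Idx →₀ ℕ) :
    coeff d (eulerField f) = (Finsupp.weight wt d : ℂ) * coeff d f := by
  induction f using MvPolynomial.induction_on' with
  | monomial e a =>
    have h : (monomial e a : BRing) = C a * monomial e 1 := by rw [C_mul_monomial, mul_one]
    rw [h, Derivation.leibniz, eulerField_monomial, derivation_C, smul_zero, add_zero, smul_eq_mul,
      coeff_C_mul, coeff_C_mul, coeff_C_mul, coeff_monomial]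
    split_ifs with hde
    · rw [hde]; ring
    · ring
  | add f g hf hg => rw [map_add, coeff_add, coeff_add, hf, hg, mul_add]

/-- The converse of Euler's identity. A nonzero coefficient can be cancelled from `weight * coeff =
n * coeff`, and naturals embed in `ℂ`. -/
theorem isWeightedHomogeneous_of_eulerField {f : BRing} {n : ℕ}
    (h : eulerField f = (n : BRing) * f) : IsWeightedHomogeneous wt f n := by
  intro d hd
  have e := coeff_eulerField f d
  rw [h, ← map_natCast C n, coeff_C_mul] at e
  exact_mod_cast (mul_right_cancel₀ hd e).symm

/-- Applied to `X i`, the relation says that `U (X i)` is an eigenvector of the Euler field, the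
eigenvalue being the weight of `X i` increased by `s`. -/
theorem isWeightedHomogeneous_of_lie_eulerField {U : VF} {s : ℕ} (h : ⁅eulerField, U⁆ = (s : ℂ) • U)
    (i : Idx) : IsWeightedHomogeneous wt (U (X i)) (wt i + s) := by
  refine isWeightedHomogeneous_of_eulerField ?_
  have e := DFunLike.congr_fun h (X i)
  rw [Derivation.commutator_apply, Derivation.smul_apply, eulerField, mkDerivation_X,
    Derivation.leibniz, Derivation.map_natCast, smul_zero, add_zero, smul_eq_mul, smul_eq_C_mul,
    map_natCast] at e
  rw [eulerField, Nat.cast_add]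
  linear_combination e

/-! ### The module generated by the fields -/

/-- From `[U, fW] = f[U, W] + U(f)W` the new term stays in the span, so brackets of generators
suffice. The bracket is not linear over `BRing`; skew symmetry transfers the argument to the left
slot. -/
theorem lie_mem_span {S : Set VF} (h : ∀ U ∈ S, ∀ W ∈ S, ⁅U, W⁆ ∈ Submodule.span BRing S) {U W : VF}
    (hU : U ∈ Submodule.span BRing S) (hW : W ∈ Submodule.span BRing S) :
    ⁅U, W⁆ ∈ Submodule.span BRing S := by
  have smul_lie (f : BRing) (U W : VF) : ⁅U, f • W⁆ = f • ⁅U, W⁆ + U f • W := by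
    refine Derivation.ext fun g => ?_
    simp only [Derivation.commutator_apply, Derivation.add_apply, Derivation.smul_apply,
      smul_eq_mul, Derivation.leibniz]
    ring
  have lie_add (U W V : VF) : ⁅U, W + V⁆ = ⁅U, W⁆ + ⁅U, V⁆ := by
    refine Derivation.ext fun g => ?_
    simp only [Derivation.commutator_apply, Derivation.add_apply, map_add]
    ring
  have lie_zero (U : VF) : ⁅U, (0 : VF)⁆ = 0 := by
    have e := lie_add U 0 0
    rwa [add_zero, right_eq_add] at e
  have skew {U W : VF} (h : ⁅W, U⁆ ∈ Submodule.span BRing S) :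
      ⁅U, W⁆ ∈ Submodule.span BRing S := by
    rw [← lie_skew]; exact neg_mem h
  induction hW using Submodule.span_induction with
  | zero => rw [lie_zero]; exact zero_mem _
  | add W V _ _ h1 h2 => rw [lie_add]; exact add_mem h1 h2
  | smul f W hW h1 =>
    rw [smul_lie]
    exact add_mem (Submodule.smul_mem _ f h1) (Submodule.smul_mem _ _ hW)
  | mem W hW =>
    induction hU using Submodule.span_induction with
    | zero => refine skew ?_; rw [lie_zero]; exact zero_mem _
    | add U V _ _ h1 h2 => refine skew ?_; rw [lie_add]; exact add_mem (skew h1) (skew h2)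
    | smul f U hU h1 =>
      refine skew ?_
      rw [smul_lie]
      exact add_mem (Submodule.smul_mem _ f (skew h1)) (Submodule.smul_mem _ _ hU)
    | mem U hU => exact h U hU W hW

theorem mem_indices {s : ℕ} (hs : s ∈ indices) :
    (∃ t : Fin 4, s = 2 * (t : ℕ) + 1) ∨ ∃ k : Fin 8, s = 2 * (k : ℕ) := by
  revert s
  decide

theorem odd_mem_indices (t : Fin 4) : 2 * (t : ℕ) + 1 ∈ indices := by
  revert t; decide

theorem even_mem_indices (k : Fin 8) : 2 * (k : ℕ) ∈ indices := by
  revert k; decide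

/-- The module generated by fields with the stated commutation relations is a Lie algebra. -/
theorem CommutationRelations.lie_mem_span {c : Fin 8 → Fin 8 → Fin 8 → ParamRing} {D : ℕ → VF}
    (h : CommutationRelations c D) {U W : VF}
    (hU : U ∈ Submodule.span BRing (D '' (indices : Set ℕ)))
    (hW : W ∈ Submodule.span BRing (D '' (indices : Set ℕ))) :
    ⁅U, W⁆ ∈ Submodule.span BRing (D '' (indices : Set ℕ)) := by
  refine Genus4.lie_mem_span ?_ hU hW
  obtain ⟨N, hN⟩ : ∃ N, N = Submodule.span BRing (D '' (indices : Set ℕ)) := ⟨_, rfl⟩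
  rw [← hN]
  have mem {s : ℕ} (hs : s ∈ indices) : D s ∈ N :=
    hN ▸ Submodule.subset_span (Set.mem_image_of_mem D hs)
  have scal (a : ℂ) {V : VF} (hV : V ∈ N) : a • V ∈ N := by
    rw [← algebraMap_smul BRing a V]
    exact N.smul_mem _ hV
  have odd (r : Fin 4 → BRing) : oddComb D r ∈ N :=
    sum_mem fun t _ => N.smul_mem _ (mem (odd_mem_indices t))
  have even (a : Fin 8 → ParamRing) : evenComb D a ∈ N :=
    sum_mem fun k _ => N.smul_mem _ (mem (even_mem_indices k))
  have skew {V V' : VF} (hV : ⁅V, V'⁆ ∈ N) : ⁅V', V⁆ ∈ N := by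
    rw [← lie_skew]; exact neg_mem hV
  have zero_left {s : ℕ} (hs : s ∈ indices) : ⁅D 0, D s⁆ ∈ N :=
    h.lie_zero s hs ▸ scal _ (mem hs)
  have odd_even (t : Fin 4) (k : Fin 7) : ⁅D (2 * (t : ℕ) + 1), D (2 * (k : ℕ) + 2)⁆ ∈ N := by
    have h1 : ⁅D 1, D (2 * (k : ℕ) + 2)⁆ ∈ N := h.lie_one k ▸ odd _
    have h3 : ⁅D 3, D (2 * (k : ℕ) + 2)⁆ ∈ N := h.lie_three k ▸ add_mem (scal _ (odd _))
      (scal _ (N.smul_mem _ (mem (odd_mem_indices 0))))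
    have h5 : ⁅D 5, D (2 * (k : ℕ) + 2)⁆ ∈ N := h.lie_five k ▸ add_mem (scal _ (odd _))
      (scal _ (N.smul_mem _ (mem (odd_mem_indices 1))))
    have h7 : ⁅D 7, D (2 * (k : ℕ) + 2)⁆ ∈ N := h.lie_seven k ▸ add_mem (scal _ (odd _))
      (scal _ (N.smul_mem _ (mem (odd_mem_indices 2))))
    fin_cases t <;> assumption
  have two_even (j : Fin 6) : ⁅D 2, D (2 * (j : ℕ) + 4)⁆ ∈ N :=
    h.lie_two j ▸ add_mem (even _) (scal _ (odd _))
  -- The relations are recorded separately for `D₀`, `D₂` and the remaining even fields; the case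
  -- distinction on `m` selects the right record.
  have lt_mem (m n : Fin 8) (hmn : m < n) : ⁅D (2 * (m : ℕ)), D (2 * (n : ℕ))⁆ ∈ N := by
    obtain ⟨m, hm⟩ := m
    obtain ⟨n, hn⟩ := n
    have hlt : m < n := hmn
    match m with
    | 0 => exact zero_left (even_mem_indices ⟨n, hn⟩)
    | 1 =>
      obtain ⟨j, rfl⟩ := Nat.exists_eq_add_of_le' hlt
      exact two_even ⟨j, by omega⟩
    | m + 2 =>
      have h2 : (2 : Fin 8) ≤ ⟨m + 2, hm⟩ := Nat.le_add_left 2 m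
      exact h.lie_even ⟨m + 2, hm⟩ ⟨n, hn⟩ h2 hmn ▸ add_mem (even _) (scal _ (odd _))
  rintro _ ⟨s, hs, rfl⟩ _ ⟨u, hu, rfl⟩
  have odd_all (t : Fin 4) {u : ℕ} (hu : u ∈ indices) : ⁅D (2 * (t : ℕ) + 1), D u⁆ ∈ N := by
    rcases mem_indices hu with ⟨m, rfl⟩ | ⟨⟨k, hk⟩, rfl⟩
    · rw [h.lie_odd]; exact zero_mem _
    · match k with
      | 0 => exact skew (zero_left (odd_mem_indices t))
      | k + 1 => exact odd_even t ⟨k, by omega⟩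
  rcases mem_indices hs with ⟨t, rfl⟩ | ⟨m, rfl⟩
  · exact odd_all t hu
  rcases mem_indices hu with ⟨t, rfl⟩ | ⟨n, rfl⟩
  · exact skew (odd_all t hs)
  rcases lt_trichotomy m n with hmn | rfl | hmn
  · exact lt_mem m n hmn
  · rw [lie_self]; exact zero_mem _
  · exact skew (lt_mem n m hmn)

/-! ### Uniqueness of the structure polynomials -/

/-- The matrix of the fields `L_{2k}` has nonzero determinant. -/
theorem det_v_ne_zero : (Matrix.of fun k i : Fin 8 => v (k + 1) (i + 1)).det ≠ 0 := by
  intro h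
  -- At the curve `y² = x⁹ + 1` every `λ_s` with `4 ≤ s < 18` vanishes. The only surviving entries
  -- of `v` are `18 λ₁₈` on the antidiagonal.
  obtain ⟨x, hx⟩ : ∃ x : Fin 8 → ℂ, x = ![0, 0, 0, 0, 0, 0, 0, 1] := ⟨_, rfl⟩
  obtain ⟨A, hA⟩ : ∃ A : Matrix (Fin 8) (Fin 8) ℂ,
    A = (Matrix.of fun k i : Fin 8 => v (k + 1) (i + 1)).map (eval x) := ⟨_, rfl⟩
  have hlam : polyVal x (lamVar 4) = 0 ∧ polyVal x (lamVar 6) = 0 ∧ polyVal x (lamVar 8) = 0 ∧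
      polyVal x (lamVar 10) = 0 ∧ polyVal x (lamVar 12) = 0 ∧ polyVal x (lamVar 14) = 0 ∧
      polyVal x (lamVar 16) = 0 ∧ polyVal x (lamVar 18) = 1 := by
    simp [polyVal, lamVar, hx]
  have entry (k i : Fin 8) : A k i = if k = Fin.rev i then 18 else 0 := by
    have e : A k i = polyVal x (v (k + 1) (i + 1)) := by rw [hA]; rfl
    rw [e]
    fin_cases k <;> fin_cases i <;>
      simp [v_upper, v_lower, polyVal_expand x, hlam, Fin.rev]
  have hdet : A.det = 0 := by
    have e := (RingHom.map_det (eval x) (Matrix.of fun k i : Fin 8 => v (k + 1) (i + 1))).symm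
    rw [h, map_zero] at e
    rw [hA]
    exact e
  -- An antidiagonal matrix with equal entries squares to a scalar, here `18² = 324`, which excludes
  -- a zero determinant without expanding one.
  have hA2 : A * A = (324 : ℂ) • (1 : Matrix (Fin 8) (Fin 8) ℂ) := by
    ext k i
    simp only [Matrix.mul_apply, entry, Matrix.smul_apply, Matrix.one_apply, smul_eq_mul]
    simp only [mul_ite, ite_mul, mul_zero, zero_mul]
    rw [Finset.sum_eq_single (Fin.rev i)]
    · simp only [Fin.rev_rev, if_true]
      split_ifs <;> norm_num
    · intro j _ hj
      rw [if_neg hj]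
    · intro hj
      exact absurd (Finset.mem_univ _) hj
  have e := congrArg Matrix.det hA2
  rw [Matrix.det_mul, hdet, mul_zero, Matrix.det_smul, Matrix.det_one] at e
  norm_num at e

theorem L_sum_apply (a : Fin 8 → ParamRing) (i : Fin 8) : (∑ k : Fin 8, a k • L k) (X i) =
    Matrix.vecMul a (Matrix.of fun k i : Fin 8 => v (k + 1) (i + 1)) i := by
  have h1 : ((a 0 • base 0 + a 1 • base 1 + a 2 • base 2 + a 3 • base 3 + a 4 • base 4 +
      a 5 • base 5 + a 6 • base 6 + a 7 • base 7 : PolyField (Fin 8)) (X i)) =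
      ∑ k : Fin 8, a k * v (k + 1) (i + 1) := by
    have hL (k : ℕ) : base k (X i) = v (k + 1) (i + 1) := mkDerivation_X _ _ _
    simp only [vf_expand, hL, Fin.sum_univ_eight]
    rfl
  rw [Fin.sum_univ_eight]
  exact h1

/-- Coefficients act on the coordinates as a row vector times `v`; over a domain, a nonzero
determinant makes this injective even though `v` is not invertible over the ring. -/
theorem L_sum_injective {a c : Fin 8 → ParamRing}
    (h : ∑ k : Fin 8, a k • L k = ∑ k : Fin 8, c k • L k) : a = c := by
  refine sub_eq_zero.1 (Matrix.eq_zero_of_vecMul_eq_zero det_v_ne_zero ?_)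
  rw [Matrix.sub_vecMul, sub_eq_zero]
  exact funext fun i => (L_sum_apply a i).symm.trans (h ▸ L_sum_apply c i)

theorem IsStructurePolynomials.unique {c c' : Fin 8 → Fin 8 → Fin 8 → ParamRing}
    (h : IsStructurePolynomials c) (h' : IsStructurePolynomials c') : c' = c := by
  refine funext fun i => funext fun j => ?_
  have e1 : ⁅L i, L j⁆ = ∑ k : Fin 8, c i j k • L k := h i j
  have e2 : ⁅L i, L j⁆ = ∑ k : Fin 8, c' i j k • L k := h' i j
  exact L_sum_injective (e2.symm.trans e1)

/-! ### Linear independence over the nonsingular locus -/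

theorem polyVal_rhoPullback (x : Idx → ℂ) (f : ParamRing) :
    polyVal x (rhoPullback f) = polyVal (rho x) f := by
  induction f using MvPolynomial.induction_on with
  | C a => rw [rhoPullback_C]; simp only [polyVal, eval_C]
  | add f g hf hg => rw [map_add, (polyVal_expand x).1, hf, hg, (polyVal_expand (rho x)).1]
  | mul_X f i hf =>
    rw [map_mul, (polyVal_expand x).2.2.1, hf, rhoPullback_X, (polyVal_expand (rho x)).2.2.1]
    simp only [polyVal, eval_X, rho]

/-- A vector field that vanishes on the coordinates at a point vanishes there. -/
theorem polyVal_apply_eq_zero {x : Idx → ℂ} {F : BField} (h : ∀ i, polyVal x (F (X i)) = 0)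
    (f : BRing) : polyVal x (F f) = 0 := by
  induction f using MvPolynomial.induction_on with
  | C a => rw [vf_C]; exact map_zero (eval x)
  | add f g hf hg => rw [vf_map_add, (polyVal_expand x).1, hf, hg, add_zero]
  | mul_X f i hf =>
    rw [vf_leibniz, (polyVal_expand x).1, (polyVal_expand x).2.2.1, (polyVal_expand x).2.2.1, hf,
      h, mul_zero, mul_zero, add_zero]

open Polynomial in
theorem eq_zero_of_dvd_sum {n : ℕ} {P : ℂ[X]} {g : Fin n → ℂ} (hP : P.degree = n)
    (h : P ∣ ∑ i : Fin n, Polynomial.C (g i) * Polynomial.X ^ (i : ℕ)) : g = 0 := by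
  have e := Polynomial.eq_zero_of_dvd_of_degree_lt h (hP ▸ Polynomial.degree_sum_fin_lt g)
  funext i
  have c := congrArg (fun Q : ℂ[X] => Q.coeff i) e
  simpa [Polynomial.finsetSum_coeff, Polynomial.coeff_C_mul, Polynomial.coeff_X_pow, Fin.val_inj]
    using c

theorem curvePoly_eval (l : Fin 8 → ℂ) (z : ℂ) :
    (curvePoly l).eval z = z ^ 9 + (l 0 * z ^ 7 + l 1 * z ^ 6 + l 2 * z ^ 5 + l 3 * z ^ 4 +
      l 4 * z ^ 3 + l 5 * z ^ 2 + l 6 * z + l 7) := by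
  simp [curvePoly, Fin.sum_univ_eight]

theorem curvePoly_derivative_eval (l : Fin 8 → ℂ) (z : ℂ) :
    (curvePoly l).derivative.eval z = 9 * z ^ 8 + 7 * l 0 * z ^ 6 + 6 * l 1 * z ^ 5 +
      5 * l 2 * z ^ 4 + 4 * l 3 * z ^ 3 + 3 * l 4 * z ^ 2 + 2 * l 5 * z + l 6 := by
  simp [curvePoly, Fin.sum_univ_eight]
  ring

theorem curvePoly_degree (l : Fin 8 → ℂ) : (curvePoly l).degree = 9 := by
  have h : curvePoly l = Polynomial.X ^ 9 + (Polynomial.C (l 0) * Polynomial.X ^ 7 +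
      Polynomial.C (l 1) * Polynomial.X ^ 6 + Polynomial.C (l 2) * Polynomial.X ^ 5 +
      Polynomial.C (l 3) * Polynomial.X ^ 4 + Polynomial.C (l 4) * Polynomial.X ^ 3 +
      Polynomial.C (l 5) * Polynomial.X ^ 2 + Polynomial.C (l 6) * Polynomial.X +
      Polynomial.C (l 7)) := by
    simp [curvePoly, Fin.sum_univ_eight]
  rw [h]
  compute_degree!

/-- A common zero `z` of `f` and `f'` would give the singular point `(z, 0)` of the curve. -/
theorem derivative_eval_ne_zero {l : Fin 8 → ℂ} (hl : l ∈ nonsingularLocus) {z : ℂ}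
    (hz : (curvePoly l).eval z = 0) : (curvePoly l).derivative.eval z ≠ 0 :=
  fun h => hl z 0 (by rw [hz]; ring) ⟨mul_zero 2, h⟩

set_option maxRecDepth 4000 in
/-- The fields `L_{2k}` are independent at the points of the nonsingular locus. -/
theorem base_independent {l : Fin 8 → ℂ} (hl : l ∈ nonsingularLocus) {a : ℕ → ℂ}
    (h : ∀ f, polyVal l ((a 0 • base 0 + a 1 • base 1 + a 2 • base 2 + a 3 • base 3 + a 4 • base 4 +
      a 5 • base 5 + a 6 • base 6 + a 7 • base 7 : PolyField (Fin 8)) f) = 0) :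
    a 0 = 0 ∧ a 1 = 0 ∧ a 2 = 0 ∧ a 3 = 0 ∧ a 4 = 0 ∧ a 5 = 0 ∧ a 6 = 0 ∧ a 7 = 0 := by
  -- With `A = Σ a_k x^{k+1}`, these are the coefficients of `-2` times the polynomial part of `A f
  -- / x⁹`, except for the constant term. That one is adjusted so that the `x⁸` coefficient of `Q f
  -- + G f'` vanishes, as it must because `f` has no `x⁸` term.
  obtain ⟨g, hg⟩ : ∃ g : Fin 9 → ℂ, g =
    ![-(2 / 9) * (2 * a 1 * l 0 + 3 * a 2 * l 1 + 4 * a 3 * l 2 + 5 * a 4 * l 3 + 6 * a 5 * l 4 + 7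
      * a 6 * l 5 + 8 * a 7 * l 6),
      -2 * (a 0 + a 2 * l 0 + a 3 * l 1 + a 4 * l 2 + a 5 * l 3 + a 6 * l 4 + a 7 * l 5),
      -2 * (a 1 + a 3 * l 0 + a 4 * l 1 + a 5 * l 2 + a 6 * l 3 + a 7 * l 4),
      -2 * (a 2 + a 4 * l 0 + a 5 * l 1 + a 6 * l 2 + a 7 * l 3),
      -2 * (a 3 + a 5 * l 0 + a 6 * l 1 + a 7 * l 2),
      -2 * (a 4 + a 6 * l 0 + a 7 * l 1),
      -2 * (a 5 + a 7 * l 0),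
      -2 * a 6,
      -2 * a 7] := ⟨_, rfl⟩
  -- The polynomial part of `2 A f' / x⁹`. The full series would cancel in `Q f + G f'`; the
  -- truncations leave a polynomial of degree at most `7`, namely the derivative of `f` along `Σ a_k
  -- L_{2k}`.
  obtain ⟨q, hq⟩ : ∃ q : Fin 8 → ℂ, q =
    ![2 * (9 * a 0 + 7 * a 2 * l 0 + 6 * a 3 * l 1 + 5 * a 4 * l 2 + 4 * a 5 * l 3 + 3 * a 6 * l 4 +
      2 * a 7 * l 5),
      2 * (9 * a 1 + 7 * a 3 * l 0 + 6 * a 4 * l 1 + 5 * a 5 * l 2 + 4 * a 6 * l 3 + 3 * a 7 * l 4),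
      2 * (9 * a 2 + 7 * a 4 * l 0 + 6 * a 5 * l 1 + 5 * a 6 * l 2 + 4 * a 7 * l 3),
      2 * (9 * a 3 + 7 * a 5 * l 0 + 6 * a 6 * l 1 + 5 * a 7 * l 2),
      2 * (9 * a 4 + 7 * a 6 * l 0 + 6 * a 7 * l 1),
      2 * (9 * a 5 + 7 * a 7 * l 0),
      18 * a 6,
      18 * a 7] := ⟨_, rfl⟩
  have hv : polyVal l (lamVar 4) = l 0 ∧ polyVal l (lamVar 6) = l 1 ∧
      polyVal l (lamVar 8) = l 2 ∧ polyVal l (lamVar 10) = l 3 ∧ polyVal l (lamVar 12) = l 4 ∧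
      polyVal l (lamVar 14) = l 5 ∧ polyVal l (lamVar 16) = l 6 ∧ polyVal l (lamVar 18) = l 7 := by
    simp [polyVal, lamVar]
  have h0 := h (lamVar 4)
  have h1 := h (lamVar 6)
  have h2 := h (lamVar 8)
  have h3 := h (lamVar 10)
  have h4 := h (lamVar 12)
  have h5 := h (lamVar 14)
  have h6 := h (lamVar 16)
  have h7 := h (lamVar 18)
  simp only [vf_expand, base_lamVar, Nat.reduceAdd, v_upper, v_lower, polyVal_expand l, hv]
    at h0 h1 h2 h3 h4 h5 h6 h7
  have hdvd : curvePoly l ∣ ∑ i : Fin 9, Polynomial.C (g i) * Polynomial.X ^ (i : ℕ) := by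
    have hc : IsCoprime (curvePoly l) (curvePoly l).derivative := by
      rw [Polynomial.isCoprime_iff_aeval_ne_zero_of_isAlgClosed ℂ ℂ]
      intro z
      by_cases hz : (curvePoly l).eval z = 0
      · exact Or.inr (derivative_eval_ne_zero hl hz)
      · exact Or.inl hz
    refine hc.dvd_of_dvd_mul_left (Dvd.intro
      (-∑ i : Fin 8, Polynomial.C (q i) * Polynomial.X ^ (i : ℕ)) (Polynomial.funext fun z => ?_))
    simp only [Polynomial.eval_mul, Polynomial.eval_neg, Polynomial.eval_add,
      Polynomial.eval_C, Polynomial.eval_pow, Polynomial.eval_X, curvePoly_eval,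
      curvePoly_derivative_eval, Fin.sum_univ_castSucc (n := 8), Fin.sum_univ_eight, hg, hq]
    simp only [Fin.reduceCastSucc, Fin.reduceLast, Fin.coe_ofNat_eq_mod, Nat.reduceMod,
      Nat.zero_mod,
      Nat.one_mod, Fin.isValue, Fin.castSucc_zero, Matrix.cons_val]
    -- The hypotheses `h0`, …, `h7` are the coefficients of `Q f + G f'`; their vanishing gives `f ∣
    -- f' G`.
    linear_combination -z ^ 7 * h0 - z ^ 6 * h1 - z ^ 5 * h2 - z ^ 4 * h3 - z ^ 3 * h4 -
      z ^ 2 * h5 - z * h6 - h7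
  have h0 := eq_zero_of_dvd_sum (curvePoly_degree l) hdvd
  have e (i : Fin 9) : g i = 0 := congrFun h0 i
  -- `G = 0` is triangular in the `a_k`, so they vanish from the top down. The adjusted constant
  -- coefficient of `G` is not needed.
  have e7 : a 7 = 0 := by simpa [hg] using e 8
  have e6 : a 6 = 0 := by simpa [hg, e7] using e 7
  have e5 : a 5 = 0 := by simpa [hg, e7, e6] using e 6
  have e4 : a 4 = 0 := by simpa [hg, e7, e6, e5] using e 5
  have e3 : a 3 = 0 := by simpa [hg, e7, e6, e5, e4] using e 4
  have e2 : a 2 = 0 := by simpa [hg, e7, e6, e5, e4, e3] using e 3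
  have e1 : a 1 = 0 := by simpa [hg, e7, e6, e5, e4, e3, e2] using e 2
  have e0 : a 0 = 0 := by simpa [hg, e7, e6, e5, e4, e3, e2, e1] using e 1
  exact ⟨e0, e1, e2, e3, e4, e5, e6, e7⟩

/-- Three polynomials without a common zero generate the unit ideal: if `P` divides `N * V` and
`N * W`, then it divides `N`. -/
theorem dvd_of_dvd_mul_of_no_common_zero {P V W N : Polynomial ℂ}
    (h : ∀ z, P.eval z = 0 → V.eval z = 0 → W.eval z ≠ 0) (hV : P ∣ N * V) (hW : P ∣ N * W) :
    P ∣ N := by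
  classical
  have hc : IsCoprime P (EuclideanDomain.gcd V W) := by
    rw [Polynomial.isCoprime_iff_aeval_ne_zero_of_isAlgClosed ℂ ℂ]
    intro z
    simp only [Polynomial.coe_aeval_eq_eval]
    by_contra! hz
    have zero_of_dvd {Q R : Polynomial ℂ} (hQ : Q ∣ R) (h0 : Q.eval z = 0) : R.eval z = 0 := by
      obtain ⟨S, rfl⟩ := hQ
      rw [Polynomial.eval_mul, h0, zero_mul]
    exact h z hz.1 (zero_of_dvd (EuclideanDomain.gcd_dvd_left V W) hz.2)
      (zero_of_dvd (EuclideanDomain.gcd_dvd_right V W) hz.2)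
  refine hc.dvd_of_dvd_mul_right ?_
  -- By Bézout `N * gcd V W` is a combination of `N * V` and `N * W`, hence divisible by `P`, and
  -- `P` is coprime to the gcd.
  rw [EuclideanDomain.gcd_eq_gcd_ab, mul_add, ← mul_assoc, ← mul_assoc]
  exact dvd_add (hV.mul_right _) (hW.mul_right _)

/-- The odd fields are independent at the points over the nonsingular locus. -/
theorem odd_independent {x : Idx → ℂ} (hx : rho x ∈ nonsingularLocus) {c1 c3 c5 c7 : ℂ}
    (h : ∀ f, polyVal x ((c1 • odd1 + c3 • odd3 + c5 • odd5 + c7 • odd7 : BField) f) = 0) :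
    c1 = 0 ∧ c3 = 0 ∧ c5 = 0 ∧ c7 = 0 := by
  obtain ⟨β, hβ⟩ : ∃ β : ℕ → ℕ → ℂ, ∀ i j, polyVal x (b i j) = β i j := ⟨_, fun _ _ => rfl⟩
  obtain ⟨u, hu⟩ : ∃ u : Polynomial ℂ, u = Polynomial.X ^ 4 - (Polynomial.C (β 1 1) * Polynomial.X ^
    3
    + Polynomial.C (β 1 3) * Polynomial.X ^ 2 + Polynomial.C (β 1 5) * Polynomial.X +
      Polynomial.C (β 1 7)) := ⟨_, rfl⟩
  obtain ⟨V, hV⟩ : ∃ V : Polynomial ℂ, V = Polynomial.C (β 2 1) * Polynomial.X ^ 3 +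
    Polynomial.C (β 2 3) * Polynomial.X ^ 2 + Polynomial.C (β 2 5) * Polynomial.X +
      Polynomial.C (β 2 7) := ⟨_, rfl⟩
  obtain ⟨W, hW⟩ : ∃ W : Polynomial ℂ, W = Polynomial.C (β 3 1) * Polynomial.X ^ 3 +
    Polynomial.C (β 3 3) * Polynomial.X ^ 2 + Polynomial.C (β 3 5) * Polynomial.X +
      Polynomial.C (β 3 7) := ⟨_, rfl⟩
  -- The polynomial part of `u · (c₇/x + c₅/x² + c₃/x³ + c₁/x⁴)`; the leading coefficient of `u` is
  -- `1`, so `N = 0` is triangular in the `c_s`.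
  obtain ⟨n, hn⟩ : ∃ n : Fin 4 → ℂ, n = ![c1 - c3 * β 1 1 - c5 * β 1 3 - c7 * β 1 5,
    c3 - c5 * β 1 1 - c7 * β 1 3, c5 - c7 * β 1 1, c7] := ⟨_, rfl⟩
  obtain ⟨N, hN⟩ : ∃ N : Polynomial ℂ,
    N = ∑ i : Fin 4, Polynomial.C (n i) * Polynomial.X ^ (i : ℕ) := ⟨_, rfl⟩
  have hdeg : u.degree = (4 : ℕ) := by
    rw [hu]
    compute_degree!
  -- This identity encodes the formulas for all `λ_s` at once and links the coordinates `b_{i,j}` to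
  -- the curve.
  have hcurve : curvePoly (rho x) = Polynomial.C (1 / 4) * V ^ 2 + u *
      ((Polynomial.X + Polynomial.C (2 * β 1 1)) * u + Polynomial.C (1 / 2) * W) := by
    refine Polynomial.funext fun z => ?_
    have hr (i : Fin 8) : rho x i = polyVal x (lam (2 * (i : ℕ) + 4)) := rfl
    simp only [curvePoly_eval, hr, Fin.isValue, Fin.coe_ofNat_eq_mod, Nat.reduceMod, Nat.zero_mod,
      Nat.one_mod, Nat.reduceMul, Nat.reduceAdd, lam, polyVal_expand x, hβ, hu, hV, hW,
      Polynomial.eval_add, Polynomial.eval_sub, Polynomial.eval_mul, Polynomial.eval_pow,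
      Polynomial.eval_C, Polynomial.eval_X]
    ring1
  -- In `V²/4 + u(… + W/2)` every term is a product of two factors from the ideal `(u, V, W)`, so a
  -- common zero is a double root of the curve polynomial.
  have hzero (z : ℂ) (h0 : u.eval z = 0) (h1 : V.eval z = 0) : W.eval z ≠ 0 := by
    intro h2
    refine derivative_eval_ne_zero hx (z := z) ?_ ?_ <;> rw [hcurve] <;>
      simp [h0, h1, h2, Polynomial.derivative_pow]
  have h11 := h (b 1 1)
  have h13 := h (b 1 3)
  have h15 := h (b 1 5)
  have h17 := h (b 1 7)
  have h21 := h (b 2 1)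
  have h23 := h (b 2 3)
  have h25 := h (b 2 5)
  have h27 := h (b 2 7)
  simp only [vf_expand, odd1_b, odd3_b, odd5_b, odd7_b, polyVal_expand x, hβ]
    at h11 h13 h15 h17 h21 h23 h25 h27
  -- The combination of odd fields sends `u` to `S u - N V`, where `S` is the polynomial part of `V
  -- · (c₇/x + c₅/x² + c₃/x³ + c₁/x⁴)`. Since it vanishes at the point, `S` is the quotient. The
  -- same works for `N W`, with `W` in place of `V` in `S` and the values on `b_{2,j}`.
  have hNV : u ∣ N * V := by
    refine Dvd.intro (Polynomial.C (c3 * β 2 1 + c5 * β 2 3 + c7 * β 2 5) +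
      Polynomial.C (c5 * β 2 1 + c7 * β 2 3) * Polynomial.X +
      Polynomial.C (c7 * β 2 1) * Polynomial.X ^ 2) (Polynomial.funext fun z => ?_)
    simp only [hN, hn, hu, hV, Fin.sum_univ_four, Fin.isValue, Fin.coe_ofNat_eq_mod, Nat.reduceMod,
      Nat.zero_mod, Nat.one_mod, Matrix.cons_val, Polynomial.eval_add, Polynomial.eval_sub,
      Polynomial.eval_mul, Polynomial.eval_pow, Polynomial.eval_C, Polynomial.eval_X]
    linear_combination -z ^ 3 * h11 - z ^ 2 * h13 - z * h15 - h17
  have hNW : u ∣ N * W := by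
    refine Dvd.intro (Polynomial.C (c3 * β 3 1 + c5 * β 3 3 + c7 * β 3 5) +
      Polynomial.C (c5 * β 3 1 + c7 * β 3 3) * Polynomial.X +
      Polynomial.C (c7 * β 3 1) * Polynomial.X ^ 2) (Polynomial.funext fun z => ?_)
    simp only [hN, hn, hu, hW, Fin.sum_univ_four, Fin.isValue, Fin.coe_ofNat_eq_mod, Nat.reduceMod,
      Nat.zero_mod, Nat.one_mod, Matrix.cons_val, Polynomial.eval_add, Polynomial.eval_sub,
      Polynomial.eval_mul, Polynomial.eval_pow, Polynomial.eval_C, Polynomial.eval_X]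
    linear_combination -z ^ 3 * h21 - z ^ 2 * h23 - z * h25 - h27
  have hdvd := dvd_of_dvd_mul_of_no_common_zero hzero hNV hNW
  have e (i : Fin 4) : n i = 0 := congrFun (eq_zero_of_dvd_sum hdeg (hN ▸ hdvd)) i
  have e7 : c7 = 0 := by simpa [hn] using e 3
  have e5 : c5 = 0 := by simpa [hn, e7] using e 2
  have e3 : c3 = 0 := by simpa [hn, e7, e5] using e 1
  have e1 : c1 = 0 := by simpa [hn, e7, e5, e3] using e 0
  exact ⟨e1, e3, e5, e7⟩

/-- A vector field combined from the twelve fields that vanishes at a point over the nonsingular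
locus has zero coefficients. -/
theorem field_independent {x : Idx → ℂ} (hx : rho x ∈ nonsingularLocus) {a : ℕ → ℂ}
    (h : ∀ i, polyVal x ((a 0 • euler + a 2 • field2 + a 4 • field4 + a 6 • field6 + a 8 • field8 +
      a 10 • field10 + a 12 • field12 + a 14 • field14 +
      (a 1 • odd1 + a 3 • odd3 + a 5 • odd5 + a 7 • odd7) : BField) (X i)) = 0) :
    ∀ s ∈ indices, a s = 0 := by
  have h' := polyVal_apply_eq_zero h
  -- On pulled-back functions the odd fields act as zero, so the hypothesis becomes the vanishing of
  -- `Σ a_{2k} L_{2k}` at `rho x`.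
  obtain ⟨e0, e2, e4, e6, e8, e10, e12, e14⟩ := base_independent hx (a := fun k => a (2 * k))
    fun f => by
      have e := h' (rhoPullback f)
      simp only [vf_expand, euler_projects f, field2_projects f, field4_projects f,
        field6_projects f, field8_projects f, field10_projects f, field12_projects f,
        field14_projects f, odd1_projects f, odd3_projects f, odd5_projects f, odd7_projects f,
        polyVal_expand x, map_zero, polyVal_rhoPullback] at e
      simp only [vf_expand, polyVal_expand (rho x), Nat.reduceMul]
      linear_combination e
  obtain ⟨e1, e3, e5, e7⟩ := odd_independent hx (c1 := a 1) (c3 := a 3) (c5 := a 5) (c7 := a 7)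
    fun f => by
      have e := h' f
      simp only [Nat.reduceMul] at e0 e2 e4 e6 e8 e10 e12 e14
      simpa only [e0, e2, e4, e6, e8, e10, e12, e14, zero_smul, zero_add] using e
  intro s hs
  simp only [indices, Finset.mem_insert, Finset.mem_singleton] at hs
  rcases hs with rfl | rfl | rfl | rfl | rfl | rfl | rfl | rfl | rfl | rfl | rfl | rfl <;>
    assumption

theorem sum_indices (g : ℕ → ℂ) : ∑ s ∈ indices, g s =
    g 0 + g 2 + g 4 + g 6 + g 8 + g 10 + g 12 + g 14 + (g 1 + g 3 + g 5 + g 7) := by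
  simp [indices]
  ring

theorem fieldFamily_linearIndependent {x : Idx → ℂ} (hx : rho x ∈ nonsingularLocus) :
    LinearIndependent ℂ fun s : indices => valueAt (fieldFamily s) x := by
  rw [Fintype.linearIndependent_iff]
  intro g hg
  -- Coefficients are extended by zero to all of `ℕ`, so that the sum over the subtype becomes a sum
  -- over numerals.
  obtain ⟨a, ha⟩ : ∃ a : ℕ → ℂ, ∀ s : indices, a s = g s :=
    ⟨fun s => if h : s ∈ indices then g ⟨s, h⟩ else 0, fun s => dif_pos s.2⟩
  have key := field_independent hx (a := a) fun i => by
    have e := congrFun hg i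
    simp only [← ha, Finset.sum_apply, Pi.smul_apply, Pi.zero_apply, smul_eq_mul] at e
    rw [Finset.sum_coe_sort indices fun s => a s * valueAt (fieldFamily s) x i, sum_indices] at e
    simp only [vf_expand, polyVal_expand x]
    exact e
  exact fun s => (ha s).symm.trans (key s s.2)

end Genus4

open Genus4

theorem theorem8p1 :
    ∃ D : ℕ → VF,
      -- the conditions hold for `D`, and they determine the twelve fields
      IsDetermined D ∧
      (∀ D' : ℕ → VF, IsDetermined D' → ∀ s ∈ indices, D' s = D s) ∧
      -- each `D s` is homogeneous of weight `s`
      (∀ s ∈ indices, ∀ i : Idx,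
        MvPolynomial.IsWeightedHomogeneous wt (D s (MvPolynomial.X i)) (wt i + s)) ∧
      -- the fields are projectable, with pushforwards `0` and `L_{2k}`
      (∀ t : Fin 4, HasPushforward (D (2 * (t : ℕ) + 1)) 0) ∧
      (∀ k : Fin 8, HasPushforward (D (2 * (k : ℕ))) (L k)) ∧
      -- they are independent at every point over the nonsingular locus
      (∀ x : Idx → ℂ, rho x ∈ nonsingularLocus →
        LinearIndependent ℂ fun s : indices => valueAt (D s) x) ∧
      -- they generate a polynomial Lie algebra with the stated commutation relations
      (∀ U ∈ Submodule.span BRing (D '' (indices : Set ℕ)),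
        ∀ W ∈ Submodule.span BRing (D '' (indices : Set ℕ)),
          ⁅U, W⁆ ∈ Submodule.span BRing (D '' (indices : Set ℕ))) ∧
      ∃ c : Fin 8 → Fin 8 → Fin 8 → ParamRing,
        IsStructurePolynomials c ∧
        (∀ c' : Fin 8 → Fin 8 → Fin 8 → ParamRing, IsStructurePolynomials c' → c' = c) ∧
        (∀ (j : Fin 6) (k : Fin 8), c 1 (Fin.natAdd 2 j) k = C2 j k) ∧
        CommutationRelations c D := by
  have hlie := fieldFamily_commutationRelations
  refine ⟨fieldFamily, fieldFamily_isDetermined, fun D' hD' => hD'.eq_fieldFamily,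
    fun s hs i => isWeightedHomogeneous_of_lie_eulerField (hlie.lie_zero s hs) i,
    fieldFamily_odd_projects, fieldFamily_even_projects,
    fun x hx => fieldFamily_linearIndependent hx,
    fun U hU W hW => hlie.lie_mem_span hU hW,
    structPoly, structPoly_isStructurePolynomials,
    fun c' hc' => structPoly_isStructurePolynomials.unique hc', structPoly_one, hlie⟩
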